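/- **Setting.** Let $n=2^J$, $J\to\infty$. For each $n$ let $X_1,\dots,X_n$ (a triangular array) be nonnegative independent random variables with $\mathbb E X_t=\alpha(t/n)$ and $\operatorname{Var}X_t=h\{\alpha(t/n)\}$, and put $\varepsilon_t=X_t-\alpha(t/n)$. Here $\alpha:[0,1]\to\mathbb R$ and $h:[0,\infty)\to[0,\infty)$ are fixed. Write $\operatorname{range}\alpha=\{\alpha(z):z\in[0,1]\}$, $\underline\alpha=\inf\alpha$, $\overline\alpha=\sup\alpha$, and $\Phi$ for the standard normal distribution function. Fix $\epsilon\in(0,1/3]$, let $J^*=(1-\epsilon)J$ and $\mathcal I_n=\{(j,k)\in\mathbb Z^2: 0\le j\le J^*-1,\ 1\le k\le 2^j\}$. Below, $\min_j$ is over the integers $0\le j\le J^*-1$. For a half-span $M=M_n\in\mathbb N$ and a bandwidth $b=b(n)$ let $$\hat\alpha_t=\frac1{2M+1}\sum_{p=t-M}^{t+M}X_p$$ (the sum being over those $p$ with $1\le p\le n$), $\hat\varepsilon_t=X_t-\hat\alpha_t$, $$W_{nt}(u)=\frac1{nb}K\Big(\frac{\alpha(t/n)-u}{b}\Big),\qquad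 \hat W_{nt}(u)=\frac1{nb}K\Big(\frac{\hat\alpha_t-u}{b}\Big),\qquad \hat h(u)=\frac{\sum_{t=1}^n\hat W_{nt}(u)\hat\varepsilon_t^2}{\sum_{t=1}^n\hat W_{nt}(u)}$$ (with $\hat h(u)=0$ if the denominator vanishes). **Assumptions.** 1. $\alpha$ has finite total variation on $[0,1]$ and $0<\underline\alpha\le\overline\alpha<\infty$. 2. $0<\inf_{[\underline\alpha,\overline\alpha]}h\le\sup_{[\underline\alpha,\overline\alpha]}h<\infty$; $h$ is non-decreasing; $h$ is Lipschitz on $[\underline\alpha,\overline\alpha]$; and for some $\theta,\eta>0$ the function $h^\theta$ is Hölder continuous on $[0,\infty)$ with exponent $\eta$. 3. There are $\gamma\ge0$ and $K_0>0$ such that $\mathbb E|\varepsilon_t|^l\le(l!)^{1+\gamma}K_0^{l-2}h\{\alpha(t/n)\}$ for all $l=3,4,\dots$, all $t$ and all $n$. 4. For each $(j,k)\in\mathcal I_n$, the weights $\kappa_{j,k-q}\ge0$, $1\le q\le n$, satisfy $\sum_q\kappa_{j,k-q}=1$, $\sum_q\kappa_{j,k-q}^2=O(2^{j-J})$ and $\max_q\kappa_{j,k-q}=O(2^{j-J})$,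 uniformly over $(j,k)\in\mathcal I_n$ and $n$. 5. $K:\mathbb R\to[0,\infty)$ vanishes outside $[-1/2,1/2]$, is bounded, Lipschitz, and $\int K=1$. 6. $\operatorname{Var}(\varepsilon_t^2)\ge\underline c>0$ uniformly over $t$ and $n$. 7. There is $C_2>0$ such that $\operatorname{Var}(\hat\alpha_t)\le C_2\operatorname{Var}|\hat\alpha_t-\mathbb E\hat\alpha_t|$ uniformly over $t$, for all large $n$. 8. There are $a,d>0$ such that $P(\sup_{1\le t\le n}|\varepsilon_t|\le a\log^dn)=1-O(n^{-2})$. 9. There are a function $c$ and a constant $c_1$ such that, for all large $n$ (with $b=b(n)$) and all $u\in\operatorname{range}\alpha$, $0<c_1\le c(u)\le\sum_{t=1}^nW_{nt}(u)$. 10. $\sum_q\kappa_{j,k-q}\,\alpha(q/n)\in\operatorname{range}\alpha$ for all $(j,k)\in\mathcal I_n$, for all large $n$. **Theorem 2.** Let $M\to\infty$, $n/M\to\infty$, $nb\to\infty$, $b\to0$, and suppose that the assumptions above hold. Let $b_n,d_n,i_n$ be any sequences with $$b_n=o\{(n/M)^{1/(6+4\gamma)}\},\qquad d_n=o\Big\{\min_j2^{\frac{J-j}{2(1+\max(\gamma,1))}}\Big\},\qquad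 i_n=o\{(nb^2)^{1/(10+12\gamma)}\}.$$ Let $\delta=\delta(n)$, let $\delta_1=\delta_1(n)$ satisfy $0<\delta_1<c_1$, put $\delta'=\delta(c_1-\delta_1)/2$, and let $H$ be a Lipschitz constant of $h$ on $\operatorname{range}\alpha$. Assume $$\delta_1n^{1/2}b^2-Mn^{-1/2}-n^{1/2}M^{-1/2}\to\infty,\tag{12}$$ $$\delta'n^{1/2}b^2\log^{-2d}n-Mn^{-1/2}-n^{1/2}M^{-1/2}\to\infty,\tag{13}$$ $$\delta>bH\quad\text{for all large }n.\tag{14}$$ Then there are positive constants $C_3,C_4,C_5,C_6$ and $A_1,\dots,A_6$, not depending on $n$ or $(j,k)$, such that with $$\begin{aligned} a_n&=A_1\big(\delta_1n^{1/2}b^2-Mn^{-1/2}-n^{1/2}M^{-1/2}\big), & c_n&=A_2\,\delta_1b^2\min_j2^{(J-j)/2},\\ e_n&=A_3\big(\delta'n^{1/2}b^2\log^{-2d}n-Mn^{-1/2}-n^{1/2}M^{-1/2}\big), & f_n&=A_4\,\delta'b^2\min_j2^{(J-j)/2}\log^{-2d}n,\\ g_n&=A_5\big(\delta'n^{1/2}b\log^{-d}n-Mn^{-1/2}-n^{1/2}M^{-1/2}\big),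 & h_n&=A_6(\delta-bH)n^{1/2}b, \end{aligned}$$ for all sufficiently large $n$ and all $(j,k)\in\mathcal I_n$, $$\begin{aligned} P\Big(\Big|\hat h\Big(\sum_q\kappa_{j,k-q}X_q\Big)-h\Big(\sum_q\kappa_{j,k-q}\alpha(q/n)\Big)\Big|\ge\delta\Big) &\le C_3(2M+1)\{4-\Phi(\min(a_n,b_n))-2\Phi(\min(e_n,b_n))-\Phi(\min(g_n,b_n))\}\\ &\quad+C_4\{3-\Phi(\min(c_n,d_n))-2\Phi(\min(f_n,d_n))\}\\ &\quad+C_5\{1-\Phi(\min(h_n,i_n))\}+C_6n^{-2}. \end{aligned}$$ -/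

import Mathlib

open MeasureTheory ProbabilityTheory Filter Asymptotics
open scoped Topology NNReal

noncomputable section

/-- The sample size `n = 2 ^ J`. -/
def nObs (J : ℕ) : ℕ := 2 ^ J

/-- The coarse scales `0 ≤ j ≤ J* - 1`, where `2 ^ J* = n ^ (1 - ε)`, that is `J* = (1 - ε) J`. -/
def coarseScales (ε : ℝ) (J : ℕ) : Set ℕ := {j | (j : ℝ) ≤ (1 - ε) * J - 1}

/-- The index set `I_n` of the pairs `(j, k)` with `0 ≤ j ≤ J* - 1` and `1 ≤ k ≤ 2 ^ j`. -/
def coarseIndices (ε : ℝ) (J : ℕ) : Set (ℕ × ℕ) :=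
  {p | p.1 ∈ coarseScales ε J ∧ 1 ≤ p.2 ∧ p.2 ≤ 2 ^ p.1}

/-- `min_j 2 ^ (s (J - j))` over the coarse scales `j` (finitely many, and at least one as soon
as `J` is large). -/
def minScalePow (ε : ℝ) (J : ℕ) (s : ℝ) : ℝ :=
  sInf ((fun j : ℕ => (2 : ℝ) ^ (s * ((J : ℝ) - j))) '' coarseScales ε J)

/-- The distribution function `Φ` of the standard normal law. -/
def stdNormalCDF (x : ℝ) : ℝ := cdf (gaussianReal 0 1) x

/-- The design value `α (t / n)`, with `n = 2 ^ J`. -/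
def designValue (α : ℝ → ℝ) (J t : ℕ) : ℝ := α ((t : ℝ) / nObs J)

/-- The moving-average pre-fit `(2 M + 1)⁻¹ ∑_{p = t - M}^{t + M} x_p`, the sum being over the
available observations `1 ≤ p ≤ n`. -/
def movingAverage (J M : ℕ) (x : ℕ → ℝ) (t : ℕ) : ℝ :=
  (1 / (2 * (M : ℝ) + 1)) *
    ∑ p ∈ (Finset.Icc 1 (nObs J)).filter (fun p => t ≤ p + M ∧ p ≤ t + M), x p

/-- The kernel weight `(n b)⁻¹ K ((v - u) / b)`. With `v = α (t / n)` it is `W_{nt}(u)`, with `v`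
the moving average at `t` it is its empirical counterpart. -/
def kernelWeight (K : ℝ → ℝ) (J : ℕ) (b v u : ℝ) : ℝ :=
  1 / ((nObs J : ℝ) * b) * K ((v - u) / b)

/-- The Nadaraya–Watson estimator of the variance function: kernel smoothing of the squared
residuals of the moving-average pre-fit. -/
def varianceEstimator (K : ℝ → ℝ) (J M : ℕ) (b : ℝ) (x : ℕ → ℝ) (u : ℝ) : ℝ :=
  (∑ t ∈ Finset.Icc 1 (nObs J),
      kernelWeight K J b (movingAverage J M x t) u * (x t - movingAverage J M x t) ^ 2) /
    ∑ t ∈ Finset.Icc 1 (nObs J), kernelWeight K J b (movingAverage J M x t) u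

/-- The local mean `∑_q κ_{j,k-q} x_q` at `(j, k)`. The weight that the observation `q` receives
in it, usually written `κ_{j,k-q}`, is `κ j k q`. -/
def localMean (J : ℕ) (κ : ℕ → ℕ → ℕ → ℝ) (j k : ℕ) (x : ℕ → ℝ) : ℝ :=
  ∑ q ∈ Finset.Icc 1 (nObs J), κ j k q * x q

/-- `inf α` over `[0, 1]`. -/
def lowerValue (α : ℝ → ℝ) : ℝ := sInf (α '' Set.Icc 0 1)

/-- `sup α` over `[0, 1]`. -/
def upperValue (α : ℝ → ℝ) : ℝ := sSup (α '' Set.Icc 0 1)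

/-- Conditions on the mean function: finite total variation on `[0, 1]`, and
`0 < inf α ≤ sup α < ∞`. -/
structure IsMeanFunction (α : ℝ → ℝ) : Prop where
  boundedVariation : BoundedVariationOn α (Set.Icc 0 1)
  lower_pos : 0 < lowerValue α
  bddAbove : BddAbove (α '' Set.Icc 0 1)

/-- Conditions on the variance function `h : [0, ∞) → [0, ∞)`: its infimum on `[inf α, sup α]` is
positive and its supremum there is finite, it is non-decreasing, Lipschitz on `[inf α, sup α]`,
and some positive power of it is Hölder continuous on `[0, ∞)`. -/
structure IsVarianceFunction (α h : ℝ → ℝ) : Prop where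
  nonneg : ∀ u, 0 ≤ u → 0 ≤ h u
  lower_pos : 0 < sInf (h '' Set.Icc (lowerValue α) (upperValue α))
  bddAbove : BddAbove (h '' Set.Icc (lowerValue α) (upperValue α))
  monotone : MonotoneOn h (Set.Ici 0)
  lipschitz : ∃ H₀ : ℝ≥0, LipschitzOnWith H₀ h (Set.Icc (lowerValue α) (upperValue α))
  hoelder : ∃ θ η Hbar : ℝ, 0 < θ ∧ 0 < η ∧ 0 < Hbar ∧
    ∀ u v, 0 ≤ u → 0 ≤ v → |h u ^ θ - h v ^ θ| ≤ Hbar * |u - v| ^ η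

/-- Conditions on the smoothing kernel: a nonnegative bounded Lipschitz function, vanishing
outside `[-1/2, 1/2]` and integrating to one. -/
structure IsSmoothingKernel (K : ℝ → ℝ) : Prop where
  nonneg : ∀ z, 0 ≤ K z
  support : ∀ z, z ∉ Set.Icc (-(1 / 2) : ℝ) (1 / 2) → K z = 0
  bounded : ∃ Kbar, ∀ z, K z ≤ Kbar
  integral_one : ∫ z, K z = 1
  lipschitz : ∃ L : ℝ≥0, LipschitzWith L K

/-- The regression model: for each `n = 2 ^ J`, the observations `X_1, …, X_n` are nonnegative and
independent, with means `α (t / n)` and variances `h (α (t / n))`. -/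
structure IsRegressionModel (α h : ℝ → ℝ) {Ω : ℕ → Type*} [∀ J, MeasurableSpace (Ω J)]
    (P : ∀ J, Measure (Ω J)) (X : ∀ J, ℕ → Ω J → ℝ) : Prop where
  measurable : ∀ J, ∀ t ∈ Finset.Icc 1 (nObs J), Measurable (X J t)
  nonneg : ∀ J, ∀ t ∈ Finset.Icc 1 (nObs J), ∀ᵐ ω ∂P J, 0 ≤ X J t ω
  indep : ∀ J, iIndepFun (fun t : Finset.Icc 1 (nObs J) => X J (t : ℕ)) (P J)
  memLp_two : ∀ J, ∀ t ∈ Finset.Icc 1 (nObs J), MemLp (X J t) 2 (P J)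
  mean : ∀ J, ∀ t ∈ Finset.Icc 1 (nObs J), ∫ ω, X J t ω ∂P J = designValue α J t
  variance : ∀ J, ∀ t ∈ Finset.Icc 1 (nObs J), Var[X J t; P J] = h (designValue α J t)

/-- The noise `ε_t = X_t - α (t / n)`. -/
def noise (α : ℝ → ℝ) {Ω : ℕ → Type*} (X : ∀ J, ℕ → Ω J → ℝ) (J t : ℕ) (ω : Ω J) : ℝ :=
  X J t ω - designValue α J t

/-- The moment condition `E |ε_t| ^ l ≤ (l !) ^ (1 + γ) κ₀ ^ (l - 2) h (α (t / n))` for all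
`l ≥ 3` and all `t`, with a constant `κ₀ > 0`. -/
def MomentCondition (α h : ℝ → ℝ) {Ω : ℕ → Type*} [∀ J, MeasurableSpace (Ω J)]
    (P : ∀ J, Measure (Ω J)) (X : ∀ J, ℕ → Ω J → ℝ) (γ : ℝ) : Prop :=
  ∃ κ₀ : ℝ, 0 < κ₀ ∧ ∀ J, ∀ t ∈ Finset.Icc 1 (nObs J), ∀ l : ℕ, 3 ≤ l →
    Integrable (fun ω => |noise α X J t ω| ^ l) (P J) ∧
    ∫ ω, |noise α X J t ω| ^ l ∂P J ≤
      (l.factorial : ℝ) ^ (1 + γ) * κ₀ ^ (l - 2) * h (designValue α J t)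

/-- Conditions on the weights of the local means: nonnegative, of sum one, with sum of squares and
maximum of order `2 ^ (j - J)`, uniformly over the coarse indices. -/
structure IsLocalMeanWeights (ε : ℝ) (κ : ℕ → ℕ → ℕ → ℕ → ℝ) : Prop where
  nonneg : ∀ J, ∀ p ∈ coarseIndices ε J, ∀ q ∈ Finset.Icc 1 (nObs J), 0 ≤ κ J p.1 p.2 q
  sum_one : ∀ J, ∀ p ∈ coarseIndices ε J, ∑ q ∈ Finset.Icc 1 (nObs J), κ J p.1 p.2 q = 1
  sum_sq : ∃ C : ℝ, ∀ J, ∀ p ∈ coarseIndices ε J,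
    ∑ q ∈ Finset.Icc 1 (nObs J), κ J p.1 p.2 q ^ 2 ≤ C * (2 : ℝ) ^ ((p.1 : ℝ) - J)
  max_le : ∃ C : ℝ, ∀ J, ∀ p ∈ coarseIndices ε J, ∀ q ∈ Finset.Icc 1 (nObs J),
    κ J p.1 p.2 q ≤ C * (2 : ℝ) ^ ((p.1 : ℝ) - J)

/-- `δ₁ n^{1/2} b² - M n^{-1/2} - n^{1/2} M^{-1/2}`. -/
def rateA (J M : ℕ) (b δ₁ : ℝ) : ℝ :=
  δ₁ * √(nObs J : ℝ) * b ^ 2 - M / √(nObs J : ℝ) - √(nObs J : ℝ) / √(M : ℝ)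

/-- `δ₁ b² min_j 2^{(J - j)/2}`. -/
def rateC (ε : ℝ) (J : ℕ) (b δ₁ : ℝ) : ℝ := δ₁ * b ^ 2 * minScalePow ε J (1 / 2)

/-- `δ' n^{1/2} b² log^{-2d} n - M n^{-1/2} - n^{1/2} M^{-1/2}`. -/
def rateE (d : ℝ) (J M : ℕ) (b δ' : ℝ) : ℝ :=
  δ' * √(nObs J : ℝ) * b ^ 2 * Real.log (nObs J) ^ (-2 * d) -
    M / √(nObs J : ℝ) - √(nObs J : ℝ) / √(M : ℝ)

/-- `δ' b² min_j 2^{(J - j)/2} log^{-2d} n`. -/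
def rateF (ε d : ℝ) (J : ℕ) (b δ' : ℝ) : ℝ :=
  δ' * b ^ 2 * minScalePow ε J (1 / 2) * Real.log (nObs J) ^ (-2 * d)

/-- `δ' n^{1/2} b log^{-d} n - M n^{-1/2} - n^{1/2} M^{-1/2}`. -/
def rateG (d : ℝ) (J M : ℕ) (b δ' : ℝ) : ℝ :=
  δ' * √(nObs J : ℝ) * b * Real.log (nObs J) ^ (-d) -
    M / √(nObs J : ℝ) - √(nObs J : ℝ) / √(M : ℝ)

/-- `(δ - b H) n^{1/2} b`. -/
def rateH (J : ℕ) (b H δ : ℝ) : ℝ := (δ - b * H) * √(nObs J : ℝ) * b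

end

/-! ### Normal tails, moment generating functions and Bernstein bounds -/

section

/-! Off an event of probability O(n⁻²) no |ε_t| exceeds B = a log^d n, so the noise may be replaced
by its truncation at B. The truncation is a bounded centred variable ζ_t plus a mean e_t of size
O(1/n) (`IsNoiseFamily.exists_centred`), and from there on only bounded independent variables occur.

Let u be the local mean of the α(q/n) and w that of the X_q. A deterministic perturbation argument
(`le_noise_add_perturbation`, `deviation_alternatives`) shows that a deviation |ĥ(w) - h(u)| ≥ δ
forces one of six events. Either the kernel sum at the pre-fit drops below a fixed multiple of nb;
or the local mean of ζ exceeds order b²; or it exceeds order δb²/log^{2d} n; or a sum carrying the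
noise of the pre-fit exceeds order δnb²; or a sum carrying its bias does so; or the kernel sum of
the centred squared noise exceeds order δ - bH. These events give the terms in a_n, c_n, f_n, e_n,
e_n and h_n. The term in g_n is a nonnegative extra.

The constants C_i and A_i are free, so no normal approximation is needed. Since 1 - Φ(z) ≥ c₀
exp(-z²) for z ≥ 0, and nothing is to be shown when z ≤ 1, it is enough to bound each probability by
a multiple of exp(-z²) + n⁻² when z > 1 (`exists_le_mul_one_sub_stdNormalCDF`). Bernstein's
inequality has an exponent that is the minimum of a quadratic and a linear expression. The quadratic
one gives exp(-z²). The linear one carries a power of n over a power of log n and exceeds 2 log n as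
soon as z > 1 (`exists_bernstein_exp_le`).

Two of the sums consist of functions of overlapping windows. They split into 2M + 1 sums over
residue classes modulo 2M + 1, inside which the windows are disjoint
(`IsCentredNoise.measureReal_window_sum_ge_le`). This produces the factor 2M + 1. In the linear
exponent the cap z ≤ b_n takes effect (`exists_window_exp_le`).

The delicate point is the denominator. Condition (12) bounds M/(nb²) and 1/(√M b²) by c₁ but does
not make them small, so neither the bias nor the noise of the pre-fit is negligible there. For the
bias, only the variation of α inside the band [u - b, u + b] counts, and it is uniformly small for
small b (`exists_dyadicVariation_clampAt_le`). For the noise, a fixed positive probability of being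
small suffices, since the kernel is nonnegative (`exists_small_ball_le`). In the numerator the
factor log^{2d} n gained in the thresholds outgrows every constant. -/

theorem stdNormalCDF_mono : Monotone stdNormalCDF := monotone_cdf _

theorem stdNormalCDF_le_one (z : ℝ) : stdNormalCDF z ≤ 1 := cdf_le_one _ z

theorem exists_exp_le_one_sub_stdNormalCDF :
    ∃ c₀ : ℝ, 0 < c₀ ∧ ∀ z, 0 ≤ z → c₀ * Real.exp (-z ^ 2) ≤ 1 - stdNormalCDF z := by
  refine ⟨(√(2 * Real.pi))⁻¹ * Real.exp (-1), by positivity, fun z hz => ?_⟩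
  have h1 : 1 - stdNormalCDF z = (gaussianReal 0 1).real (Set.Ioi z) := by
    rw [stdNormalCDF, cdf_eq_real, ← Set.compl_Iic, measureReal_compl measurableSet_Iic]
    simp
  rw [h1]
  have h2 : (gaussianReal 0 1).real (Set.Ioc z (z + 1)) ≤ (gaussianReal 0 1).real (Set.Ioi z) :=
    measureReal_mono Set.Ioc_subset_Ioi_self
  refine le_trans ?_ h2
  rw [Measure.real, gaussianReal_apply_eq_integral _ one_ne_zero, ENNReal.toReal_ofReal
    (integral_nonneg fun x => gaussianPDFReal_nonneg _ _ _)]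
  have h3 : ∫ _ in Set.Ioc z (z + 1), (√(2 * Real.pi))⁻¹ * Real.exp (-1) * Real.exp (-z ^ 2) ≤
      ∫ x in Set.Ioc z (z + 1), gaussianPDFReal 0 1 x := by
    refine setIntegral_mono_on ?_ ?_ measurableSet_Ioc ?_
    · exact integrableOn_const (by simp)
    · exact (integrable_gaussianPDFReal 0 1).integrableOn
    · intro x hx
      rw [gaussianPDFReal, mul_assoc, ← Real.exp_add]
      simp only [NNReal.coe_one, mul_one, sub_zero]
      gcongr
      -- On (z, z+1] one has x²/2 ≤ (z+1)²/2 ≤ z² + 1, the last because (z-1)² ≥ 0. This is the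
      -- origin of the factor exp(-1) in the constant.
      have : x ^ 2 ≤ (z + 1) ^ 2 := by
        have := hx.1; have := hx.2
        gcongr
        linarith
      nlinarith [sq_nonneg (z - 1)]
  simpa using h3

/-- A tail bound at a level that exceeds one is enough to compare with the normal tail. -/
theorem exists_le_mul_one_sub_stdNormalCDF :
    ∃ C : ℝ, 0 < C ∧ ∀ p z q R : ℝ, p ≤ 1 → 1 ≤ R → 0 ≤ q →
      (1 < z → p ≤ R * (Real.exp (-z ^ 2) + q)) → p ≤ C * R * (1 - stdNormalCDF z) + R * q := by
  obtain ⟨c₀, hc₀, hc⟩ := exists_exp_le_one_sub_stdNormalCDF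
  refine ⟨Real.exp 1 / c₀, by positivity, fun p z q R hp hR hq h => ?_⟩
  by_cases hz : 1 < z
  · have h1 := hc z (by linarith)
    have h2 : Real.exp (-z ^ 2) ≤ (Real.exp 1 / c₀) * (1 - stdNormalCDF z) := by
      have h3 : Real.exp (-z ^ 2) ≤ (1 - stdNormalCDF z) / c₀ := by
        rw [le_div_iff₀ hc₀]; linarith
      have h4 : (1 - stdNormalCDF z) / c₀ ≤ Real.exp 1 * ((1 - stdNormalCDF z) / c₀) :=
        le_mul_of_one_le_left ((Real.exp_pos _).le.trans h3) (by simp)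
      calc _ ≤ _ := h3.trans h4
        _ = _ := by ring
    calc p ≤ R * (Real.exp (-z ^ 2) + q) := h hz
      _ ≤ R * ((Real.exp 1 / c₀) * (1 - stdNormalCDF z) + q) := by gcongr
      _ = _ := by ring
  -- For z ≤ 1 the normal tail is at least c₀/e, so the constant e/c₀ lifts the right side above 1 ≥
  -- R⁻¹R, and p ≤ 1 suffices.
  · have h1 := hc 1 (by simp)
    have h2 := stdNormalCDF_mono (not_lt.mp hz)
    have h3 : 1 ≤ (Real.exp 1 / c₀) * (1 - stdNormalCDF z) := by
      have h4 : c₀ * Real.exp (-1) ≤ 1 - stdNormalCDF z := by norm_num at h1; linarith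
      calc (1 : ℝ) = Real.exp 1 / c₀ * (c₀ * Real.exp (-1)) := by
            rw [Real.exp_neg]; field_simp
        _ ≤ _ := by gcongr
    calc p ≤ 1 := hp
      _ ≤ R * ((Real.exp 1 / c₀) * (1 - stdNormalCDF z)) := by nlinarith
      _ ≤ _ := by nlinarith [mul_nonneg (zero_le_one.trans hR) hq]

variable {Ω : Type*} [MeasurableSpace Ω] {μ : Measure Ω}

theorem integrable_of_abs_le [IsFiniteMeasure μ] {f : Ω → ℝ} (hf : Measurable f) {C : ℝ}
    (h : ∀ ω, |f ω| ≤ C) : Integrable f μ :=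
  Integrable.of_bound hf.aestronglyMeasurable C (ae_of_all _ h)

theorem integrable_exp_mul_of_abs_le [IsFiniteMeasure μ] {f : Ω → ℝ} (hf : Measurable f) {C : ℝ}
    (h : ∀ ω, |f ω| ≤ C) (l : ℝ) : Integrable (fun ω => Real.exp (l * f ω)) μ := by
  refine integrable_of_abs_le (C := Real.exp (|l| * C)) (by fun_prop) fun ω => ?_
  rw [Real.abs_exp]
  refine Real.exp_le_exp.mpr ?_
  calc l * f ω ≤ |l * f ω| := le_abs_self _
    _ = |l| * |f ω| := abs_mul _ _
    _ ≤ _ := by gcongr; exact h ω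

theorem integral_one_add_mul_add_mul [IsProbabilityMeasure μ] {f g : Ω → ℝ} (hf : Integrable f μ)
    (hg : Integrable g μ) (a b : ℝ) :
    ∫ ω, (1 + a * f ω + b * g ω) ∂μ = 1 + a * ∫ ω, f ω ∂μ + b * ∫ ω, g ω ∂μ := by
  have h1 : Integrable (fun ω => 1 + a * f ω) μ := (integrable_const _).add (hf.const_mul _)
  rw [integral_add h1 (hg.const_mul _), integral_add (integrable_const _) (hf.const_mul _),
    integral_const_mul, integral_const_mul]
  simp

/-- A second-order bound valid for all x: for sub-exponential variables the exponent cannot be kept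
small pointwise, and the factor exp|x| is absorbed by an exponential moment. -/
theorem exp_le_one_add_add_sq_mul_exp_abs (x : ℝ) :
    Real.exp x ≤ 1 + x + x ^ 2 * Real.exp |x| := by
  rcases le_total |x| 1 with h | h
  · have h1 := Real.norm_exp_sub_one_sub_id_le (x := x) h
    have h2 : Real.exp x - 1 - x ≤ x ^ 2 := by
      have := le_of_abs_le h1
      simpa using this
    have h3 : 1 ≤ Real.exp |x| := by simp
    nlinarith [sq_nonneg x]
  · have h3 : Real.exp x ≤ Real.exp |x| := by gcongr; exact le_abs_self x
    have h4 : 1 ≤ x ^ 2 := by rw [← sq_abs]; nlinarith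
    rcases le_total 0 x with hx | hx
    · nlinarith [Real.exp_pos |x|]
    · rw [abs_of_nonpos hx] at h ⊢
      have h5 : -x + 1 ≤ Real.exp (-x) := Real.add_one_le_exp _
      have h6 : Real.exp x ≤ 1 := by simpa using hx
      nlinarith [Real.exp_pos (-x)]

/-- The moment generating function of a bounded centred random variable. -/
theorem mgf_le_of_bounded [IsProbabilityMeasure μ] {f : Ω → ℝ} (hf : Measurable f) {R v l : ℝ}
    (h : ∀ ω, |f ω| ≤ R) (h0 : ∫ ω, f ω ∂μ = 0) (h2 : ∫ ω, f ω ^ 2 ∂μ ≤ v) (hl : |l| * R ≤ 1) :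
    mgf f μ l ≤ Real.exp (l ^ 2 * v) := by
  have hi : Integrable f μ := integrable_of_abs_le hf h
  have hi2 : Integrable (fun ω => f ω ^ 2) μ :=
    integrable_of_abs_le (C := R ^ 2) (by fun_prop) fun ω => by
      rw [abs_pow]; gcongr; exact h ω
  have h3 : mgf f μ l ≤ ∫ ω, (1 + l * f ω + l ^ 2 * f ω ^ 2) ∂μ := by
    refine integral_mono (integrable_exp_mul_of_abs_le hf h l)
      (((integrable_const _).add (hi.const_mul _)).add (hi2.const_mul _)) fun ω => ?_
    have h4 : |l * f ω| ≤ 1 := by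
      rw [abs_mul]; exact (mul_le_mul_of_nonneg_left (h ω) (abs_nonneg l)).trans hl
    have h1 := le_of_abs_le (Real.norm_exp_sub_one_sub_id_le (x := l * f ω) h4)
    simp only [Real.norm_eq_abs, sq_abs] at h1
    simp only
    linarith [mul_pow l (f ω) 2]
  rw [integral_one_add_mul_add_mul hi hi2, h0, mul_zero, add_zero] at h3
  calc _ ≤ _ := h3
    _ ≤ 1 + l ^ 2 * v := by gcongr
    _ ≤ _ := by linarith [Real.add_one_le_exp (l ^ 2 * v)]

/-- The moment generating function of a centred random variable dominated by a sub-exponential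
one. -/
theorem mgf_sub_integral_le [IsProbabilityMeasure μ] {W Y : Ω → ℝ} (hW : Measurable W)
    (hY : Measurable Y) {R s E l : ℝ} (hYR : ∀ ω, |Y ω| ≤ R) (hWY : ∀ ω, |W ω| ≤ |Y ω|)
    (hs : 0 < s) (hE : ∫ ω, Real.exp (|Y ω| / s) ∂μ ≤ E) (hl : |l| * s ≤ 1 / 4) :
    mgf (fun ω => W ω - ∫ ω', W ω' ∂μ) μ l ≤
      Real.exp (l ^ 2 * (32 * s ^ 2 * (E * Real.exp E))) := by
  set e := ∫ ω', W ω' ∂μ with he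
  have hWR : ∀ ω, |W ω| ≤ R := fun ω => (hWY ω).trans (hYR ω)
  have hWi : Integrable W μ := integrable_of_abs_le hW hWR
  have hexpi : Integrable (fun ω => Real.exp (|Y ω| / s)) μ := by
    have := integrable_exp_mul_of_abs_le (μ := μ) (f := fun ω => |Y ω|) (by fun_prop)
      (C := R) (fun ω => by simpa using hYR ω) (1 / s)
    refine this.congr (ae_of_all _ fun ω => ?_)
    simp only; congr 1; ring
  have heE : |e| ≤ s * E := by
    calc |e| ≤ ∫ ω, |W ω| ∂μ := abs_integral_le_integral_abs
      _ ≤ ∫ ω, s * Real.exp (|Y ω| / s) ∂μ := by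
          refine integral_mono hWi.abs (hexpi.const_mul _) fun ω => ?_
          have h1 : |Y ω| / s ≤ Real.exp (|Y ω| / s) := by
            linarith [Real.add_one_le_exp (|Y ω| / s)]
          rw [div_le_iff₀ hs] at h1
          calc |W ω| ≤ |Y ω| := hWY ω
            _ ≤ _ := by rw [mul_comm]; exact h1
      _ ≤ s * E := by rw [integral_const_mul]; gcongr
  have hdR : ∀ ω, |W ω - e| ≤ R + s * E := fun ω =>
    (abs_sub _ _).trans (add_le_add (hWR ω) heE)
  have hdi : Integrable (fun ω => W ω - e) μ := hWi.sub (integrable_const _)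
  have h3 : mgf (fun ω => W ω - e) μ l ≤ ∫ ω, (1 + l * (W ω - e) +
      (l ^ 2 * (32 * s ^ 2 * Real.exp E)) * Real.exp (|Y ω| / s)) ∂μ := by
    refine integral_mono (integrable_exp_mul_of_abs_le (by fun_prop) hdR l)
      (((integrable_const _).add (hdi.const_mul _)).add (hexpi.const_mul _)) fun ω => ?_
    have h1 := exp_le_one_add_add_sq_mul_exp_abs (l * (W ω - e))
    refine h1.trans (add_le_add le_rfl ?_)
    set Q := |W ω - e| / s with hQ
    have hQ0 : 0 ≤ Q := by positivity
    have hQe : |W ω - e| = s * Q := by rw [hQ]; field_simp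
    have hQ1 : Q ≤ |Y ω| / s + E := by
      rw [hQ, div_le_iff₀ hs, add_mul, div_mul_cancel₀ _ hs.ne']
      calc |W ω - e| ≤ |W ω| + |e| := abs_sub _ _
        _ ≤ |Y ω| + E * s := by rw [mul_comm E]; exact add_le_add (hWY ω) heE
    have h5 : |l * (W ω - e)| ≤ Q / 4 := by
      rw [abs_mul, hQe, ← mul_assoc]
      nlinarith
    have h6 : (l * (W ω - e)) ^ 2 = l ^ 2 * s ^ 2 * Q ^ 2 := by
      rw [mul_pow, ← sq_abs (W ω - e), hQe]; ring
    -- This is x²/2 ≤ exp x at x = Q/4. Together with |l| s ≤ 1/4 there are two factors exp(Q/4),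
    -- whose product stays below exp(|Y|/s + E).
    have h7 : Q ^ 2 ≤ 32 * Real.exp (Q / 4) := by
      have := Real.quadratic_le_exp_of_nonneg (x := Q / 4) (by positivity)
      nlinarith
    calc (l * (W ω - e)) ^ 2 * Real.exp |l * (W ω - e)|
        ≤ (l ^ 2 * s ^ 2 * (32 * Real.exp (Q / 4))) * Real.exp (Q / 4) := by
          rw [h6]; gcongr
      _ = l ^ 2 * (32 * s ^ 2) * Real.exp (Q / 4 + Q / 4) := by rw [Real.exp_add]; ring
      _ ≤ l ^ 2 * (32 * s ^ 2) * Real.exp (E + |Y ω| / s) := by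
          refine mul_le_mul_of_nonneg_left (Real.exp_le_exp.mpr (by linarith)) (by positivity)
      _ = _ := by rw [Real.exp_add]; ring
  have hdz : ∫ ω, (W ω - e) ∂μ = 0 := by
    rw [integral_sub hWi (integrable_const _)]; simp [he]
  rw [integral_one_add_mul_add_mul hdi hexpi, hdz, mul_zero, add_zero] at h3
  calc _ ≤ _ := h3
    _ ≤ 1 + l ^ 2 * (32 * s ^ 2 * Real.exp E) * E := by gcongr
    _ = 1 + l ^ 2 * (32 * s ^ 2 * (E * Real.exp E)) := by ring
    _ ≤ _ := by linarith [Real.add_one_le_exp (l ^ 2 * (32 * s ^ 2 * (E * Real.exp E)))]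

/-- Bernstein's form of the Chernoff bound. -/
theorem measureReal_ge_le_exp_neg_min [IsProbabilityMeasure μ] {S : Ω → ℝ} (hS : Measurable S)
    {R V l₀ x : ℝ} (hR : ∀ ω, |S ω| ≤ R) (hV : 0 < V) (hl₀ : 0 < l₀) (hx : 0 ≤ x)
    (h : ∀ l, 0 ≤ l → l ≤ l₀ → mgf S μ l ≤ Real.exp (l ^ 2 * V)) :
    μ.real {ω | x ≤ S ω} ≤ Real.exp (-min (x ^ 2 / (4 * V)) (l₀ * x / 2)) := by
  -- x/(2V) minimizes l²V - lx. With the cap l₀ one still has lV ≤ x/2, so the exponent gains at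
  -- least lx/2 in both cases.
  set l := min (x / (2 * V)) l₀ with hl
  have hl0 : 0 ≤ l := le_min (by positivity) hl₀.le
  refine (measure_ge_le_exp_mul_mgf x hl0 (integrable_exp_mul_of_abs_le hS hR l)).trans ?_
  calc Real.exp (-l * x) * mgf S μ l ≤ Real.exp (-l * x) * Real.exp (l ^ 2 * V) := by
        gcongr; exact h l hl0 (min_le_right _ _)
    _ = Real.exp (-(l * x - l ^ 2 * V)) := by rw [← Real.exp_add]; ring_nf
    _ ≤ _ := by
        gcongr
        have h1 : l * V ≤ x / 2 := by
          have : l ≤ x / (2 * V) := min_le_left _ _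
          calc l * V ≤ x / (2 * V) * V := by gcongr
            _ = x / 2 := by field_simp
        have h2 : l * x / 2 ≤ l * x - l ^ 2 * V := by nlinarith
        refine le_trans ?_ h2
        rcases le_total (x / (2 * V)) l₀ with h3 | h3
        · rw [hl, min_eq_left h3]
          refine (min_le_left _ _).trans (le_of_eq ?_)
          field_simp
          ring
        · rw [hl, min_eq_right h3]
          exact min_le_right _ _

/-- Bernstein's inequality for sums of bounded independent centred random variables. -/
theorem bernstein_sum {ι : Type*} {f : ι → Ω → ℝ} (hind : iIndepFun f μ)
    (hf : ∀ i, Measurable (f i)) (S : Finset ι) {R V x : ℝ} {v : ι → ℝ}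
    (hR : 0 < R) (hfR : ∀ i ∈ S, ∀ ω, |f i ω| ≤ R) (h0 : ∀ i ∈ S, ∫ ω, f i ω ∂μ = 0)
    (h2 : ∀ i ∈ S, ∫ ω, f i ω ^ 2 ∂μ ≤ v i) (hV : 0 < V) (hv : ∑ i ∈ S, v i ≤ V) (hx : 0 ≤ x) :
    μ.real {ω | x ≤ ∑ i ∈ S, f i ω} ≤ Real.exp (-min (x ^ 2 / (4 * V)) (x / (2 * R))) := by
  have := hind.isProbabilityMeasure
  have h := measureReal_ge_le_exp_neg_min (μ := μ) (S := fun ω => ∑ i ∈ S, f i ω)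
    (R := ∑ i ∈ S, R) (V := V) (l₀ := 1 / R) (x := x)
    (Finset.measurable_fun_sum _ fun i _ => hf i)
    (fun ω => (Finset.abs_sum_le_sum_abs _ _).trans (Finset.sum_le_sum fun i hi => hfR i hi ω))
    hV (by positivity) hx ?_
  · convert h using 4
    field_simp
  intro l hl0 hl
  have h1 : mgf (fun ω => ∑ i ∈ S, f i ω) μ l = ∏ i ∈ S, mgf (f i) μ l := by
    rw [← hind.mgf_sum hf S]; congr 1; ext ω; simp
  rw [h1]
  calc ∏ i ∈ S, mgf (f i) μ l ≤ ∏ i ∈ S, Real.exp (l ^ 2 * v i) := by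
        refine Finset.prod_le_prod (fun i _ => mgf_nonneg) fun i hi => ?_
        refine mgf_le_of_bounded (hf i) (hfR i hi) (h0 i hi) (h2 i hi) ?_
        rw [abs_of_nonneg hl0]
        calc l * R ≤ 1 / R * R := by gcongr
          _ = 1 := by field_simp
    _ = Real.exp (l ^ 2 * ∑ i ∈ S, v i) := by rw [← Real.exp_sum, Finset.mul_sum]
    _ ≤ _ := by gcongr

end

/-! ### Bounded centred noise and its characteristic function -/

section

/-- Independent centred noise, bounded by `B`, with second and fourth moments at most `v`. -/
structure IsCentredNoise {Ω : Type*} [MeasurableSpace Ω] (μ : Measure Ω) (ζ : ℕ → Ω → ℝ)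
    (B v : ℝ) : Prop where
  indep : iIndepFun ζ μ
  meas : ∀ p, Measurable (ζ p)
  bdd : ∀ p ω, |ζ p ω| ≤ B
  mean : ∀ p, ∫ ω, ζ p ω ∂μ = 0
  sq : ∀ p, ∫ ω, ζ p ω ^ 2 ∂μ ≤ v
  fourth : ∀ p, ∫ ω, ζ p ω ^ 4 ∂μ ≤ v

variable {Ω : Type*} [MeasurableSpace Ω] {μ : Measure Ω} {ζ : ℕ → Ω → ℝ} {B v : ℝ}

namespace IsCentredNoise

theorem isProbabilityMeasure (h : IsCentredNoise μ ζ B v) : IsProbabilityMeasure μ :=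
  h.indep.isProbabilityMeasure

theorem integrable_pow (h : IsCentredNoise μ ζ B v) (p k : ℕ) :
    Integrable (fun ω => ζ p ω ^ k) μ := by
  have := h.isProbabilityMeasure
  have := h.meas p
  refine integrable_of_abs_le (C := B ^ k) (by fun_prop) fun ω => ?_
  rw [abs_pow]; gcongr; exact h.bdd p ω

theorem integrable (h : IsCentredNoise μ ζ B v) (p : ℕ) : Integrable (ζ p) μ := by
  simpa using h.integrable_pow p 1

theorem nonneg (h : IsCentredNoise μ ζ B v) : 0 ≤ v :=
  (integral_nonneg fun _ => sq_nonneg _).trans (h.sq 0)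

theorem bound_nonneg (h : IsCentredNoise μ ζ B v) : 0 ≤ B := by
  have := h.isProbabilityMeasure
  obtain ⟨ω⟩ := μ.nonempty_of_neZero
  exact (abs_nonneg _).trans (h.bdd 0 ω)

theorem integral_abs_cube_le (h : IsCentredNoise μ ζ B v) (p : ℕ) :
    ∫ ω, |ζ p ω| ^ 3 ∂μ ≤ v := by
  have h1 : ∫ ω, |ζ p ω| ^ 3 ∂μ ≤ ∫ ω, (1 / 2 * ζ p ω ^ 2 + 1 / 2 * ζ p ω ^ 4) ∂μ := by
    refine integral_mono_of_nonneg (ae_of_all _ fun ω => by positivity)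
      (((h.integrable_pow p 2).const_mul _).add ((h.integrable_pow p 4).const_mul _))
      (ae_of_all _ fun ω => ?_)
    have h2 : ζ p ω ^ 2 = |ζ p ω| ^ 2 := (sq_abs _).symm
    have h4 : ζ p ω ^ 4 = |ζ p ω| ^ 4 := by rw [← abs_pow, abs_of_nonneg (by positivity)]
    simp only [h2, h4]
    nlinarith [sq_nonneg (|ζ p ω| * (|ζ p ω| - 1))]
  rw [integral_add ((h.integrable_pow p 2).const_mul _) ((h.integrable_pow p 4).const_mul _),
    integral_const_mul, integral_const_mul] at h1
  linarith [h.sq p, h.fourth p]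

theorem measurable_sum (h : IsCentredNoise μ ζ B v) (S : Finset ℕ) :
    Measurable fun ω => ∑ p ∈ S, ζ p ω :=
  Finset.measurable_fun_sum _ fun i _ => h.meas i

theorem abs_sum_le (h : IsCentredNoise μ ζ B v) (S : Finset ℕ) (ω : Ω) :
    |∑ p ∈ S, ζ p ω| ≤ S.card * B := by
  calc _ ≤ ∑ p ∈ S, |ζ p ω| := Finset.abs_sum_le_sum_abs _ _
    _ ≤ ∑ p ∈ S, B := Finset.sum_le_sum fun p _ => h.bdd p ω
    _ = _ := by simp

theorem integral_sum_sq_le (h : IsCentredNoise μ ζ B v) (S : Finset ℕ) :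
    ∫ ω, (∑ p ∈ S, ζ p ω) ^ 2 ∂μ ≤ S.card * v := by
  have := h.isProbabilityMeasure
  have hL : ∀ p, MemLp (ζ p) 2 μ := fun p =>
    MemLp.of_bound (h.meas p).aestronglyMeasurable B (ae_of_all _ (h.bdd p))
  have h1 := IndepFun.variance_sum (μ := μ) (X := ζ) (s := S) (fun p _ => hL p)
    (fun i _ j _ hij => h.indep.indepFun hij)
  have h2 : ∫ ω, (∑ p ∈ S, ζ p) ω ∂μ = 0 := by
    simp only [Finset.sum_apply]
    rw [integral_finsetSum _ fun p _ => h.integrable p]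
    simp [h.mean]
  have hm : Measurable (∑ p ∈ S, ζ p) := by
    have := h.measurable_sum S
    convert this using 1; ext ω; simp
  rw [variance_of_integral_eq_zero hm.aemeasurable h2] at h1
  simp only [Finset.sum_apply] at h1
  rw [h1]
  calc ∑ p ∈ S, Var[ζ p; μ] ≤ ∑ p ∈ S, v := by
        refine Finset.sum_le_sum fun p _ => ?_
        rw [variance_of_integral_eq_zero (h.meas p).aemeasurable (h.mean p)]
        exact h.sq p
    _ = _ := by simp

end IsCentredNoise

/-- The exponential series handles |x| ≤ 1 and the triangle inequality the rest. The generous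
constant 4 makes one bound serve both, so no smallness of the argument has to be tracked. -/
theorem norm_exp_I_mul_sub_taylor_two_le (x : ℝ) :
    ‖Complex.exp (x * Complex.I) - (1 + x * Complex.I - (x : ℂ) ^ 2 / 2)‖ ≤ 4 * |x| ^ 3 := by
  have hn : ‖(x * Complex.I : ℂ)‖ = |x| := by simp
  rcases le_total |x| 1 with hx | hx
  · have h := Complex.exp_bound (x := x * Complex.I) (by rw [hn]; exact hx) (n := 3) (by norm_num)
    have h1 : ∑ m ∈ Finset.range 3, (x * Complex.I : ℂ) ^ m / (m.factorial : ℂ) =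
        1 + x * Complex.I - (x : ℂ) ^ 2 / 2 := by
      simp [Finset.sum_range_succ, mul_pow]; ring
    rw [h1, hn] at h
    refine h.trans ?_
    rw [mul_comm]
    have : ((Nat.succ 3 : ℕ) : ℝ) * (((Nat.factorial 3 : ℕ) : ℝ) * ((3 : ℕ) : ℝ))⁻¹ ≤ 4 := by
      norm_num [Nat.factorial]
    gcongr
  · have h1 : ‖Complex.exp (x * Complex.I)‖ = 1 := Complex.norm_exp_ofReal_mul_I x
    have h2 : ‖(1 + x * Complex.I - (x : ℂ) ^ 2 / 2 : ℂ)‖ ≤ 1 + |x| + |x| ^ 2 / 2 := by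
      refine (norm_sub_le _ _).trans (add_le_add ((norm_add_le _ _).trans ?_) ?_)
      · simp
      · simp
    refine (norm_sub_le _ _).trans ?_
    rw [h1]
    have h3 : |x| ≤ |x| ^ 3 := by nlinarith [mul_nonneg (abs_nonneg x) (abs_nonneg x)]
    have h4 : |x| ^ 2 ≤ |x| ^ 3 := by nlinarith [sq_nonneg |x|]
    have h5 : 1 ≤ |x| ^ 3 := one_le_pow₀ hx
    nlinarith

theorem norm_exp_neg_sub_one_add_le {u : ℝ} (hu : 0 ≤ u) :
    |Real.exp (-u) - (1 - u)| ≤ u ^ 2 := by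
  rcases le_total u 1 with h | h
  · have := Real.norm_exp_sub_one_sub_id_le (x := -u) (by simpa [abs_of_nonneg hu] using h)
    simp only [Real.norm_eq_abs, abs_neg, sq_abs] at this
    convert this using 2; ring
  · have h1 : Real.exp (-u) ≤ 1 := by simpa using hu
    have h2 : -u + 1 ≤ Real.exp (-u) := Real.add_one_le_exp _
    rw [abs_of_nonneg (by linarith)]
    nlinarith

/-- Lindeberg replacement: the factors are exchanged one at a time, and the untouched ones lie in
the unit disc. -/
theorem norm_prod_sub_prod_le {ι : Type*} (S : Finset ι) (a b : ι → ℂ) (ha : ∀ i, ‖a i‖ ≤ 1)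
    (hb : ∀ i, ‖b i‖ ≤ 1) : ‖∏ i ∈ S, a i - ∏ i ∈ S, b i‖ ≤ ∑ i ∈ S, ‖a i - b i‖ := by
  classical
  induction S using Finset.induction_on with
  | empty => simp
  | insert i S hi ih =>
    rw [Finset.prod_insert hi, Finset.prod_insert hi, Finset.sum_insert hi]
    have h1 : a i * ∏ j ∈ S, a j - b i * ∏ j ∈ S, b j =
        (a i - b i) * ∏ j ∈ S, a j + b i * (∏ j ∈ S, a j - ∏ j ∈ S, b j) := by ring
    rw [h1]
    refine (norm_add_le _ _).trans (add_le_add ?_ ?_)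
    · rw [norm_mul, norm_prod]
      exact mul_le_of_le_one_right (norm_nonneg _)
        (Finset.prod_le_one (fun _ _ => norm_nonneg _) fun j _ => ha j)
    · rw [norm_mul]
      exact (mul_le_of_le_one_left (norm_nonneg _) (hb i)).trans ih

/-- Both terms are compared with 1 - r² E ζ²/2. The error involves only upper bounds on moments, so
the variance may be arbitrarily small, and it does not involve the growing bound B. -/
theorem norm_integral_exp_sub_gaussian_le (h : IsCentredNoise μ ζ B v) (p : ℕ) (r : ℝ) :
    ‖charFun (μ.map (ζ p)) r - Complex.exp ((-(r ^ 2 * (∫ ω, ζ p ω ^ 2 ∂μ) / 2) : ℝ))‖ ≤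
      4 * |r| ^ 3 * v + r ^ 4 * v ^ 2 := by
  have := h.isProbabilityMeasure
  have hm := h.meas p
  set w := ∫ ω, ζ p ω ^ 2 ∂μ with hw
  have hw0 : 0 ≤ w := integral_nonneg fun _ => sq_nonneg _
  have h1 : charFun (μ.map (ζ p)) r = ∫ ω, Complex.exp ((r * ζ p ω : ℝ) * Complex.I) ∂μ := by
    rw [charFun_apply_real, integral_map hm.aemeasurable (by fun_prop)]
    simp
  have hi : Integrable (fun ω => Complex.exp ((r * ζ p ω : ℝ) * Complex.I)) μ :=
    Integrable.of_bound (by fun_prop) 1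
      (ae_of_all _ fun ω => (Complex.norm_exp_ofReal_mul_I _).le)
  have hT : Integrable (fun ω => (1 + (r * ζ p ω : ℝ) * Complex.I -
      ((r * ζ p ω : ℝ) : ℂ) ^ 2 / 2)) μ := by
    refine Integrable.sub ((integrable_const _).add ?_) ?_
    · exact (((h.integrable p).const_mul r).ofReal (𝕜 := ℂ)).mul_const _
    · have : Integrable (fun ω => ((r ^ 2 / 2 * ζ p ω ^ 2 : ℝ) : ℂ)) μ :=
        ((h.integrable_pow p 2).const_mul (r ^ 2 / 2)).ofReal
      refine this.congr (ae_of_all _ fun ω => ?_)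
      push_cast
      ring
  have hTi : ∫ ω, (1 + (r * ζ p ω : ℝ) * Complex.I - ((r * ζ p ω : ℝ) : ℂ) ^ 2 / 2) ∂μ =
      ((1 - r ^ 2 * w / 2 : ℝ) : ℂ) := by
    have e : ∀ ω, (1 + (r * ζ p ω : ℝ) * Complex.I - ((r * ζ p ω : ℝ) : ℂ) ^ 2 / 2) =
        ((1 + 0 * ζ p ω + (-(r ^ 2 / 2)) * ζ p ω ^ 2 : ℝ) : ℂ) +
          ((r * ζ p ω : ℝ) : ℂ) * Complex.I := by
      intro ω; push_cast; ring
    simp_rw [e]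
    have i1 : Integrable (fun ω => ((1 + 0 * ζ p ω + (-(r ^ 2 / 2)) * ζ p ω ^ 2 : ℝ) : ℂ)) μ :=
      ((((integrable_const _).add ((h.integrable p).const_mul _)).add
        ((h.integrable_pow p 2).const_mul _))).ofReal
    have i2 : Integrable (fun ω => ((r * ζ p ω : ℝ) : ℂ) * Complex.I) μ :=
      (((h.integrable p).const_mul r).ofReal (𝕜 := ℂ)).mul_const _
    rw [integral_add i1 i2, integral_complex_ofReal,
      integral_one_add_mul_add_mul (h.integrable p) (h.integrable_pow p 2), integral_mul_const,
      integral_complex_ofReal, integral_const_mul, h.mean]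
    push_cast
    rw [← hw]
    ring
  have h2 : ‖charFun (μ.map (ζ p)) r - ((1 - r ^ 2 * w / 2 : ℝ) : ℂ)‖ ≤ 4 * |r| ^ 3 * v := by
    rw [h1, ← hTi, ← integral_sub hi hT]
    refine (norm_integral_le_integral_norm _).trans ?_
    calc _ ≤ ∫ ω, 4 * |r| ^ 3 * |ζ p ω| ^ 3 ∂μ := by
          refine integral_mono_of_nonneg (ae_of_all _ fun ω => norm_nonneg _) ?_
            (ae_of_all _ fun ω => ?_)
          · refine Integrable.const_mul ?_ _
            exact ((h.integrable_pow p 3).abs).congr (ae_of_all _ fun ω => by simp [abs_pow])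
          · refine (norm_exp_I_mul_sub_taylor_two_le (r * ζ p ω)).trans (le_of_eq ?_)
            simp only [abs_mul]; ring
      _ ≤ _ := by
          rw [integral_const_mul]
          gcongr
          exact h.integral_abs_cube_le p
  have h3 : ‖((1 - r ^ 2 * w / 2 : ℝ) : ℂ) - Complex.exp ((-(r ^ 2 * w / 2) : ℝ))‖ ≤
      r ^ 4 * v ^ 2 := by
    rw [← Complex.ofReal_exp, ← Complex.ofReal_sub, Complex.norm_real, Real.norm_eq_abs,
      abs_sub_comm]
    refine (norm_exp_neg_sub_one_add_le (by positivity)).trans ?_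
    have : w ≤ v := h.sq p
    calc (r ^ 2 * w / 2) ^ 2 ≤ (r ^ 2 * v) ^ 2 := by
          have := h.nonneg
          gcongr
          nlinarith [mul_nonneg (sq_nonneg r) hw0, mul_le_mul_of_nonneg_left ‹w ≤ v› (sq_nonneg r)]
      _ = _ := by ring
  calc _ = ‖(charFun (μ.map (ζ p)) r - ((1 - r ^ 2 * w / 2 : ℝ) : ℂ)) +
        (((1 - r ^ 2 * w / 2 : ℝ) : ℂ) - Complex.exp ((-(r ^ 2 * w / 2) : ℝ)))‖ := by ring_nf
    _ ≤ _ := (norm_add_le _ _).trans (add_le_add h2 h3)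

/-- A lower bound for the characteristic function of a normalized sum of centred noise. -/
theorem re_charFun_sum_ge (h : IsCentredNoise μ ζ B v) (S : Finset ℕ) {m : ℕ} (hm : 1 ≤ m)
    (hS : S.card ≤ m) (r : ℝ) :
    Real.exp (-(v / 2) * r ^ 2) - (4 * |r| ^ 3 * v + r ^ 4 * v ^ 2) / √m ≤
      (charFun (μ.map fun ω => (∑ p ∈ S, ζ p ω) / √m) r).re := by
  have := h.isProbabilityMeasure
  have hm0 : (0 : ℝ) < m := by exact_mod_cast hm
  have hsm : 0 < √(m : ℝ) := Real.sqrt_pos.mpr hm0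
  have hsm1 : 1 ≤ √(m : ℝ) := Real.one_le_sqrt.mpr (by exact_mod_cast hm)
  have hsq : √(m : ℝ) * √(m : ℝ) = m := Real.mul_self_sqrt hm0.le
  set q := r / √m with hq
  have e1 : charFun (μ.map fun ω => (∑ p ∈ S, ζ p ω) / √m) r =
      ∏ p ∈ S, charFun (μ.map (ζ p)) q := by
    have h1 : charFun (μ.map fun ω => (∑ p ∈ S, ζ p ω) / √m) r =
        charFun (μ.map fun ω => (∑ p ∈ S, ζ p ω)) q := by
      have hs := h.measurable_sum S
      rw [charFun_apply_real, charFun_apply_real, integral_map (hs.div_const _).aemeasurable (by fun_prop),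
        integral_map hs.aemeasurable (by fun_prop)]
      refine integral_congr_ae (ae_of_all _ fun ω => ?_)
      simp only [hq]
      push_cast
      ring_nf
    rw [h1, (h.indep.restrict S).charFun_map_fun_finsetSum_eq_prod (fun p _ => (h.meas p).aemeasurable)]
    simp
  set g : ℕ → ℂ := fun p => Complex.exp ((-(q ^ 2 * (∫ ω, ζ p ω ^ 2 ∂μ) / 2) : ℝ)) with hg
  have hg1 : ∀ p, ‖g p‖ ≤ 1 := fun p => by
    have : 0 ≤ ∫ ω, ζ p ω ^ 2 ∂μ := integral_nonneg fun _ => sq_nonneg _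
    rw [hg]
    simp only
    rw [← Complex.ofReal_exp, Complex.norm_real, Real.norm_eq_abs, Real.abs_exp,
      Real.exp_le_one_iff]
    have : 0 ≤ q ^ 2 * (∫ ω, ζ p ω ^ 2 ∂μ) / 2 := by positivity
    linarith
  have hmap : ∀ p, IsProbabilityMeasure (μ.map (ζ p)) := fun p =>
    Measure.isProbabilityMeasure_map (h.meas p).aemeasurable
  have h2 : ‖∏ p ∈ S, charFun (μ.map (ζ p)) q - ∏ p ∈ S, g p‖ ≤
      (4 * |r| ^ 3 * v + r ^ 4 * v ^ 2) / √m := by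
    refine (norm_prod_sub_prod_le S _ g (fun p => norm_charFun_le_one q) hg1).trans ?_
    calc _ ≤ ∑ p ∈ S, (4 * |q| ^ 3 * v + q ^ 4 * v ^ 2) :=
          Finset.sum_le_sum fun p _ => norm_integral_exp_sub_gaussian_le h p q
      _ = S.card * (4 * |q| ^ 3 * v + q ^ 4 * v ^ 2) := by simp; ring
      _ ≤ m * (4 * |q| ^ 3 * v + q ^ 4 * v ^ 2) := by
          have := h.nonneg
          gcongr
      _ = 4 * |r| ^ 3 * v / √m + r ^ 4 * v ^ 2 / m := by
          rw [hq, abs_div, abs_of_pos hsm]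
          generalize √(m : ℝ) = z at *
          rw [← hsq]
          field_simp
      _ ≤ 4 * |r| ^ 3 * v / √m + r ^ 4 * v ^ 2 / √m := by
          gcongr
          nlinarith
      _ = _ := by ring
  have h3 : (∏ p ∈ S, g p) = ((Real.exp (-∑ p ∈ S, q ^ 2 * (∫ ω, ζ p ω ^ 2 ∂μ) / 2) : ℝ) : ℂ) := by
    rw [hg, ← Complex.exp_sum]
    push_cast
    simp
  -- Fewer than m terms, or variances below v, only enlarge the Gaussian factor. This is why a lower
  -- bound holds without any control of the variance from below.
  have h4 : Real.exp (-(v / 2) * r ^ 2) ≤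
      Real.exp (-∑ p ∈ S, q ^ 2 * (∫ ω, ζ p ω ^ 2 ∂μ) / 2) := by
    refine Real.exp_le_exp.mpr ?_
    have h5 : ∑ p ∈ S, q ^ 2 * (∫ ω, ζ p ω ^ 2 ∂μ) / 2 ≤ ∑ p ∈ S, q ^ 2 * v / 2 :=
      Finset.sum_le_sum fun p _ => by have := h.sq p; gcongr
    have h6 : ∑ p ∈ S, q ^ 2 * v / 2 ≤ v / 2 * r ^ 2 := by
      have h7 : q ^ 2 * m = r ^ 2 := by
        rw [hq]
        generalize √(m : ℝ) = z at *
        rw [← hsq]; field_simp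
      have : (S.card : ℝ) ≤ m := by exact_mod_cast hS
      have := h.nonneg
      calc ∑ p ∈ S, q ^ 2 * v / 2 = S.card * (q ^ 2 * v / 2) := by simp
        _ ≤ m * (q ^ 2 * v / 2) := by gcongr
        _ = v / 2 * (q ^ 2 * m) := by ring
        _ = _ := by rw [h7]
    linarith
  rw [e1]
  have h5 := (abs_le.mp ((Complex.abs_re_le_norm _).trans h2)).1
  rw [h3, Complex.sub_re, Complex.ofReal_re] at h5
  linarith

end

/-! ### Small-ball probabilities -/

/-- Fubini, combined with the fact that the Gaussian weight is itself a characteristic function. It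
turns lower bounds for `charFun ν` into lower bounds for the mass of ν near zero. -/
theorem integral_exp_neg_mul_sq_eq_integral_charFun (ν : Measure ℝ) [IsProbabilityMeasure ν]
    (w : ℝ≥0) :
    ∫ y, Real.exp (-(w / 2) * y ^ 2) ∂ν = ∫ r, (charFun ν r).re ∂(gaussianReal 0 w) := by
  have hint : Integrable (Function.uncurry fun (y r : ℝ) => Complex.exp (r * y * Complex.I))
      (ν.prod (gaussianReal 0 w)) := by
    refine Integrable.of_bound ?_ 1 (ae_of_all _ fun z => ?_)
    · refine Continuous.aestronglyMeasurable ?_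
      simp only [Function.uncurry_def]
      fun_prop
    · simp only [Function.uncurry_def]
      rw [← Complex.ofReal_mul]
      exact (Complex.norm_exp_ofReal_mul_I _).le
  have h1 : ∫ y, charFun (gaussianReal 0 w) y ∂ν = ∫ r, charFun ν r ∂(gaussianReal 0 w) := by
    simp_rw [charFun_apply_real]
    have := integral_integral_swap hint
    rw [← this]
    refine integral_congr_ae (ae_of_all _ fun y => ?_)
    refine integral_congr_ae (ae_of_all _ fun r => ?_)
    simp only
    rw [mul_comm (y : ℂ)]
  have h2 : ∫ y, charFun (gaussianReal 0 w) y ∂ν =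
      ((∫ y, Real.exp (-(w / 2) * y ^ 2) ∂ν : ℝ) : ℂ) := by
    rw [← integral_complex_ofReal]
    refine integral_congr_ae (ae_of_all _ fun y => ?_)
    simp only [charFun_gaussianReal]
    push_cast
    congr 1
    ring
  have hi : Integrable (charFun ν) (gaussianReal 0 w) :=
    Integrable.of_bound (by fun_prop) 1 (ae_of_all _ fun r => norm_charFun_le_one r)
  have h3 := integral_re (𝕜 := ℂ) hi
  simp only [RCLike.re_to_complex] at h3
  rw [h3, ← h1, h2, Complex.ofReal_re]

theorem integral_exp_neg_mul_sq_gaussianReal {v : ℝ} (hv : 0 ≤ v) {w : ℝ≥0} (hw : 0 < w) :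
    ∫ r, Real.exp (-(v / 2) * r ^ 2) ∂(gaussianReal 0 w) = (√(1 + v * w))⁻¹ := by
  have hw' : (0 : ℝ) < w := hw
  rw [integral_gaussianReal_eq_integral_smul hw.ne']
  have h1 : ∀ x : ℝ, gaussianPDFReal 0 w x • Real.exp (-(v / 2) * x ^ 2) =
      (√(2 * Real.pi * w))⁻¹ * Real.exp (-((1 + v * w) / (2 * w)) * x ^ 2) := by
    intro x
    rw [gaussianPDFReal, smul_eq_mul, mul_assoc, ← Real.exp_add]
    congr 2
    field_simp
    ring
  simp_rw [h1]
  rw [integral_const_mul, integral_gaussian, ← Real.sqrt_inv, ← Real.sqrt_inv, ← Real.sqrt_mul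
    (by positivity)]
  congr 1
  have := Real.pi_pos
  field_simp

/-- Normalized sums of many centred noise variables charge every neighbourhood of zero. -/
theorem exists_small_ball_le.{u} (v s : ℝ) (hv : 0 ≤ v) (hs : 0 < s) :
    ∃ p₀ : ℝ, 0 < p₀ ∧ ∃ m₀ : ℕ, 1 ≤ m₀ ∧ ∀ (Ω : Type u) [MeasurableSpace Ω] (μ : Measure Ω)
      (ζ : ℕ → Ω → ℝ) (B : ℝ), IsCentredNoise μ ζ B v → ∀ (m : ℕ), m₀ ≤ m →
      ∀ S : Finset ℕ, S.card ≤ m → p₀ ≤ μ.real {ω | |(∑ p ∈ S, ζ p ω) / √m| ≤ s} := by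
  -- With w = k² the main term A decays only like 1/k, while exp(-k²s²/2) is at most 2/(k²s²). The
  -- second entry of the maximum makes the latter at most A/2.
  set k : ℝ := max 1 (4 * (1 + v) / s ^ 2) with hk
  have hk1 : 1 ≤ k := le_max_left _ _
  have hk2 : 4 * (1 + v) / s ^ 2 ≤ k := le_max_right _ _
  set w : ℝ≥0 := ⟨k ^ 2, sq_nonneg k⟩ with hw
  have hwk : (w : ℝ) = k ^ 2 := rfl
  have hw0 : 0 < w := by
    rw [← NNReal.coe_pos, hwk]; positivity
  set A := (√(1 + v * w))⁻¹ with hA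
  have hA0 : 0 < A := by positivity
  have hexp : Real.exp (-(w / 2) * s ^ 2) ≤ A / 2 := by
    have h1 : Real.exp (-(w / 2) * s ^ 2) ≤ (w / 2 * s ^ 2)⁻¹ := by
      rw [neg_mul, Real.exp_neg]
      have : (0 : ℝ) < w / 2 * s ^ 2 := by positivity
      exact inv_anti₀ this (by linarith [Real.add_one_le_exp ((w : ℝ) / 2 * s ^ 2)])
    have h2 : √(1 + v * w) ≤ (1 + v) * k := by
      rw [Real.sqrt_le_left (by positivity), hwk]
      have : 1 ≤ k ^ 2 := by nlinarith
      nlinarith [mul_nonneg hv (sq_nonneg k), mul_nonneg (mul_nonneg hv hv) (sq_nonneg k)]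
    have h3 : 2 * √(1 + v * w) ≤ w / 2 * s ^ 2 := by
      rw [div_le_iff₀ (by positivity)] at hk2
      have h4 := mul_le_mul_of_nonneg_left hk2 (zero_le_one.trans hk1)
      calc 2 * √(1 + v * w) ≤ 2 * ((1 + v) * k) := by gcongr
        _ ≤ w / 2 * s ^ 2 := by rw [hwk]; linarith
    refine h1.trans ?_
    have e : A / 2 = (2 * √(1 + v * w))⁻¹ := by rw [hA, mul_inv]; ring
    rw [e]
    exact inv_anti₀ (by positivity) h3
  set E : ℝ := ∫ r, (4 * |r| ^ 3 * v + r ^ 4 * v ^ 2) ∂(gaussianReal 0 w) with hE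
  have hE0 : 0 ≤ E := integral_nonneg fun r => by positivity
  -- The main term A loses A/4 to the expansion error, by the choice of m₀, and A/2 to the region
  -- |Y| > s. What remains is A/4.
  refine ⟨A / 4, by positivity, max 1 ⌈(4 * E / A) ^ 2⌉₊, le_max_left _ _,
    fun Ω _ μ ζ B h m hm S hS => ?_⟩
  have := h.isProbabilityMeasure
  have hm1 : 1 ≤ m := (le_max_left _ _).trans hm
  have hm2 : (4 * E / A) ^ 2 ≤ m :=
    (Nat.le_ceil _).trans (by exact_mod_cast (le_max_right _ _).trans hm)
  have hsm : 0 < √(m : ℝ) := Real.sqrt_pos.mpr (by exact_mod_cast hm1)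
  have hEm : E / √m ≤ A / 4 := by
    have : 4 * E / A ≤ √m := Real.le_sqrt_of_sq_le hm2
    rw [div_le_iff₀ hA0] at this
    rw [div_le_iff₀ hsm]
    linarith
  set Y : Ω → ℝ := fun ω => (∑ p ∈ S, ζ p ω) / √m with hY
  have hYm : Measurable Y := (h.measurable_sum S).div_const _
  have hmap : IsProbabilityMeasure (μ.map Y) :=
    Measure.isProbabilityMeasure_map hYm.aemeasurable
  have h1 : A - E / √m ≤ ∫ ω, Real.exp (-(w / 2) * Y ω ^ 2) ∂μ := by
    have e1 : ∫ ω, Real.exp (-(w / 2) * Y ω ^ 2) ∂μ =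
        ∫ r, (charFun (μ.map Y) r).re ∂(gaussianReal 0 w) := by
      rw [← integral_exp_neg_mul_sq_eq_integral_charFun, integral_map hYm.aemeasurable
        (by fun_prop)]
    have i1 : Integrable (fun r => Real.exp (-(v / 2) * r ^ 2)) (gaussianReal 0 w) := by
      refine integrable_of_abs_le (C := 1) (by fun_prop) fun r => ?_
      rw [Real.abs_exp, Real.exp_le_one_iff]
      nlinarith [mul_nonneg hv (sq_nonneg r)]
    have i2 : Integrable (fun r => 4 * |r| ^ 3 * v + r ^ 4 * v ^ 2) (gaussianReal 0 w) := by
      have hp : ∀ k : ℕ, Integrable (fun r : ℝ => |r| ^ k) (gaussianReal 0 w) := fun k => by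
        have := (memLp_id_gaussianReal (μ := 0) (v := w) (k : ℝ≥0)).integrable_norm_pow'
        simpa using this
      refine (((hp 3).const_mul 4).mul_const v).add (((hp 4).congr ?_).mul_const _)
      exact ae_of_all _ fun r => by simp [← abs_pow, abs_of_nonneg (by positivity : 0 ≤ r ^ 4)]
    have i3 : Integrable (fun r => (charFun (μ.map Y) r).re) (gaussianReal 0 w) :=
      Integrable.of_bound (Complex.continuous_re.measurable.comp (by fun_prop)).aestronglyMeasurable
        1 (ae_of_all _ fun r => (Complex.abs_re_le_norm _).trans (norm_charFun_le_one r))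
    rw [e1, hA, ← integral_exp_neg_mul_sq_gaussianReal hv hw0, hE, ← integral_div,
      ← integral_sub i1 (i2.div_const _)]
    exact integral_mono (i1.sub (i2.div_const _)) i3
      fun r => re_charFun_sum_ge h S hm1 hS r
  have hms : MeasurableSet {ω | |Y ω| ≤ s} := measurableSet_le (by fun_prop) (by fun_prop)
  have h2 : ∫ ω, Real.exp (-(w / 2) * Y ω ^ 2) ∂μ ≤
      μ.real {ω | |Y ω| ≤ s} + Real.exp (-(w / 2) * s ^ 2) := by
    have : ∫ ω, Real.exp (-(w / 2) * Y ω ^ 2) ∂μ ≤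
        ∫ ω, ({ω | |Y ω| ≤ s}.indicator (fun _ => (1 : ℝ)) ω + Real.exp (-(w / 2) * s ^ 2)) ∂μ := by
      refine integral_mono ?_ (((integrable_const _).indicator hms).add (integrable_const _)) ?_
      · refine integrable_of_abs_le (C := 1) (by fun_prop) fun r => ?_
        rw [Real.abs_exp, Real.exp_le_one_iff]
        nlinarith [mul_nonneg w.coe_nonneg (sq_nonneg (Y r))]
      · intro ω
        simp only [Set.indicator_apply, Set.mem_ofPred_eq]
        split_ifs with hω
        · have : Real.exp (-(w / 2) * Y ω ^ 2) ≤ 1 := by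
            rw [Real.exp_le_one_iff]
            nlinarith [mul_nonneg w.coe_nonneg (sq_nonneg (Y ω))]
          linarith [Real.exp_pos (-(w / 2) * s ^ 2)]
        · rw [zero_add, Real.exp_le_exp]
          have : s ^ 2 ≤ Y ω ^ 2 := by
            rw [← sq_abs (Y ω)]
            have := (not_le.mp hω).le
            gcongr
          nlinarith [mul_le_mul_of_nonneg_left this w.coe_nonneg]
    rw [integral_add ((integrable_const _).indicator hms) (integrable_const _),
      integral_indicator hms] at this
    simpa using this
  linarith

/-! ### Window sums and blocking -/

section

/-- The observations in the window of half-span `M` around `t`. -/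
def window (n M t : ℕ) : Finset ℕ := (Finset.Icc 1 n).filter fun p => t ≤ p + M ∧ p ≤ t + M

theorem card_window_le (n M t : ℕ) : (window n M t).card ≤ 2 * M + 1 := by
  have : window n M t ⊆ Finset.Icc (t - M) (t + M) := fun p hp => by
    simp only [window, Finset.mem_filter, Finset.mem_Icc] at hp ⊢
    omega
  refine (Finset.card_le_card this).trans ?_
  simp only [Nat.card_Icc]
  omega

/-- Distinct centres in one residue class are at least 2M + 1 apart, which is just enough for
windows of half-span M not to meet. -/
theorem disjoint_window {n M t t' : ℕ} (h : t % (2 * M + 1) = t' % (2 * M + 1)) (hne : t ≠ t') :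
    Disjoint (window n M t) (window n M t') := by
  have key : ∀ t t' : ℕ, t % (2 * M + 1) = t' % (2 * M + 1) → t < t' → t + (2 * M + 1) ≤ t' := by
    intro t t' h hlt
    have h1 := (Nat.modEq_iff_dvd' hlt.le).mp h
    have := Nat.le_of_dvd (by omega) h1
    omega
  rw [Finset.disjoint_left]
  intro p hp hp'
  simp only [window, Finset.mem_filter] at hp hp'
  rcases lt_or_gt_of_ne hne with h1 | h1
  · have := key _ _ h h1; omega
  · have := key _ _ h.symm h1; omega

theorem card_filter_mod_le (n m r : ℕ) :
    ((Finset.Icc 1 n).filter fun t => t % m = r).card ≤ n / m + 1 := by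
  have : ((Finset.Icc 1 n).filter fun t => t % m = r).card ≤
      (Finset.range (n / m + 1)).card := by
    refine Finset.card_le_card_of_injOn (fun t => t / m) ?_ ?_
    · intro t ht
      simp only [Finset.coe_filter, Finset.mem_Icc, Set.mem_ofPred_eq] at ht
      simp only [Finset.coe_range, Set.mem_Iio]
      exact Nat.lt_succ_of_le (Nat.div_le_div_right ht.1.2)
    · intro t ht t' ht' h
      simp only [Finset.coe_filter, Finset.mem_Icc, Set.mem_ofPred_eq] at ht ht'
      simp only at h
      rw [← Nat.div_add_mod t m, ← Nat.div_add_mod t' m, h, ht.2, ht'.2]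
  simpa using this

/-- `W` is measurable with respect to every σ-algebra that makes the `ζ p`, `p ∈ S`, measurable. -/
def IsBlockMeasurable {Ω : Type*} (ζ : ℕ → Ω → ℝ) (S : Finset ℕ) (W : Ω → ℝ) : Prop :=
  ∀ _ : MeasurableSpace Ω, (∀ p ∈ S, Measurable (ζ p)) → Measurable W

theorem IsBlockMeasurable.measurable_iSup {Ω : Type*} {ζ : ℕ → Ω → ℝ} {S : Finset ℕ} {W : Ω → ℝ}
    (h : IsBlockMeasurable ζ S W) {U : Set ℕ} (hS : ∀ p ∈ S, p ∈ U) :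
    Measurable[⨆ p ∈ U, MeasurableSpace.comap (ζ p) inferInstance] W := by
  refine h _ fun p hp => ?_
  refine Measurable.mono (comap_measurable (ζ p)) ?_ le_rfl
  exact le_biSup (fun p => MeasurableSpace.comap (ζ p) inferInstance) (hS p hp)

variable {Ω : Type*} [mΩ : MeasurableSpace Ω] {μ : Measure Ω} {ζ : ℕ → Ω → ℝ} {B v : ℝ}

theorem IsBlockMeasurable.measurable {S : Finset ℕ} {W : Ω → ℝ} (h : IsBlockMeasurable ζ S W)
    (hm : ∀ p, Measurable (ζ p)) : Measurable W := h mΩ fun p _ => hm p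

/-- Disjoint index sets generate independent σ-algebras, so a new block is independent of the sum
over the earlier ones, and the factors split off one by one. -/
theorem mgf_sum_of_disjoint_blocks (hind : iIndepFun ζ μ) (hm : ∀ p, Measurable (ζ p))
    {S : ℕ → Finset ℕ} {W : ℕ → Ω → ℝ} (C : Finset ℕ)
    (hdis : ∀ t ∈ C, ∀ t' ∈ C, t ≠ t' → Disjoint (S t) (S t'))
    (hW : ∀ t ∈ C, IsBlockMeasurable ζ (S t) (W t)) (l : ℝ) :
    mgf (fun ω => ∑ t ∈ C, W t ω) μ l = ∏ t ∈ C, mgf (W t) μ l := by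
  have := hind.isProbabilityMeasure
  induction C using Finset.induction_on with
  | empty => simp [mgf]
  | insert t C ht ih =>
    rw [Finset.prod_insert ht, ← ih (fun a ha b hb => hdis a (Finset.mem_insert_of_mem ha) b
      (Finset.mem_insert_of_mem hb)) fun a ha => hW a (Finset.mem_insert_of_mem ha)]
    have hWt := hW t (Finset.mem_insert_self _ _)
    have hWC := fun a (ha : a ∈ C) => hW a (Finset.mem_insert_of_mem ha)
    have hsum : Measurable fun ω => ∑ a ∈ C, W a ω :=
      Finset.measurable_fun_sum _ fun a ha => (hWC a ha).measurable hm
    have hI := indep_iSup_of_disjoint (fun p => (hm p).comap_le)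
      ((iIndepFun_iff_iIndep _ _ _).mp hind) (S := (S t : Set ℕ)) (T := ⋃ a ∈ C, (S a : Set ℕ)) (by
        rw [Set.disjoint_iUnion₂_right]
        intro a ha
        rw [Finset.disjoint_coe]
        exact hdis t (Finset.mem_insert_self _ _) a (Finset.mem_insert_of_mem ha)
          fun h => ht (h ▸ ha))
    have hindep : IndepFun (W t) (fun ω => ∑ a ∈ C, W a ω) μ := by
      rw [IndepFun_iff_Indep]
      refine indep_of_indep_of_le_left (indep_of_indep_of_le_right hI ?_) ?_
      · rw [← measurable_iff_comap_le]
        refine Finset.measurable_fun_sum _ fun a ha => (hWC a ha).measurable_iSup ?_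
        intro p hp
        exact Set.mem_biUnion ha hp
      · rw [← measurable_iff_comap_le]
        exact hWt.measurable_iSup fun p hp => hp
    have h2 := hindep.mgf_add' (t := l) (hWt.measurable hm).aestronglyMeasurable
      hsum.aestronglyMeasurable
    rw [← h2]
    congr 1
    ext ω
    simp [Finset.sum_insert ht]

/-- At l = ±1/(s√m) the condition B ≤ s√m keeps |l|B ≤ 1, so each factor of the moment generating
function is at most exp(l²v). Since ml² ≤ 1, the product is at most exp(v), whatever the size of B.
-/
theorem IsCentredNoise.integral_exp_abs_sum_le (h : IsCentredNoise μ ζ B v) (S : Finset ℕ)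
    {m : ℕ} (hm : 1 ≤ m) (hS : S.card ≤ m) {s : ℝ} (hs : 1 ≤ s) (hsB : B ≤ s * √m) :
    ∫ ω, Real.exp (|(∑ p ∈ S, ζ p ω) / √m| / s) ∂μ ≤ 2 * Real.exp v := by
  have := h.isProbabilityMeasure
  have hm0 : (0 : ℝ) < m := by exact_mod_cast hm
  have hsm : 0 < √(m : ℝ) := Real.sqrt_pos.mpr hm0
  have hs0 : 0 < s := by linarith
  set l := (s * √m)⁻¹ with hl
  have hl0 : 0 < l := by positivity
  have key : ∀ l' : ℝ, |l'| = l → mgf (fun ω => ∑ p ∈ S, ζ p ω) μ l' ≤ Real.exp v := by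
    intro l' hl'
    have h1 : mgf (fun ω => ∑ p ∈ S, ζ p ω) μ l' = ∏ p ∈ S, mgf (ζ p) μ l' := by
      rw [← h.indep.mgf_sum h.meas S]; congr 1; ext ω; simp
    rw [h1]
    calc _ ≤ ∏ p ∈ S, Real.exp (l' ^ 2 * v) := by
          refine Finset.prod_le_prod (fun _ _ => mgf_nonneg) fun p _ =>
            mgf_le_of_bounded (h.meas p) (h.bdd p) (h.mean p) (h.sq p) ?_
          rw [hl', hl, inv_mul_le_iff₀ (by positivity)]
          linarith
      _ = Real.exp (S.card * (l ^ 2 * v)) := by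
          rw [Finset.prod_const, ← Real.exp_nat_mul, ← sq_abs, hl']
      _ ≤ _ := by
          refine Real.exp_le_exp.mpr ?_
          have hS' : (S.card : ℝ) ≤ m := by exact_mod_cast hS
          have hv := h.nonneg
          have e : m * l ^ 2 = (s ^ 2)⁻¹ := by
            rw [hl, inv_pow, mul_pow, Real.sq_sqrt hm0.le]; field_simp
          have h1 : (s ^ 2)⁻¹ ≤ 1 := inv_le_one_of_one_le₀ (by nlinarith)
          calc (S.card : ℝ) * (l ^ 2 * v) ≤ m * (l ^ 2 * v) := by gcongr
            _ = (s ^ 2)⁻¹ * v := by rw [← e]; ring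
            _ ≤ v := mul_le_of_le_one_left hv h1
  have hi : ∀ l', Integrable (fun ω => Real.exp (l' * ∑ p ∈ S, ζ p ω)) μ := fun l' =>
    integrable_exp_mul_of_abs_le (h.measurable_sum S) (h.abs_sum_le S) l'
  calc _ ≤ ∫ ω, (Real.exp (l * ∑ p ∈ S, ζ p ω) + Real.exp (-l * ∑ p ∈ S, ζ p ω)) ∂μ := by
        refine integral_mono_of_nonneg (ae_of_all _ fun _ => (Real.exp_pos _).le)
          ((hi _).add (hi _)) (ae_of_all _ fun ω => ?_)
        have e : |(∑ p ∈ S, ζ p ω) / √m| / s = |l * ∑ p ∈ S, ζ p ω| := by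
          rw [abs_mul, abs_of_pos hl0, abs_div, abs_of_pos hsm, hl]; field_simp
        simp only [e, neg_mul]
        rcases abs_cases (l * ∑ p ∈ S, ζ p ω) with ⟨h1, _⟩ | ⟨h1, _⟩ <;> rw [h1]
        · linarith [Real.exp_pos (-(l * ∑ p ∈ S, ζ p ω))]
        · linarith [Real.exp_pos (l * ∑ p ∈ S, ζ p ω)]
    _ = mgf (fun ω => ∑ p ∈ S, ζ p ω) μ l + mgf (fun ω => ∑ p ∈ S, ζ p ω) μ (-l) :=
        integral_add (hi _) (hi _)
    _ ≤ _ := by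
        have := key l (abs_of_pos hl0)
        have := key (-l) (by rw [abs_neg, abs_of_pos hl0])
        linarith

/-- Deviations of a sum of functions of the windows that are dominated by the normalized window
sums of the noise: the sum splits into `2 M + 1` sums of independent variables. -/
theorem IsCentredNoise.measureReal_window_sum_ge_le (h : IsCentredNoise μ ζ B v) {n M : ℕ}
    (hn : 2 * M + 1 ≤ n) {s : ℝ} (hs : 1 ≤ s) (hsB : B ≤ s * √(2 * M + 1 : ℕ)) {W : ℕ → Ω → ℝ}
    (hW : ∀ t ∈ Finset.Icc 1 n, IsBlockMeasurable ζ (window n M t) (W t))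
    (hWY : ∀ t ∈ Finset.Icc 1 n, ∀ ω, |W t ω| ≤
      |(∑ p ∈ window n M t, ζ p ω) / √(2 * M + 1 : ℕ)|)
    {y : ℝ} (hy : 0 ≤ y) :
    μ.real {ω | y * √((n : ℝ) * (2 * M + 1 : ℕ)) ≤
        ∑ t ∈ Finset.Icc 1 n, (W t ω - ∫ ω', W t ω' ∂μ)} ≤
      (2 * M + 1 : ℕ) * Real.exp (-min (y ^ 2 / (512 * Real.exp (v + 2 * Real.exp v) * s ^ 2))
        (y * √((n : ℝ) / (2 * M + 1 : ℕ)) / (8 * s))) := by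
  have := h.isProbabilityMeasure
  set m : ℕ := 2 * M + 1 with hm
  have hm1 : 1 ≤ m := by omega
  have hm0 : (0 : ℝ) < m := by exact_mod_cast hm1
  have hn0 : (0 : ℝ) < n := by exact_mod_cast hm1.trans hn
  have hs0 : 0 < s := by linarith
  -- The share of the level that falls to each residue class: m x = y √(nm). If the whole sum
  -- reaches the level, some class reaches x.
  set x := y * √((n : ℝ) / m) with hx
  have hxm : m * x = y * √((n : ℝ) * m) := by
    have : √((n : ℝ) * m) = √((n : ℝ) / m) * m := by
      have e : (n : ℝ) * m = n / m * (m * m) := by field_simp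
      rw [e, Real.sqrt_mul (by positivity), Real.sqrt_mul_self hm0.le]
    rw [this, hx]; ring
  set V : ℕ → Ω → ℝ := fun t ω => W t ω - ∫ ω', W t ω' ∂μ with hV
  set C : ℕ → Finset ℕ := fun r => (Finset.Icc 1 n).filter fun t => t % m = r with hC
  have hCI : ∀ r, ∀ t ∈ C r, t ∈ Finset.Icc 1 n := fun r t ht => (Finset.mem_filter.mp ht).1
  have hWm : ∀ t ∈ Finset.Icc 1 n, Measurable (W t) := fun t ht => (hW t ht).measurable h.meas
  have hVb : ∀ t ∈ Finset.Icc 1 n, IsBlockMeasurable ζ (window n M t) (V t) := fun t ht m' hm' =>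
    (hW t ht m' hm').sub_const _
  set κ := 32 * s ^ 2 * (2 * Real.exp v * Real.exp (2 * Real.exp v)) with hκ
  have hYR : ∀ t ω, |(∑ p ∈ window n M t, ζ p ω) / √(m : ℝ)| ≤ m * B := by
    intro t ω
    rw [abs_div, abs_of_nonneg (Real.sqrt_nonneg _)]
    have hB := h.bound_nonneg
    calc _ ≤ |∑ p ∈ window n M t, ζ p ω| :=
          div_le_self (abs_nonneg _) (Real.one_le_sqrt.mpr (by exact_mod_cast hm1))
      _ ≤ (window n M t).card * B := h.abs_sum_le _ _
      _ ≤ _ := by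
          gcongr
          exact_mod_cast card_window_le n M t
  have hclass : ∀ r, μ.real {ω | x ≤ ∑ t ∈ C r, V t ω} ≤
      Real.exp (-min (y ^ 2 / (512 * Real.exp (v + 2 * Real.exp v) * s ^ 2)) (x / (8 * s))) := by
    intro r
    -- Since m ≤ n, the extra 1 in the size of a residue class is at most n/m.
    have hcard : ((C r).card : ℝ) ≤ 2 * (n / m) := by
      have h1 : ((C r).card : ℝ) ≤ ((n / m : ℕ) : ℝ) + 1 := by
        exact_mod_cast card_filter_mod_le n m r
      have h2 : ((n / m : ℕ) : ℝ) ≤ n / m := Nat.cast_div_le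
      have h3 : (1 : ℝ) ≤ n / m := by
        rw [le_div_iff₀ hm0, one_mul]; exact_mod_cast hn
      linarith
    have hbern := measureReal_ge_le_exp_neg_min (μ := μ) (S := fun ω => ∑ t ∈ C r, V t ω)
      (R := ∑ t ∈ C r, (m * B + |∫ ω', W t ω' ∂μ|)) (V := 2 * (n / m) * κ) (l₀ := 1 / (4 * s))
      (x := x) (Finset.measurable_fun_sum _ fun t ht => (hWm t (hCI r t ht)).sub_const _)
      (fun ω => (Finset.abs_sum_le_sum_abs _ _).trans (Finset.sum_le_sum fun t ht =>
        (abs_sub _ _).trans (add_le_add ((hWY t (hCI r t ht) ω).trans (hYR t ω)) le_rfl)))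
      (by positivity) (by positivity) (by positivity) ?_
    · refine hbern.trans (Real.exp_le_exp.mpr (neg_le_neg (le_of_eq ?_)))
      congr 1
      · rw [hκ, hx, mul_pow, Real.sq_sqrt (by positivity), Real.exp_add]
        field_simp
        ring
      · field_simp
        ring
    · intro l hl0 hl
      rw [mgf_sum_of_disjoint_blocks h.indep h.meas (S := window n M) (C r) ?_ fun t ht => hVb t (hCI r t ht)]
      · calc ∏ t ∈ C r, mgf (V t) μ l ≤ ∏ t ∈ C r, Real.exp (l ^ 2 * κ) := by
              refine Finset.prod_le_prod (fun _ _ => mgf_nonneg) fun t ht => ?_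
              refine mgf_sub_integral_le (hWm t (hCI r t ht)) ((h.measurable_sum _).div_const _) (hYR t)
                (hWY t (hCI r t ht)) hs0 (h.integral_exp_abs_sum_le _ hm1 (card_window_le n M t) hs hsB) ?_
              rw [abs_of_nonneg hl0]
              calc l * s ≤ 1 / (4 * s) * s := by gcongr
                _ = 1 / 4 := by field_simp
          _ = Real.exp ((C r).card * (l ^ 2 * κ)) := by
              rw [Finset.prod_const, ← Real.exp_nat_mul]
          _ ≤ _ := by
              refine Real.exp_le_exp.mpr ?_
              calc ((C r).card : ℝ) * (l ^ 2 * κ) ≤ 2 * (n / m) * (l ^ 2 * κ) := by gcongr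
                _ = _ := by ring
      · intro t ht t' ht' hne
        simp only [hC, Finset.mem_filter] at ht ht'
        exact disjoint_window (by rw [← hm, ht.2, ht'.2]) hne
  have hsub : {ω | y * √((n : ℝ) * m) ≤ ∑ t ∈ Finset.Icc 1 n, V t ω} ⊆
      ⋃ r ∈ Finset.range m, {ω | x ≤ ∑ t ∈ C r, V t ω} := by
    intro ω hω
    simp only [Set.mem_ofPred_eq, ← hxm] at hω
    have hfib : ∑ r ∈ Finset.range m, ∑ t ∈ C r, V t ω = ∑ t ∈ Finset.Icc 1 n, V t ω :=
      Finset.sum_fiberwise_of_maps_to (fun t _ => Finset.mem_range.mpr (Nat.mod_lt _ hm1)) _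
    by_contra hcon
    simp only [Set.mem_iUnion, Set.mem_ofPred_eq, not_exists, not_le, Finset.mem_range] at hcon
    have : ∑ r ∈ Finset.range m, ∑ t ∈ C r, V t ω < ∑ r ∈ Finset.range m, x :=
      Finset.sum_lt_sum_of_nonempty ⟨0, by simp; omega⟩ fun r hr =>
        hcon r (Finset.mem_range.mp hr)
    rw [hfib] at this
    simp at this
    linarith
  calc _ ≤ μ.real (⋃ r ∈ Finset.range m, {ω | x ≤ ∑ t ∈ C r, V t ω}) := measureReal_mono hsub (measure_ne_top _ _)
    _ ≤ ∑ r ∈ Finset.range m, μ.real {ω | x ≤ ∑ t ∈ C r, V t ω} :=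
        measureReal_biUnion_finset_le _ _
    _ ≤ ∑ r ∈ Finset.range m, _ := Finset.sum_le_sum fun r _ => hclass r
    _ = _ := by simp

end

/-! ### Bounded variation and the bias of the pre-fit -/

/-- The variation of `f` over the dyadic grid of mesh `2 ^ (-J)` of `[0, 1]`. -/
noncomputable def dyadicVariation (f : ℝ → ℝ) (J : ℕ) : ℝ :=
  ∑ i ∈ Finset.range (nObs J), |f (((i + 1 : ℕ) : ℝ) / nObs J) - f ((i : ℝ) / nObs J)|

theorem nObs_pos (J : ℕ) : 0 < nObs J := by unfold nObs; positivity

theorem nObs_cast_pos (J : ℕ) : (0 : ℝ) < nObs J := by exact_mod_cast nObs_pos J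

theorem sum_range_two_mul (g : ℕ → ℝ) (n : ℕ) :
    ∑ i ∈ Finset.range (2 * n), g i = ∑ i ∈ Finset.range n, (g (2 * i) + g (2 * i + 1)) := by
  induction n with
  | zero => simp
  | succ n ih =>
    rw [Finset.sum_range_succ, ← ih, show 2 * (n + 1) = 2 * n + 1 + 1 by ring,
      Finset.sum_range_succ, Finset.sum_range_succ]
    ring

/-- The grids are nested: each step halves the cells, and inserting midpoints can only increase the
sum of increments. -/
theorem dyadicVariation_mono (f : ℝ → ℝ) : Monotone (dyadicVariation f) := by
  refine monotone_nat_of_le_succ fun J => ?_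
  have hn : nObs (J + 1) = 2 * nObs J := by simp only [nObs, pow_succ]; ring
  have hJ := (nObs_cast_pos J).ne'
  simp only [dyadicVariation]
  rw [hn, sum_range_two_mul]
  refine Finset.sum_le_sum fun i _ => ?_
  have e1 : (((2 * i + 1 + 1 : ℕ) : ℝ) / (2 * nObs J : ℕ)) = ((i + 1 : ℕ) : ℝ) / nObs J := by
    push_cast; field_simp; ring
  have e2 : (((2 * i : ℕ) : ℝ) / (2 * nObs J : ℕ)) = (i : ℝ) / nObs J := by
    push_cast; field_simp
  rw [e1, e2]
  exact (abs_sub_le _ (f (((2 * i + 1 : ℕ) : ℝ) / (2 * nObs J : ℕ))) _).trans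
    (le_of_eq (add_comm _ _))

theorem dyadicVariation_le {f : ℝ → ℝ} (hf : BoundedVariationOn f (Set.Icc 0 1)) (J : ℕ) :
    dyadicVariation f J ≤ (eVariationOn f (Set.Icc 0 1)).toReal := by
  have hJ := nObs_cast_pos J
  have h := eVariationOn.sum_le_of_monotoneOn_Iic (f := f) (s := Set.Icc 0 1) (n := nObs J)
    (u := fun i => (i : ℝ) / nObs J) (fun a _ b _ hab => by
      have : (a : ℝ) ≤ b := by exact_mod_cast hab
      exact div_le_div_of_nonneg_right this hJ.le) (fun i hi => ⟨by positivity, by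
        rw [div_le_one hJ]; exact_mod_cast hi⟩)
  have h2 := ENNReal.toReal_mono hf h
  rw [ENNReal.toReal_sum (fun _ _ => edist_ne_top _ _)] at h2
  refine le_trans (le_of_eq ?_) h2
  refine Finset.sum_congr rfl fun i _ => ?_
  rw [edist_dist, ENNReal.toReal_ofReal dist_nonneg, Real.dist_eq]

/-- Truncation of the real line to `[u - b, u + b]`. -/
noncomputable def clampAt (u b x : ℝ) : ℝ := max (u - b) (min (u + b) x)

theorem clampAt_eq_self {u b x : ℝ} (h : |x - u| ≤ b) : clampAt u b x = x := by
  rw [abs_le] at h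
  rw [clampAt, min_eq_right (by linarith), max_eq_right (by linarith)]

theorem clampAt_mono (u b : ℝ) : Monotone (clampAt u b) := fun x y h => by
  unfold clampAt; gcongr

theorem sub_clampAt_mono (u b : ℝ) : Monotone fun x => x - clampAt u b x := fun x y h => by
  simp only [clampAt]
  rcases max_cases (u - b) (min (u + b) x) with h1 | h1 <;>
  rcases max_cases (u - b) (min (u + b) y) with h2 | h2 <;>
  rcases min_cases (u + b) x with h3 | h3 <;> rcases min_cases (u + b) y with h4 | h4 <;> linarith

/-- The truncation and its remainder are both non-decreasing, so their increments have the same sign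
and nothing cancels. Hence variation is exactly additive over the band and its complement. -/
theorem abs_clampAt_sub_add (u b x y : ℝ) :
    |clampAt u b x - clampAt u b y| + |(x - clampAt u b x) - (y - clampAt u b y)| = |x - y| := by
  rcases le_total x y with h | h
  · have h1 := clampAt_mono u b h
    have h2 := sub_clampAt_mono u b h
    simp only at h2
    rw [abs_of_nonpos (by linarith), abs_of_nonpos (by linarith), abs_of_nonpos (by linarith)]
    ring
  · have h1 := clampAt_mono u b h
    have h2 := sub_clampAt_mono u b h
    simp only at h2
    rw [abs_of_nonneg (by linarith), abs_of_nonneg (by linarith), abs_of_nonneg (by linarith)]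
    ring

theorem abs_clampAt_sub_le {b : ℝ} (hb : 0 ≤ b) (u x y : ℝ) :
    |clampAt u b x - clampAt u b y| ≤ 2 * b := by
  have h : ∀ x, u - b ≤ clampAt u b x ∧ clampAt u b x ≤ u + b := fun x =>
    ⟨le_max_left _ _, max_le (by linarith) (min_le_left _ _)⟩
  rw [abs_le]
  constructor <;> linarith [(h x).1, (h x).2, (h y).1, (h y).2]

/-- A function of bounded variation varies little within bands of small height, uniformly in the
position of the band. -/
theorem exists_dyadicVariation_clampAt_le {f : ℝ → ℝ} (hf : BoundedVariationOn f (Set.Icc 0 1))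
    {η : ℝ} (hη : 0 < η) :
    ∃ b₀ : ℝ, 0 < b₀ ∧ ∃ J₀ : ℕ, ∀ J, J₀ ≤ J → ∀ u b : ℝ, 0 ≤ b → b ≤ b₀ →
      dyadicVariation (fun x => clampAt u b (f x)) J ≤ η := by
  have hbdd : BddAbove (Set.range (dyadicVariation f)) :=
    ⟨_, Set.forall_mem_range.mpr fun J => dyadicVariation_le hf J⟩
  -- This grid captures the supremum of the dyadic variations up to η/2. On it the truncated part
  -- has 2^J₀ increments of size at most 2b, in total at most η/2. On finer grids the remainder
  -- keeps its variation, so the truncated part can gain at most the missing η/2. Nothing depends on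
  -- u.
  obtain ⟨J₀, hJ₀⟩ := exists_lt_of_lt_ciSup
    (show (⨆ J, dyadicVariation f J) - η / 2 < ⨆ J, dyadicVariation f J by linarith)
  have hN := nObs_cast_pos J₀
  refine ⟨η / (4 * nObs J₀), by positivity, J₀, fun J hJ u b hb hbb => ?_⟩
  have key : ∀ J, dyadicVariation (fun x => clampAt u b (f x)) J +
      dyadicVariation (fun x => f x - clampAt u b (f x)) J = dyadicVariation f J := fun J => by
    simp only [dyadicVariation]
    rw [← Finset.sum_add_distrib]
    exact Finset.sum_congr rfl fun i _ => abs_clampAt_sub_add _ _ _ _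
  have h1 : dyadicVariation (fun x => clampAt u b (f x)) J₀ ≤ η / 2 := by
    calc _ ≤ ∑ i ∈ Finset.range (nObs J₀), 2 * b :=
          Finset.sum_le_sum fun i _ => abs_clampAt_sub_le hb _ _ _
      _ = nObs J₀ * (2 * b) := by simp
      _ ≤ nObs J₀ * (2 * (η / (4 * nObs J₀))) := by gcongr
      _ = η / 2 := by field_simp; ring
  have h2 := dyadicVariation_mono (fun x => f x - clampAt u b (f x)) hJ
  have h3 := le_ciSup hbdd J
  linarith [key J, key J₀]

/-- The variation of the sequence `g` over the window of half-span `M` around `t`. -/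
noncomputable def windowVariation (g : ℕ → ℝ) (n M t : ℕ) : ℝ :=
  ∑ i ∈ (Finset.range n).filter (fun i => t ≤ i + M ∧ i < t + M), |g (i + 1) - g i|

theorem windowVariation_nonneg (g : ℕ → ℝ) (n M t : ℕ) : 0 ≤ windowVariation g n M t :=
  Finset.sum_nonneg fun _ _ => abs_nonneg _

theorem abs_sub_le_windowVariation (g : ℕ → ℝ) {n M t p : ℕ} (ht : t ≤ n)
    (hp : p ∈ window n M t) : |g p - g t| ≤ windowVariation g n M t := by
  simp only [window, Finset.mem_filter, Finset.mem_Icc] at hp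
  have key : ∀ a b : ℕ, a ≤ b → b ≤ n → t ≤ a + M → b ≤ t + M →
      |g a - g b| ≤ windowVariation g n M t := by
    intro a b hab hbn h1 h2
    have := dist_le_Ico_sum_dist g hab
    rw [Real.dist_eq] at this
    refine this.trans ?_
    rw [windowVariation]
    calc _ = ∑ i ∈ Finset.Ico a b, |g (i + 1) - g i| :=
          Finset.sum_congr rfl fun i _ => by rw [Real.dist_eq, abs_sub_comm]
      _ ≤ _ := by
          refine Finset.sum_le_sum_of_subset_of_nonneg (fun i hi => ?_) fun _ _ _ => abs_nonneg _
          simp only [Finset.mem_Ico] at hi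
          simp only [Finset.mem_filter, Finset.mem_range]
          omega
  rcases le_total p t with h | h
  · exact key p t h ht hp.2.1 (by omega)
  · rw [abs_sub_comm]
    exact key t p h hp.1.2 (by omega) hp.2.2

/-- Exchange of summation: each increment is seen by at most 2M windows. -/
theorem sum_windowVariation_le (g : ℕ → ℝ) (n M : ℕ) :
    ∑ t ∈ Finset.Icc 1 n, windowVariation g n M t ≤
      2 * M * ∑ i ∈ Finset.range n, |g (i + 1) - g i| := by
  simp only [windowVariation, Finset.sum_filter]
  rw [Finset.sum_comm, Finset.mul_sum]
  refine Finset.sum_le_sum fun i _ => ?_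
  rw [← Finset.sum_filter, Finset.sum_const, nsmul_eq_mul]
  gcongr
  have : (Finset.Icc 1 n).filter (fun t => t ≤ i + M ∧ i < t + M) ⊆
      Finset.Icc (i + 1 - M) (i + M) := fun t ht => by
    simp only [Finset.mem_filter, Finset.mem_Icc] at ht ⊢
    omega
  have h2 := Finset.card_le_card this
  rw [Nat.card_Icc] at h2
  have h3 : ((Finset.Icc 1 n).filter (fun t => t ≤ i + M ∧ i < t + M)).card ≤ 2 * M ∨
    (i < M ∧ ((Finset.Icc 1 n).filter (fun t => t ≤ i + M ∧ i < t + M)).card ≤ 2 * M) := by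
    by_cases h : M ≤ i
    · left; omega
    · right
      refine ⟨by omega, ?_⟩
      have : (Finset.Icc 1 n).filter (fun t => t ≤ i + M ∧ i < t + M) ⊆ Finset.Icc 1 (i + M) :=
        fun t ht => by
          simp only [Finset.mem_filter, Finset.mem_Icc] at ht ⊢
          omega
      have h4 := Finset.card_le_card this
      rw [Nat.card_Icc] at h4
      omega
  have h4 : ((Finset.Icc 1 n).filter (fun t => t ≤ i + M ∧ i < t + M)).card ≤ 2 * M :=
    h3.elim id And.right
  exact_mod_cast h4

theorem card_window_of_interior {n M t : ℕ} (h1 : M < t) (h2 : t + M ≤ n) :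
    (window n M t).card = 2 * M + 1 := by
  have : window n M t = Finset.Icc (t - M) (t + M) := by
    ext p
    simp only [window, Finset.mem_filter, Finset.mem_Icc]
    omega
  rw [this, Nat.card_Icc]
  omega

/-- At these points the window is incomplete while the divisor is still 2M + 1, so the mean does not
reproduce constants. They are few enough for trivial bounds. -/
theorem card_boundary_le (n M : ℕ) :
    ((Finset.Icc 1 n).filter fun t => ¬ (M < t ∧ t + M ≤ n)).card ≤ 2 * M := by
  have : (Finset.Icc 1 n).filter (fun t => ¬ (M < t ∧ t + M ≤ n)) ⊆
      Finset.Icc 1 M ∪ Finset.Icc (n + 1 - M) n := fun t ht => by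
    simp only [Finset.mem_filter, Finset.mem_Icc, Finset.mem_union] at ht ⊢
    omega
  refine (Finset.card_le_card this).trans ((Finset.card_union_le _ _).trans ?_)
  simp only [Nat.card_Icc]
  omega

/-- The window mean of a sequence, normalized by the nominal size of the window. -/
noncomputable def windowMean (n M : ℕ) (x : ℕ → ℝ) (t : ℕ) : ℝ :=
  (∑ p ∈ window n M t, x p) / (2 * M + 1 : ℕ)

theorem movingAverage_eq (J M : ℕ) (x : ℕ → ℝ) (t : ℕ) :
    movingAverage J M x t = windowMean (nObs J) M x t := by
  simp only [movingAverage, windowMean, window]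
  push_cast
  ring

theorem abs_windowMean_le {n M t : ℕ} {x : ℕ → ℝ} {C : ℝ} (hC : 0 ≤ C)
    (hx : ∀ p ∈ Finset.Icc 1 n, |x p| ≤ C) : |windowMean n M x t| ≤ C := by
  have hm : (0 : ℝ) < (2 * M + 1 : ℕ) := by positivity
  rw [windowMean, abs_div, abs_of_pos hm, div_le_iff₀ hm]
  calc |∑ p ∈ window n M t, x p| ≤ ∑ p ∈ window n M t, |x p| := Finset.abs_sum_le_sum_abs _ _
    _ ≤ ∑ p ∈ window n M t, C := Finset.sum_le_sum fun p hp => hx p (Finset.mem_filter.mp hp).1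
    _ = (window n M t).card * C := by simp
    _ ≤ (2 * M + 1 : ℕ) * C := by
        have := card_window_le n M t
        gcongr
    _ = _ := mul_comm _ _

theorem abs_windowMean_sub_le {n M t : ℕ} {x : ℕ → ℝ} {y C : ℝ} (h1 : M < t) (h2 : t + M ≤ n)
    (hx : ∀ p ∈ window n M t, |x p - y| ≤ C) : |windowMean n M x t - y| ≤ C := by
  have hm : (0 : ℝ) < (2 * M + 1 : ℕ) := by positivity
  have hc := card_window_of_interior h1 h2
  have e : windowMean n M x t - y = (∑ p ∈ window n M t, (x p - y)) / (2 * M + 1 : ℕ) := by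
    rw [windowMean, Finset.sum_sub_distrib, Finset.sum_const, hc, nsmul_eq_mul]
    field_simp
  rw [e, abs_div, abs_of_pos hm, div_le_iff₀ hm]
  calc |∑ p ∈ window n M t, (x p - y)| ≤ ∑ p ∈ window n M t, |x p - y| :=
        Finset.abs_sum_le_sum_abs _ _
    _ ≤ ∑ p ∈ window n M t, C := Finset.sum_le_sum hx
    _ = _ := by rw [Finset.sum_const, hc, nsmul_eq_mul, mul_comm]

/-- The total bias of the moving average of a sequence of bounded variation. -/
theorem sum_abs_windowMean_sub_le {n M : ℕ} {g e : ℕ → ℝ} {A r : ℝ} (hr : 0 ≤ r)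
    (hg : ∀ p ∈ Finset.Icc 1 n, |g p| ≤ A) (he : ∀ p ∈ Finset.Icc 1 n, |e p| ≤ r) (hA : 0 ≤ A) :
    ∑ t ∈ Finset.Icc 1 n, |windowMean n M (fun p => g p + e p) t - g t| ≤
      2 * M * (∑ i ∈ Finset.range n, |g (i + 1) - g i|) + n * r + 4 * M * A := by
  have key : ∀ t ∈ Finset.Icc 1 n, |windowMean n M (fun p => g p + e p) t - g t| ≤
      windowVariation g n M t + r + if ¬ (M < t ∧ t + M ≤ n) then 2 * A else 0 := by
    intro t ht
    by_cases h : M < t ∧ t + M ≤ n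
    swap
    · rw [if_pos h]
      have h1 : |windowMean n M (fun p => g p + e p) t| ≤ A + r :=
        abs_windowMean_le (by positivity) fun p hp =>
          (abs_add_le _ _).trans (add_le_add (hg p hp) (he p hp))
      have h2 := abs_sub (windowMean n M (fun p => g p + e p) t) (g t)
      have h3 := windowVariation_nonneg g n M t
      linarith [hg t ht]
    · rw [if_neg (not_not.mpr h), add_zero]
      refine abs_windowMean_sub_le h.1 h.2 fun p hp => ?_
      have h1 := abs_sub_le_windowVariation g (Finset.mem_Icc.mp ht).2 hp
      have h2 := he p (Finset.mem_filter.mp hp).1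
      have h3 := abs_add_le (g p - g t) (e p)
      rw [show g p + e p - g t = g p - g t + e p by ring]
      linarith
  refine (Finset.sum_le_sum key).trans ?_
  rw [Finset.sum_add_distrib, Finset.sum_add_distrib, ← Finset.sum_filter, Finset.sum_const,
    Finset.sum_const, nsmul_eq_mul, nsmul_eq_mul, Nat.card_Icc]
  have h1 := sum_windowVariation_le g n M
  have h2 : (((Finset.Icc 1 n).filter fun t => ¬ (M < t ∧ t + M ≤ n)).card : ℝ) ≤ 2 * M := by
    exact_mod_cast card_boundary_le n M
  have h3 := mul_le_mul_of_nonneg_right h2 (by positivity : 0 ≤ 2 * A)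
  simp only [add_tsub_cancel_right]
  linarith

/-- The kernel sum loses little when the design values are replaced by their window means, as
soon as the sequence varies little in the band of the kernel. -/
theorem sum_kernel_windowMean_ge {n M : ℕ} {K : ℝ → ℝ} {Kb L b u r : ℝ} {g e : ℕ → ℝ}
    (hK0 : ∀ z, 0 ≤ K z) (hKs : ∀ z, z ∉ Set.Icc (-(1 / 2) : ℝ) (1 / 2) → K z = 0)
    (hKb : ∀ z, K z ≤ Kb) (hKL : ∀ z w, |K z - K w| ≤ L * |z - w|) (hL : 0 ≤ L) (hb : 0 < b)
    (hr : 0 ≤ r) (he : ∀ p ∈ Finset.Icc 1 n, |e p| ≤ r) :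
    ∑ t ∈ Finset.Icc 1 n, K ((g t - u) / b) ≤
      ∑ t ∈ Finset.Icc 1 n, K ((windowMean n M (fun p => g p + e p) t - u) / b) +
        (L * r / b * n + (L + 2 * Kb) / b * (2 * M *
          (∑ i ∈ Finset.range n, |clampAt u b (g (i + 1)) - clampAt u b (g i)|)) +
          2 * M * Kb) := by
  have hKb0 : 0 ≤ Kb := (hK0 0).trans (hKb 0)
  set φ : ℕ → ℝ := fun i => clampAt u b (g i) with hφ
  have key : ∀ t ∈ Finset.Icc 1 n, K ((g t - u) / b) ≤
      K ((windowMean n M (fun p => g p + e p) t - u) / b) + (L * r / b +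
        (L + 2 * Kb) / b * windowVariation φ n M t +
        if ¬ (M < t ∧ t + M ≤ n) then Kb else 0) := by
    intro t ht
    set m := windowMean n M (fun p => g p + e p) t with hm
    have hw := windowVariation_nonneg φ n M t
    have hK' := hK0 ((m - u) / b)
    have h1 : 0 ≤ L * r / b := by positivity
    have h2 : 0 ≤ (L + 2 * Kb) / b * windowVariation φ n M t := by positivity
    by_cases h : M < t ∧ t + M ≤ n
    swap
    · rw [if_pos h]
      linarith [hKb ((g t - u) / b)]
    rw [if_neg (not_not.mpr h)]
    by_cases hz : (g t - u) / b ∈ Set.Icc (-(1 / 2) : ℝ) (1 / 2)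
    swap
    · rw [hKs _ hz]; linarith
    have hgt : |g t - u| ≤ b / 2 := by
      rw [Set.mem_Icc, ← abs_le, abs_div, abs_of_pos hb, div_le_iff₀ hb] at hz
      linarith
    have hφt : φ t = g t := clampAt_eq_self (by linarith)
    by_cases hp : ∀ p ∈ window n M t, |g p - g t| ≤ b / 2
    · have h3 : |m - g t| ≤ windowVariation φ n M t + r := by
        refine abs_windowMean_sub_le h.1 h.2 fun p hpw => ?_
        have h4 := abs_sub_le_windowVariation φ (Finset.mem_Icc.mp ht).2 hpw
        have hφp : φ p = g p := clampAt_eq_self (by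
          have := abs_add_le (g p - g t) (g t - u)
          rw [show g p - g t + (g t - u) = g p - u by ring] at this
          linarith [hp p hpw])
        rw [hφp, hφt] at h4
        have h5 := he p (Finset.mem_filter.mp hpw).1
        have h6 := abs_add_le (g p - g t) (e p)
        rw [show g p + e p - g t = g p - g t + e p by ring]
        linarith
      have h4 := le_of_abs_le (hKL ((g t - u) / b) ((m - u) / b))
      have h5 : |(g t - u) / b - (m - u) / b| = |m - g t| / b := by
        rw [← sub_div, abs_div, abs_of_pos hb, abs_sub_comm]; ring_nf
      rw [h5] at h4
      have h6 : L * (|m - g t| / b) ≤ L * ((windowVariation φ n M t + r) / b) := by gcongr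
      have h7 : (L + 2 * Kb) / b * windowVariation φ n M t =
          L * (windowVariation φ n M t / b) + 2 * Kb / b * windowVariation φ n M t := by ring
      have h8 : 0 ≤ 2 * Kb / b * windowVariation φ n M t := by positivity
      rw [add_div, mul_add] at h6
      rw [mul_div_assoc]
      linarith
    -- Otherwise the window leaves g t by more than b/2, and the clamped sequence still moves by
    -- b/2. The term (2 Kb / b) times the band variation then pays for the whole kernel value.
    · push Not at hp
      obtain ⟨p, hpw, hpb⟩ := hp
      have h4 := abs_sub_le_windowVariation φ (Finset.mem_Icc.mp ht).2 hpw
      have h5 : b / 2 ≤ |φ p - φ t| := by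
        rw [hφt]
        rw [abs_le] at hgt
        simp only [hφ, clampAt]
        rcases abs_cases (g p - g t) with ⟨h6, _⟩ | ⟨h6, _⟩ <;> rw [h6] at hpb
        · refine le_trans ?_ (le_abs_self _)
          have : g t + b / 2 ≤ max (u - b) (min (u + b) (g p)) :=
            le_max_of_le_right (le_min (by linarith) (by linarith))
          linarith
        · refine le_trans ?_ (neg_le_abs _)
          have : max (u - b) (min (u + b) (g p)) ≤ g t - b / 2 :=
            max_le (by linarith) ((min_le_right _ _).trans (by linarith))
          linarith
      have h6 : 2 * Kb / b * (b / 2) ≤ 2 * Kb / b * windowVariation φ n M t := by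
        have := h5.trans h4
        gcongr
      have h7 : 2 * Kb / b * (b / 2) = Kb := by field_simp
      have h8 : (L + 2 * Kb) / b * windowVariation φ n M t =
          L / b * windowVariation φ n M t + 2 * Kb / b * windowVariation φ n M t := by ring
      have h9 : 0 ≤ L / b * windowVariation φ n M t := by positivity
      linarith [hKb ((g t - u) / b)]
  refine (Finset.sum_le_sum key).trans ?_
  rw [Finset.sum_add_distrib, Finset.sum_add_distrib, Finset.sum_add_distrib, ← Finset.sum_filter,
    Finset.sum_const, Finset.sum_const, nsmul_eq_mul, nsmul_eq_mul, Nat.card_Icc, ← Finset.mul_sum]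
  have h1 := mul_le_mul_of_nonneg_left (sum_windowVariation_le φ n M)
    (by positivity : 0 ≤ (L + 2 * Kb) / b)
  have h2 : (((Finset.Icc 1 n).filter fun t => ¬ (M < t ∧ t + M ≤ n)).card : ℝ) ≤ 2 * M := by
    exact_mod_cast card_boundary_le n M
  have h3 := mul_le_mul_of_nonneg_right h2 hKb0
  simp only [add_tsub_cancel_right]
  simp only [hφ] at h1 ⊢
  linarith

/-! ### Truncation of the noise -/

section

variable {Ω : Type*} [mΩ : MeasurableSpace Ω] {μ : Measure Ω}

/-- A finite independent family stays independent when it is continued by zero. -/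
theorem iIndepFun_extend_zero [IsProbabilityMeasure μ] {S : Finset ℕ} {Y : ℕ → Ω → ℝ}
    (h : iIndepFun (fun t : S => Y (t : ℕ)) μ) :
    iIndepFun (fun t ω => if t ∈ S then Y t ω else 0) μ := by
  rw [iIndepFun_iff_measure_inter_preimage_eq_mul] at h ⊢
  intro T s hs
  set f : ℕ → Ω → ℝ := fun t ω => if t ∈ S then Y t ω else 0 with hf
  -- The preimage of a set under the zero function is everything or empty. Either the indices
  -- outside S contribute factors 1, or both sides vanish.
  by_cases h0 : ∀ i ∈ T, i ∉ S → (0 : ℝ) ∈ s i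
  · have hpre : ∀ i ∈ T, i ∉ S → f i ⁻¹' s i = Set.univ := fun i hi hiS => by
      ext ω; simp [hf, hiS, h0 i hi hiS]
    have hpre' : ∀ i ∈ S, f i ⁻¹' s i = Y i ⁻¹' s i := fun i hi => by
      ext ω; simp [hf, hi]
    have h1 := h (T.subtype (· ∈ S)) (sets := fun i => s i) (fun i hi => hs i (by simpa using hi))
    have e1 : (⋂ i ∈ T, f i ⁻¹' s i) = ⋂ i ∈ T.subtype (· ∈ S), Y i ⁻¹' s i := by
      ext ω
      simp only [Set.mem_iInter, Finset.mem_subtype]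
      constructor
      · intro hω i hi
        rw [← hpre' i i.2]; exact hω i hi
      · intro hω i hi
        by_cases hiS : i ∈ S
        · rw [hpre' i hiS]; exact hω ⟨i, hiS⟩ hi
        · rw [hpre i hi hiS]; trivial
    have e2 : ∏ i ∈ T, μ (f i ⁻¹' s i) = ∏ i ∈ T.subtype (· ∈ S), μ (Y i ⁻¹' s i) := by
      rw [← Finset.prod_filter_mul_prod_filter_not T (· ∈ S),
        Finset.prod_eq_one (s := T.filter fun i => ¬ i ∈ S) fun i hi => by
          rw [Finset.mem_filter] at hi; rw [hpre i hi.1 hi.2, measure_univ], mul_one,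
        ← Finset.subtype_map, Finset.prod_map]
      exact Finset.prod_congr rfl fun i _ => by
        rw [← hpre' i i.2]; rfl
    rw [e1, e2, h1]
  · push Not at h0
    obtain ⟨i, hi, hiS, hi0⟩ := h0
    have hemp : f i ⁻¹' s i = ∅ := by ext ω; simp [hf, hiS, hi0]
    rw [Finset.prod_eq_zero hi (by rw [hemp, measure_empty])]
    refine measure_mono_null (Set.biInter_subset_of_mem hi) ?_
    rw [hemp, measure_empty]

/-- Truncation of a real number at the level `B`. -/
noncomputable def truncAt (B x : ℝ) : ℝ := if |x| ≤ B then x else 0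

theorem measurable_truncAt (B : ℝ) : Measurable (truncAt B) :=
  Measurable.ite (measurableSet_le (by fun_prop) (by fun_prop)) measurable_id measurable_const

theorem abs_truncAt_le {B : ℝ} (hB : 0 ≤ B) (x : ℝ) : |truncAt B x| ≤ B := by
  unfold truncAt; split_ifs with h
  · exact h
  · simpa using hB

theorem abs_truncAt_le_abs (B x : ℝ) : |truncAt B x| ≤ |x| := by
  unfold truncAt; split_ifs with h
  · exact le_rfl
  · simp

/-- The truncated variables of a finite family, continued by zero. -/
noncomputable def truncNoise (S : Finset ℕ) (B : ℝ) (ε : ℕ → Ω → ℝ) (t : ℕ) (ω : Ω) : ℝ :=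
  if t ∈ S then truncAt B (ε t ω) else 0

/-- A finite family of independent centred variables with second and fourth moments bounded by
`v`, exceeding the level `B` with probability at most `τ`. -/
structure IsNoiseFamily (μ : Measure Ω) (S : Finset ℕ) (ε : ℕ → Ω → ℝ) (B v τ : ℝ) : Prop where
  meas : ∀ t ∈ S, Measurable (ε t)
  indep : iIndepFun (fun t : S => ε (t : ℕ)) μ
  bound_nonneg : 0 ≤ B
  moment_nonneg : 0 ≤ v
  integrable : ∀ t ∈ S, Integrable (ε t) μ
  mean : ∀ t ∈ S, ∫ ω, ε t ω ∂μ = 0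
  integrable_sq : ∀ t ∈ S, Integrable (fun ω => ε t ω ^ 2) μ
  sq : ∀ t ∈ S, ∫ ω, ε t ω ^ 2 ∂μ ≤ v
  integrable_fourth : ∀ t ∈ S, Integrable (fun ω => ε t ω ^ 4) μ
  fourth : ∀ t ∈ S, ∫ ω, ε t ω ^ 4 ∂μ ≤ v
  tail : ∀ t ∈ S, μ.real {ω | ¬ |ε t ω| ≤ B} ≤ τ

namespace IsNoiseFamily

variable {S : Finset ℕ} {ε : ℕ → Ω → ℝ} {B v τ : ℝ}

theorem measurable_truncNoise (h : IsNoiseFamily μ S ε B v τ) (t : ℕ) :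
    Measurable (truncNoise S B ε t) := by
  unfold truncNoise
  by_cases ht : t ∈ S
  · simp only [ht, if_true]; exact (measurable_truncAt B).comp (h.meas t ht)
  · simp only [ht, if_false]; exact measurable_const

theorem abs_truncNoise_le (h : IsNoiseFamily μ S ε B v τ) (t : ℕ) (ω : Ω) :
    |truncNoise S B ε t ω| ≤ B := by
  unfold truncNoise; split_ifs
  · exact abs_truncAt_le h.bound_nonneg _
  · simpa using h.bound_nonneg

theorem iIndepFun_truncNoise (h : IsNoiseFamily μ S ε B v τ) :
    iIndepFun (truncNoise S B ε) μ := by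
  have := h.indep.isProbabilityMeasure
  exact iIndepFun_extend_zero (Y := fun t ω => truncAt B (ε t ω))
    (h.indep.comp (fun _ => truncAt B) fun _ => measurable_truncAt B)

theorem integrable_truncNoise_pow (h : IsNoiseFamily μ S ε B v τ) (t k : ℕ) :
    Integrable (fun ω => truncNoise S B ε t ω ^ k) μ := by
  have := h.indep.isProbabilityMeasure
  have := h.measurable_truncNoise t
  refine integrable_of_abs_le (C := B ^ k) (by fun_prop) fun ω => ?_
  rw [abs_pow]; gcongr; exact h.abs_truncNoise_le t ω

theorem integrable_truncNoise (h : IsNoiseFamily μ S ε B v τ) (t : ℕ) :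
    Integrable (truncNoise S B ε t) μ := by simpa using h.integrable_truncNoise_pow t 1

theorem integral_truncNoise_sq_le (h : IsNoiseFamily μ S ε B v τ) (t : ℕ) :
    ∫ ω, truncNoise S B ε t ω ^ 2 ∂μ ≤ v := by
  by_cases ht : t ∈ S
  · refine le_trans (integral_mono (h.integrable_truncNoise_pow t 2) (h.integrable_sq t ht)
      fun ω => ?_) (h.sq t ht)
    simp only [truncNoise, ht, if_true]
    rw [← sq_abs, ← sq_abs (ε t ω)]
    exact pow_le_pow_left₀ (abs_nonneg _) (abs_truncAt_le_abs _ _) _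
  · simp [truncNoise, ht, h.moment_nonneg]

theorem integral_truncNoise_fourth_le (h : IsNoiseFamily μ S ε B v τ) (t : ℕ) :
    ∫ ω, truncNoise S B ε t ω ^ 4 ∂μ ≤ v := by
  by_cases ht : t ∈ S
  · refine le_trans (integral_mono (h.integrable_truncNoise_pow t 4) (h.integrable_fourth t ht)
      fun ω => ?_) (h.fourth t ht)
    simp only [truncNoise, ht, if_true]
    have e : ∀ x : ℝ, x ^ 4 = |x| ^ 4 := fun x => by
      rw [← abs_pow, abs_of_nonneg (by positivity)]
    rw [e, e (ε t ω)]
    exact pow_le_pow_left₀ (abs_nonneg _) (abs_truncAt_le_abs _ _) _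
  · simp [truncNoise, ht, h.moment_nonneg]

/-- The remainder of a truncated moment, controlled by the next even moment and the tail. -/
theorem integral_sub_truncNoise_le (h : IsNoiseFamily μ S ε B v τ) {t : ℕ} (ht : t ∈ S) (k : ℕ)
    (hi : Integrable (fun ω => ε t ω ^ k) μ) (hi2 : Integrable (fun ω => ε t ω ^ (2 * k)) μ)
    (hv : ∫ ω, ε t ω ^ (2 * k) ∂μ ≤ v) (hk : k ≠ 0) {l : ℝ} (hl : 0 < l) :
    |∫ ω, ε t ω ^ k ∂μ - ∫ ω, truncNoise S B ε t ω ^ k ∂μ| ≤ l * v + τ / l := by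
  have := h.indep.isProbabilityMeasure
  have hA : MeasurableSet {ω | ¬ |ε t ω| ≤ B} := by
    have := h.meas t ht
    exact (measurableSet_le (f := fun ω => |ε t ω|) (by fun_prop) measurable_const).compl
  rw [← integral_sub hi (h.integrable_truncNoise_pow t k)]
  calc |∫ ω, (ε t ω ^ k - truncNoise S B ε t ω ^ k) ∂μ|
      ≤ ∫ ω, |ε t ω ^ k - truncNoise S B ε t ω ^ k| ∂μ := abs_integral_le_integral_abs
    _ ≤ ∫ ω, (l * ε t ω ^ (2 * k) +
          {ω | ¬ |ε t ω| ≤ B}.indicator (fun _ => 1 / l) ω) ∂μ := by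
        refine integral_mono (hi.sub (h.integrable_truncNoise_pow t k)).abs
          ((hi2.const_mul _).add ((integrable_const _).indicator hA)) fun ω => ?_
        simp only [truncNoise, ht, if_true, truncAt, Set.indicator_apply, Set.mem_ofPred_eq]
        have h0 : 0 ≤ l * ε t ω ^ (2 * k) := by rw [pow_mul']; positivity
        by_cases hω : |ε t ω| ≤ B
        · simp [hω, h0]
        · simp only [hω, if_false, not_false_eq_true, if_true, zero_pow hk, sub_zero]
          rw [pow_mul']
          rw [abs_le]
          generalize ε t ω ^ k = z
          -- Completing the square gives |z| ≤ l z² + 1/(4l) on the exceptional event. The free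
          -- parameter l is later set to 1/n, to balance moment against tail.
          have h1 : 0 ≤ l * (z - 1 / (2 * l)) ^ 2 := by positivity
          have h2 : 0 ≤ l * (z + 1 / (2 * l)) ^ 2 := by positivity
          have e1 : l * (z - 1 / (2 * l)) ^ 2 = l * z ^ 2 - z + 1 / (4 * l) := by field_simp; ring
          have e2 : l * (z + 1 / (2 * l)) ^ 2 = l * z ^ 2 + z + 1 / (4 * l) := by field_simp; ring
          have e3 : 1 / (4 * l) ≤ 1 / l := by gcongr; linarith
          constructor <;> linarith
    _ = l * ∫ ω, ε t ω ^ (2 * k) ∂μ + μ.real {ω | ¬ |ε t ω| ≤ B} * (1 / l) := by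
        rw [integral_add (hi2.const_mul _) ((integrable_const _).indicator hA),
          integral_const_mul, integral_indicator hA]
        simp
    _ ≤ l * v + τ * (1 / l) := by
        have := h.tail t ht
        gcongr
    _ = _ := by ring

theorem abs_integral_truncNoise_le (h : IsNoiseFamily μ S ε B v τ) {t : ℕ} (ht : t ∈ S) {l : ℝ}
    (hl : 0 < l) : |∫ ω, truncNoise S B ε t ω ∂μ| ≤ l * v + τ / l := by
  have := h.integral_sub_truncNoise_le ht 1 (by simpa using h.integrable t ht)
    (by simpa using h.integrable_sq t ht) (by simpa using h.sq t ht) one_ne_zero hl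
  simpa [h.mean t ht] using this

/-- The centred truncated variables. -/
theorem isCentredNoise (h : IsNoiseFamily μ S ε B v τ) :
    IsCentredNoise μ (fun t ω => truncNoise S B ε t ω - ∫ ω', truncNoise S B ε t ω' ∂μ)
      (2 * B) (16 * v) := by
  have := h.indep.isProbabilityMeasure
  have hi := fun t => h.integrable_truncNoise t
  have he : ∀ t, |∫ ω', truncNoise S B ε t ω' ∂μ| ≤ B := fun t => by
    have := norm_integral_le_of_norm_le_const (μ := μ) (f := truncNoise S B ε t) (C := B)
      (ae_of_all _ fun ω => h.abs_truncNoise_le t ω)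
    simpa using this
  have hv := h.moment_nonneg
  refine ⟨?_, fun t => (h.measurable_truncNoise t).sub_const _, fun t ω => ?_, fun t => ?_,
    fun t => ?_, fun t => ?_⟩
  · exact h.iIndepFun_truncNoise.comp (fun t x => x - ∫ ω', truncNoise S B ε t ω' ∂μ)
      fun t => by fun_prop
  · exact (abs_sub _ _).trans (by linarith [h.abs_truncNoise_le t ω, he t])
  · rw [integral_sub (hi t) (integrable_const _)]; simp
  · have h1 : Var[truncNoise S B ε t; μ] =
        ∫ ω, (truncNoise S B ε t ω - ∫ ω', truncNoise S B ε t ω' ∂μ) ^ 2 ∂μ :=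
      variance_eq_integral (h.measurable_truncNoise t).aemeasurable
    rw [← h1]
    have h2 := variance_le_expectation_sq (h.measurable_truncNoise t).aestronglyMeasurable
      (μ := μ)
    have h3 := h.integral_truncNoise_sq_le t
    simp only [Pi.pow_apply] at h2
    linarith
  · set e := ∫ ω', truncNoise S B ε t ω' ∂μ with hedef
    -- Jensen's inequality, obtained as nonnegativity of a variance and applied twice to reach the
    -- fourth power. With (x - e)⁴ ≤ 8x⁴ + 8e⁴ this gives the factor 16.
    have he2 : e ^ 2 ≤ ∫ ω, truncNoise S B ε t ω ^ 2 ∂μ := by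
      have h1 : 0 ≤ ∫ ω, (truncNoise S B ε t ω - e) ^ 2 ∂μ := integral_nonneg fun _ => sq_nonneg _
      have h2 : ∫ ω, (truncNoise S B ε t ω - e) ^ 2 ∂μ =
          (∫ ω, (1 + (-2 * e) * truncNoise S B ε t ω + 1 * truncNoise S B ε t ω ^ 2) ∂μ) +
            (e ^ 2 - 1) := by
        have i1 : Integrable (fun ω =>
            1 + (-2 * e) * truncNoise S B ε t ω + 1 * truncNoise S B ε t ω ^ 2) μ :=
          ((integrable_const _).add ((hi t).const_mul _)).add
            ((h.integrable_truncNoise_pow t 2).const_mul _)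
        rw [show e ^ 2 - 1 = ∫ _, (e ^ 2 - 1) ∂μ by simp, ← integral_add i1 (integrable_const _)]
        congr 1; ext ω; ring
      rw [integral_one_add_mul_add_mul (hi t) (h.integrable_truncNoise_pow t 2), ← hedef] at h2
      linarith
    have he4 : e ^ 4 ≤ ∫ ω, truncNoise S B ε t ω ^ 4 ∂μ := by
      set q := ∫ ω, truncNoise S B ε t ω ^ 2 ∂μ with hq
      have hq4 : q ^ 2 ≤ ∫ ω, truncNoise S B ε t ω ^ 4 ∂μ := by
        have h1 : 0 ≤ ∫ ω, (truncNoise S B ε t ω ^ 2 - q) ^ 2 ∂μ :=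
          integral_nonneg fun _ => sq_nonneg _
        have h2 : ∫ ω, (truncNoise S B ε t ω ^ 2 - q) ^ 2 ∂μ =
            (∫ ω, (1 + (-2 * q) * truncNoise S B ε t ω ^ 2 + 1 * truncNoise S B ε t ω ^ 4) ∂μ) +
              (q ^ 2 - 1) := by
          have i1 : Integrable (fun ω =>
              1 + (-2 * q) * truncNoise S B ε t ω ^ 2 + 1 * truncNoise S B ε t ω ^ 4) μ :=
            ((integrable_const _).add ((h.integrable_truncNoise_pow t 2).const_mul _)).add
              ((h.integrable_truncNoise_pow t 4).const_mul _)
          rw [show q ^ 2 - 1 = ∫ _, (q ^ 2 - 1) ∂μ by simp, ← integral_add i1 (integrable_const _)]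
          congr 1; ext ω; ring
        rw [integral_one_add_mul_add_mul (h.integrable_truncNoise_pow t 2)
          (h.integrable_truncNoise_pow t 4), ← hq] at h2
        linarith
      calc e ^ 4 = (e ^ 2) ^ 2 := by ring
        _ ≤ q ^ 2 := by gcongr
        _ ≤ _ := hq4
    have h4 := h.integral_truncNoise_fourth_le t
    calc ∫ ω, (truncNoise S B ε t ω - e) ^ 4 ∂μ
        ≤ ∫ ω, (8 * truncNoise S B ε t ω ^ 4 + 8 * e ^ 4) ∂μ := by
          refine integral_mono_of_nonneg (ae_of_all _ fun ω => by positivity)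
            (((h.integrable_truncNoise_pow t 4).const_mul _).add (integrable_const _))
            (ae_of_all _ fun ω => ?_)
          simp only
          generalize truncNoise S B ε t ω = x
          have e1 : (x - e) ^ 2 ≤ 2 * (x ^ 2 + e ^ 2) := by nlinarith [sq_nonneg (x + e)]
          calc (x - e) ^ 4 = ((x - e) ^ 2) ^ 2 := by ring
            _ ≤ (2 * (x ^ 2 + e ^ 2)) ^ 2 := by gcongr
            _ ≤ _ := by nlinarith [sq_nonneg (x ^ 2 - e ^ 2)]
      _ = 8 * ∫ ω, truncNoise S B ε t ω ^ 4 ∂μ + 8 * e ^ 4 := by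
          rw [integral_add ((h.integrable_truncNoise_pow t 4).const_mul _) (integrable_const _),
            integral_const_mul]
          simp
      _ ≤ _ := by linarith

end IsNoiseFamily

end

/-! ### Tail bounds for the elementary sums -/

section

variable {Ω : Type*} [mΩ : MeasurableSpace Ω] {μ : Measure Ω} {ζ : ℕ → Ω → ℝ} {B v : ℝ}

namespace IsCentredNoise

theorem integral_shift_sq_le (h : IsCentredNoise μ ζ B v) (t : ℕ) {e : ℝ} (he : |e| ≤ 1) :
    ∫ ω, (ζ t ω + e) ^ 2 ∂μ ≤ v + 1 := by
  have := h.isProbabilityMeasure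
  have h1 : ∫ ω, (ζ t ω + e) ^ 2 ∂μ =
      (∫ ω, (1 + (2 * e) * ζ t ω + 1 * ζ t ω ^ 2) ∂μ) + (e ^ 2 - 1) := by
    have i1 : Integrable (fun ω => 1 + (2 * e) * ζ t ω + 1 * ζ t ω ^ 2) μ :=
      ((integrable_const _).add ((h.integrable t).const_mul _)).add
        ((h.integrable_pow t 2).const_mul _)
    rw [show e ^ 2 - 1 = ∫ _, (e ^ 2 - 1) ∂μ by simp, ← integral_add i1 (integrable_const _)]
    congr 1; ext ω; ring
  rw [h1, integral_one_add_mul_add_mul (h.integrable t) (h.integrable_pow t 2), h.mean]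
  have h2 : e ^ 2 ≤ 1 := by rw [← sq_abs]; nlinarith [abs_nonneg e]
  linarith [h.sq t]

theorem integral_shift_fourth_le (h : IsCentredNoise μ ζ B v) (t : ℕ) {e : ℝ} (he : |e| ≤ 1) :
    ∫ ω, (ζ t ω + e) ^ 4 ∂μ ≤ 8 * (v + 1) := by
  have := h.isProbabilityMeasure
  have h2 : e ^ 2 ≤ 1 := by rw [← sq_abs]; nlinarith [abs_nonneg e]
  calc ∫ ω, (ζ t ω + e) ^ 4 ∂μ ≤ ∫ ω, (8 * ζ t ω ^ 4 + 8) ∂μ := by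
        refine integral_mono_of_nonneg (ae_of_all _ fun ω => by positivity)
          (((h.integrable_pow t 4).const_mul _).add (integrable_const _)) (ae_of_all _ fun ω => ?_)
        simp only
        generalize ζ t ω = x
        have e1 : (x + e) ^ 2 ≤ 2 * (x ^ 2 + 1) := by nlinarith [sq_nonneg (x - e)]
        calc (x + e) ^ 4 = ((x + e) ^ 2) ^ 2 := by ring
          _ ≤ (2 * (x ^ 2 + 1)) ^ 2 := by gcongr
          _ ≤ _ := by nlinarith [sq_nonneg (x ^ 2 - 1)]
    _ = 8 * ∫ ω, ζ t ω ^ 4 ∂μ + 8 := by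
        rw [integral_add ((h.integrable_pow t 4).const_mul _) (integrable_const _),
          integral_const_mul]
        simp
    _ ≤ _ := by linarith [h.fourth t]

theorem integrable_shift_pow (h : IsCentredNoise μ ζ B v) (t k : ℕ) (e : ℝ) :
    Integrable (fun ω => (ζ t ω + e) ^ k) μ := by
  have := h.isProbabilityMeasure
  have := h.meas t
  refine integrable_of_abs_le (C := (B + |e|) ^ k) (by fun_prop) fun ω => ?_
  rw [abs_pow]
  exact pow_le_pow_left₀ (abs_nonneg _)
    ((abs_add_le _ _).trans (add_le_add (h.bdd t ω) le_rfl)) _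

/-- Tails of weighted sums of centred noise. -/
theorem measureReal_weighted_sum_ge_le (h : IsCentredNoise μ ζ B v) (S : Finset ℕ) {w : ℕ → ℝ}
    {R V x : ℝ} (hB : 0 < B) (hv : 0 < v) (hR : 0 < R) (hV : 0 < V) (hx : 0 ≤ x)
    (hw : ∀ t ∈ S, |w t| ≤ R) (hw2 : ∑ t ∈ S, w t ^ 2 ≤ V) :
    μ.real {ω | x ≤ ∑ t ∈ S, w t * ζ t ω} ≤
      Real.exp (-min (x ^ 2 / (4 * (v * V))) (x / (2 * (R * B)))) := by
  have := h.isProbabilityMeasure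
  refine bernstein_sum (f := fun t ω => w t * ζ t ω) (v := fun t => v * w t ^ 2)
    (h.indep.comp (fun t x => w t * x) fun t => by fun_prop)
    (fun t => (h.meas t).const_mul _) S (by positivity) ?_ ?_ ?_ (by positivity) ?_ hx
  · intro t ht ω
    rw [abs_mul]
    exact mul_le_mul (hw t ht) (h.bdd t ω) (abs_nonneg _) hR.le
  · intro t _
    rw [integral_const_mul, h.mean, mul_zero]
  · intro t _
    simp_rw [mul_pow]
    rw [integral_const_mul, mul_comm]
    have := h.sq t
    gcongr
  · rw [← Finset.mul_sum]
    gcongr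

/-- Tails of weighted sums of centred squares. -/
theorem measureReal_weighted_sq_sum_ge_le (h : IsCentredNoise μ ζ B v) (S : Finset ℕ)
    {w e : ℕ → ℝ} {A R V x : ℝ} (hA : 0 < A) (hR : 0 < R) (hV : 0 < V) (hx : 0 ≤ x)
    (he : ∀ t ∈ S, |e t| ≤ 1) (hξ : ∀ t ∈ S, ∀ ω, |ζ t ω + e t| ≤ A)
    (hw : ∀ t ∈ S, |w t| ≤ R) (hw2 : ∑ t ∈ S, w t ^ 2 ≤ V) :
    μ.real {ω | x ≤ ∑ t ∈ S, w t * ((ζ t ω + e t) ^ 2 - ∫ ω', (ζ t ω' + e t) ^ 2 ∂μ)} ≤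
      Real.exp (-min (x ^ 2 / (4 * (8 * (v + 1) * V))) (x / (2 * (R * A ^ 2)))) := by
  have := h.isProbabilityMeasure
  have hv := h.nonneg
  have hm := h.meas
  refine bernstein_sum (f := fun t ω => w t * ((ζ t ω + e t) ^ 2 - ∫ ω', (ζ t ω' + e t) ^ 2 ∂μ))
    (v := fun t => 8 * (v + 1) * w t ^ 2)
    (h.indep.comp (fun t x => w t * ((x + e t) ^ 2 - ∫ ω', (ζ t ω' + e t) ^ 2 ∂μ))
      fun t => by fun_prop)
    (fun t => by have := hm t; fun_prop) S (by positivity) ?_ ?_ ?_ (by positivity) ?_ hx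
  · intro t ht ω
    rw [abs_mul]
    refine mul_le_mul (hw t ht) ?_ (abs_nonneg _) hR.le
    have h1 : ∀ ω, (ζ t ω + e t) ^ 2 ≤ A ^ 2 := fun ω => by
      rw [← sq_abs]; exact pow_le_pow_left₀ (abs_nonneg _) (hξ t ht ω) _
    have h2 : ∫ ω', (ζ t ω' + e t) ^ 2 ∂μ ≤ A ^ 2 := by
      refine (integral_mono (h.integrable_shift_pow t 2 _) (integrable_const _) h1).trans ?_
      simp
    have h3 : 0 ≤ ∫ ω', (ζ t ω' + e t) ^ 2 ∂μ := integral_nonneg fun _ => sq_nonneg _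
    rw [abs_le]
    constructor <;> nlinarith [h1 ω, sq_nonneg (ζ t ω + e t)]
  · intro t _
    rw [integral_const_mul, integral_sub (h.integrable_shift_pow t 2 _) (integrable_const _)]
    simp
  · intro t ht
    simp_rw [mul_pow]
    rw [integral_const_mul, mul_comm]
    refine mul_le_mul_of_nonneg_right ?_ (sq_nonneg _)
    have h1 : Var[fun ω => (ζ t ω + e t) ^ 2; μ] =
        ∫ ω, ((ζ t ω + e t) ^ 2 - ∫ ω', (ζ t ω' + e t) ^ 2 ∂μ) ^ 2 ∂μ :=
      variance_eq_integral (by have := hm t; fun_prop)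
    rw [← h1]
    have h2 := variance_le_expectation_sq (μ := μ) (X := fun ω => (ζ t ω + e t) ^ 2)
      (by have := hm t; exact Measurable.aestronglyMeasurable (by fun_prop))
    refine h2.trans (le_trans (le_of_eq ?_) (h.integral_shift_fourth_le t (he t ht)))
    congr 1; ext ω; simp only [Pi.pow_apply]; ring
  · rw [← Finset.mul_sum]
    gcongr

/-- The window average of the noise. -/
theorem integral_windowMean_sq_le (h : IsCentredNoise μ ζ B v) (n M t : ℕ) :
    ∫ ω, windowMean n M (fun p => ζ p ω) t ^ 2 ∂μ ≤ v / (2 * M + 1 : ℕ) := by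
  have hm : (0 : ℝ) < (2 * M + 1 : ℕ) := by positivity
  have h1 := h.integral_sum_sq_le (window n M t)
  have hc : ((window n M t).card : ℝ) ≤ (2 * M + 1 : ℕ) := by exact_mod_cast card_window_le n M t
  have hv := h.nonneg
  simp only [windowMean, div_pow]
  rw [integral_div, div_le_div_iff₀ (by positivity) hm]
  calc _ ≤ ((window n M t).card * v) * (2 * M + 1 : ℕ) := by gcongr
    _ ≤ ((2 * M + 1 : ℕ) * v) * (2 * M + 1 : ℕ) := by gcongr
    _ = _ := by ring

theorem measurable_windowMean (h : IsCentredNoise μ ζ B v) (n M t : ℕ) :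
    Measurable fun ω => windowMean n M (fun p => ζ p ω) t :=
  (h.measurable_sum _).div_const _

theorem abs_windowMean_le (h : IsCentredNoise μ ζ B v) (n M t : ℕ) (ω : Ω) :
    |windowMean n M (fun p => ζ p ω) t| ≤ B :=
  _root_.abs_windowMean_le h.bound_nonneg fun p _ => h.bdd p ω

end IsCentredNoise

theorem windowMean_mul_sqrt (n M t : ℕ) (x : ℕ → ℝ) :
    √(2 * M + 1 : ℕ) * windowMean n M x t = (∑ p ∈ window n M t, x p) / √(2 * M + 1 : ℕ) := by
  have hm : (0 : ℝ) < (2 * M + 1 : ℕ) := by positivity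
  have hs : 0 < √((2 * M + 1 : ℕ) : ℝ) := Real.sqrt_pos.mpr hm
  have e : ((2 * M + 1 : ℕ) : ℝ) = √((2 * M + 1 : ℕ) : ℝ) * √((2 * M + 1 : ℕ) : ℝ) :=
    (Real.mul_self_sqrt hm.le).symm
  rw [windowMean]
  generalize √((2 * M + 1 : ℕ) : ℝ) = z at *
  rw [e]
  field_simp

theorem isBlockMeasurable_windowMean {Ω : Type*} (ζ : ℕ → Ω → ℝ) (n M t : ℕ) :
    IsBlockMeasurable ζ (window n M t) fun ω => windowMean n M (fun p => ζ p ω) t :=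
  fun _ hm => (Finset.measurable_fun_sum _ hm).div_const _

theorem mem_window_self {n M t : ℕ} (ht : t ∈ Finset.Icc 1 n) : t ∈ window n M t := by
  simp only [window, Finset.mem_filter]
  exact ⟨ht, by omega, by omega⟩

theorem isBlockMeasurable_mul_shift {Ω : Type*} (ζ : ℕ → Ω → ℝ) {n M t : ℕ}
    (ht : t ∈ Finset.Icc 1 n) (e c : ℝ) :
    IsBlockMeasurable ζ (window n M t) fun ω => c * (|windowMean n M (fun p => ζ p ω) t| *
      (1 + (ζ t ω + e) ^ 2 + 2 * |windowMean n M (fun p => ζ p ω) t|)) := fun m hm => by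
  have h1 := isBlockMeasurable_windowMean ζ n M t m hm
  have h2 := hm t (mem_window_self ht)
  fun_prop

theorem isBlockMeasurable_kernel {Ω : Type*} (ζ : ℕ → Ω → ℝ) {K : ℝ → ℝ} (hK : Measurable K)
    (n M t : ℕ) (a b c d : ℝ) :
    IsBlockMeasurable ζ (window n M t) fun ω =>
      c * (d - K ((a + windowMean n M (fun p => ζ p ω) t) / b)) := fun m hm => by
  have h1 := isBlockMeasurable_windowMean ζ n M t m hm
  fun_prop

namespace IsCentredNoise

/-- The effect of the noise of the pre-fit: an upper tail. -/
theorem measureReal_sum_abs_windowMean_ge_le (h : IsCentredNoise μ ζ B v) {n M : ℕ}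
    (hn : 2 * M + 1 ≤ n) {s : ℝ} (hs : 1 ≤ s) (hsB : B ≤ s * √(2 * M + 1 : ℕ)) {e : ℕ → ℝ}
    {A T : ℝ} (he : ∀ t ∈ Finset.Icc 1 n, |e t| ≤ 1)
    (hξ : ∀ t ∈ Finset.Icc 1 n, ∀ ω, |ζ t ω + e t| ≤ A)
    (hT : 40 * (v + 1) * n / √(2 * M + 1 : ℕ) ≤ T) :
    μ.real {ω | T ≤ ∑ t ∈ Finset.Icc 1 n, |windowMean n M (fun p => ζ p ω) t| *
        (1 + (ζ t ω + e t) ^ 2 + 2 * |windowMean n M (fun p => ζ p ω) t|)} ≤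
      (2 * M + 1 : ℕ) * Real.exp
        (-min ((T / (2 * (1 + A ^ 2 + 2 * B) * √n)) ^ 2 /
            (512 * Real.exp (v + 2 * Real.exp v) * s ^ 2))
          ((T / (2 * (1 + A ^ 2 + 2 * B) * √n)) * √((n : ℝ) / (2 * M + 1 : ℕ)) / (8 * s))) := by
  have := h.isProbabilityMeasure
  have hv := h.nonneg
  have hB := h.bound_nonneg
  have hm0 : (0 : ℝ) < (2 * M + 1 : ℕ) := by positivity
  have hm1 : (1 : ℝ) ≤ (2 * M + 1 : ℕ) := by exact_mod_cast (by omega : 1 ≤ 2 * M + 1)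
  have hn0 : (0 : ℝ) < n := by exact_mod_cast (by omega : 0 < n)
  set q := √((2 * M + 1 : ℕ) : ℝ) with hq
  have hq0 : 0 < q := Real.sqrt_pos.mpr hm0
  have hq1 : 1 ≤ q := Real.one_le_sqrt.mpr hm1
  have hqq : q ^ 2 = (2 * M + 1 : ℕ) := Real.sq_sqrt hm0.le
  have hsn : 0 < √(n : ℝ) := Real.sqrt_pos.mpr hn0
  set R := 1 + A ^ 2 + 2 * B with hR
  have hR0 : 0 < R := by positivity
  set ν : ℕ → Ω → ℝ := fun t ω => windowMean n M (fun p => ζ p ω) t with hν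
  set Z : ℕ → Ω → ℝ := fun t ω => |ν t ω| * (1 + (ζ t ω + e t) ^ 2 + 2 * |ν t ω|) with hZ
  have hT0 : 0 ≤ T := le_trans (by positivity) hT
  have hEZ : ∀ t ∈ Finset.Icc 1 n, ∫ ω, Z t ω ∂μ ≤ 20 * (v + 1) / q := by
    intro t ht
    have hνi : Integrable (fun ω => ν t ω ^ 2) μ := by
      have := h.measurable_windowMean n M t
      refine integrable_of_abs_le (C := B ^ 2) (by fun_prop) fun ω => ?_
      rw [abs_pow]; exact pow_le_pow_left₀ (abs_nonneg _) (h.abs_windowMean_le n M t ω) _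
    -- Young's inequality with weight q = √(2M+1): a(1 + c) ≤ qa²/2 + (1 + c)²/(2q), where a = |ν_t|
    -- and c is the squared noise. As E ν_t² ≤ v/q², both parts have order 1/q.
    have h1 : ∫ ω, Z t ω ∂μ ≤ ∫ ω, (((q / 2 + 2) * ν t ω ^ 2 + 1 / q) +
        1 / q * (ζ t ω + e t) ^ 4) ∂μ := by
      refine integral_mono_of_nonneg (ae_of_all _ fun ω => by positivity)
        (((hνi.const_mul _).add (integrable_const _)).add
          ((h.integrable_shift_pow t 4 _).const_mul _)) (ae_of_all _ fun ω => ?_)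
      simp only [hZ]
      rw [← sq_abs (ν t ω)]
      generalize |ν t ω| = a
      rw [show (ζ t ω + e t) ^ 4 = ((ζ t ω + e t) ^ 2) ^ 2 by ring]
      have hc : 0 ≤ (ζ t ω + e t) ^ 2 := sq_nonneg _
      generalize (ζ t ω + e t) ^ 2 = c at *
      have h2 : 0 ≤ (q * a - (1 + c)) ^ 2 / (2 * q) := by positivity
      have h3 : (q * a - (1 + c)) ^ 2 / (2 * q) =
          q / 2 * a ^ 2 - a * (1 + c) + (1 + c) ^ 2 / (2 * q) := by field_simp; ring
      have h4 : (1 + c) ^ 2 / (2 * q) ≤ 1 / q + 1 / q * c ^ 2 := by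
        rw [show 1 / q + 1 / q * c ^ 2 = (2 * (1 + c ^ 2)) / (2 * q) by field_simp]
        gcongr
        nlinarith [sq_nonneg (1 - c)]
      nlinarith
    have i1 : Integrable (fun ω => (q / 2 + 2) * ν t ω ^ 2 + 1 / q) μ :=
      (hνi.const_mul _).add (integrable_const _)
    rw [integral_add i1 ((h.integrable_shift_pow t 4 _).const_mul _),
      integral_add (hνi.const_mul _) (integrable_const _), integral_const_mul,
      integral_const_mul] at h1
    have h2 := h.integral_windowMean_sq_le n M t
    have h3 := h.integral_shift_fourth_le t (he t ht)
    rw [← hqq] at h2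
    have h4 : (q / 2 + 2) * ∫ ω, ν t ω ^ 2 ∂μ ≤ 5 / 2 * v / q := by
      calc (q / 2 + 2) * ∫ ω, ν t ω ^ 2 ∂μ ≤ (q / 2 + 2) * (v / q ^ 2) := by gcongr
        _ ≤ (q / 2 + 2 * q) * (v / q ^ 2) := by gcongr; linarith
        _ = 5 / 2 * v / q := by field_simp; ring
    have h5 : 1 / q * ∫ ω, (ζ t ω + e t) ^ 4 ∂μ ≤ 1 / q * (8 * (v + 1)) := by gcongr
    simp only [integral_const, probReal_univ, smul_eq_mul, one_mul] at h1
    calc _ ≤ _ := h1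
      _ ≤ 5 / 2 * v / q + 1 / q + 1 / q * (8 * (v + 1)) := by linarith
      _ = (5 / 2 * v + 1 + 8 * (v + 1)) / q := by field_simp
      _ ≤ _ := by gcongr; linarith
  -- The bounds on the noise make the second factor of Z at most R. Scaled by q/R, the summand is
  -- dominated by the normalized window sum, as the blocking bound requires.
  have hWY : ∀ t ∈ Finset.Icc 1 n, ∀ ω, |q / R * Z t ω| ≤
      |(∑ p ∈ window n M t, ζ p ω) / √(2 * M + 1 : ℕ)| := by
    intro t ht ω
    rw [← windowMean_mul_sqrt, ← hq, abs_mul q, abs_mul, abs_of_pos hq0,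
      abs_of_pos (div_pos hq0 hR0)]
    have h1 : |Z t ω| ≤ |ν t ω| * R := by
      simp only [hZ]
      rw [abs_mul, abs_abs]
      gcongr
      rw [abs_of_nonneg (by positivity), hR]
      have h2 : (ζ t ω + e t) ^ 2 ≤ A ^ 2 := by
        rw [← sq_abs]; exact pow_le_pow_left₀ (abs_nonneg _) (hξ t ht ω) _
      linarith [h.abs_windowMean_le n M t ω]
    calc q / R * |Z t ω| ≤ q / R * (|ν t ω| * R) := by gcongr
      _ = q * |ν t ω| := by field_simp
  refine le_trans (measureReal_mono ?_ (measure_ne_top _ _))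
    (h.measureReal_window_sum_ge_le hn hs hsB (W := fun t ω => q / R * Z t ω)
      (fun t ht => isBlockMeasurable_mul_shift ζ ht (e t) (q / R)) hWY
      (y := T / (2 * R * √n)) (by positivity))
  intro ω hω
  simp only [Set.mem_ofPred_eq] at hω ⊢
  have h1 : ∑ t ∈ Finset.Icc 1 n, (q / R * Z t ω - ∫ ω', q / R * Z t ω' ∂μ) =
      q / R * (∑ t ∈ Finset.Icc 1 n, Z t ω - ∑ t ∈ Finset.Icc 1 n, ∫ ω', Z t ω' ∂μ) := by
    rw [← Finset.sum_sub_distrib, Finset.mul_sum]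
    refine Finset.sum_congr rfl fun t _ => ?_
    rw [integral_const_mul, mul_sub]
  have h2 : ∑ t ∈ Finset.Icc 1 n, ∫ ω', Z t ω' ∂μ ≤ T / 2 := by
    calc _ ≤ ∑ t ∈ Finset.Icc 1 n, 20 * (v + 1) / q := Finset.sum_le_sum hEZ
      _ = 40 * (v + 1) * n / q / 2 := by
          rw [Finset.sum_const, Nat.card_Icc]; simp; ring
      _ ≤ T / 2 := by gcongr
  rw [h1, Real.sqrt_mul hn0.le, ← hq]
  calc T / (2 * R * √n) * (√n * q) = q / R * (T / 2) := by field_simp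
    _ ≤ _ := by
        gcongr
        have : T ≤ ∑ t ∈ Finset.Icc 1 n, Z t ω := hω
        linarith

/-- The kernel sums at the moving averages are bounded away from zero: a lower tail. -/
theorem measureReal_sum_kernel_le (h : IsCentredNoise μ ζ B v) {n M : ℕ}
    (hn : 2 * M + 1 ≤ n) {s : ℝ} (hs : 1 ≤ s) (hsB : B ≤ s * √(2 * M + 1 : ℕ)) {K : ℝ → ℝ}
    {L b u c s₀ p₀ : ℝ} {g : ℕ → ℝ} (hK0 : ∀ z, 0 ≤ K z) (hKm : Measurable K)
    (hKL : ∀ z w, |K z - K w| ≤ L * |z - w|) (hL : 0 < L) (hb : 0 < b) (hc : 0 < c)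
    (hp₀ : 0 < p₀) (hg : n * b * c ≤ ∑ t ∈ Finset.Icc 1 n, K ((g t - u) / b))
    (hball : ∀ t, p₀ ≤ μ.real {ω | |(∑ p ∈ window n M t, ζ p ω) / √(2 * M + 1 : ℕ)| ≤ s₀})
    (hs₀ : s₀ ≤ b ^ 2 * c / (4 * L) * √(2 * M + 1 : ℕ)) :
    μ.real {ω | ∑ t ∈ Finset.Icc 1 n, K ((g t + windowMean n M (fun p => ζ p ω) t - u) / b) ≤
        p₀ * (n * b * c) / 8} ≤
      (2 * M + 1 : ℕ) * Real.exp
        (-min ((p₀ * c * √n * b ^ 2 / (8 * L)) ^ 2 /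
            (512 * Real.exp (v + 2 * Real.exp v) * s ^ 2))
          ((p₀ * c * √n * b ^ 2 / (8 * L)) * √((n : ℝ) / (2 * M + 1 : ℕ)) / (8 * s))) := by
  have := h.isProbabilityMeasure
  have hm0 : (0 : ℝ) < (2 * M + 1 : ℕ) := by positivity
  have hn0 : (0 : ℝ) < n := by exact_mod_cast (by omega : 0 < n)
  set q := √((2 * M + 1 : ℕ) : ℝ) with hq
  have hq0 : 0 < q := Real.sqrt_pos.mpr hm0
  set ν : ℕ → Ω → ℝ := fun t ω => windowMean n M (fun p => ζ p ω) t with hν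
  have hνm : ∀ t, Measurable (ν t) := fun t => h.measurable_windowMean n M t
  set Z : ℕ → Ω → ℝ := fun t ω => K ((g t + ν t ω - u) / b) with hZ
  set k : ℕ → ℝ := fun t => K ((g t - u) / b) with hk
  have hZk : ∀ t ω, |k t - Z t ω| ≤ L / b * |ν t ω| := fun t ω => by
    refine (hKL _ _).trans (le_of_eq ?_)
    rw [← sub_div, abs_div, abs_of_pos hb, show g t - u - (g t + ν t ω - u) = -ν t ω by ring,
      abs_neg]
    ring
  have hZm : ∀ t, Measurable (Z t) := fun t => by have := hνm t; fun_prop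
  have hZi : ∀ t, Integrable (Z t) μ := fun t => by
    refine integrable_of_abs_le (C := |k t| + L / b * B) (hZm t) fun ω => ?_
    have h1 := h.abs_windowMean_le n M t ω
    have h2 : L / b * |ν t ω| ≤ L / b * B := by gcongr
    have h3 := abs_sub (k t) (k t - Z t ω)
    rw [sub_sub_cancel] at h3
    linarith [hZk t ω]
  -- On the small-ball event |ν_t| ≤ b²c/(4L), so the kernel value moves by at most bc/4 ≤ k t / 2
  -- and keeps half its size. Elsewhere only K ≥ 0 is used.
  have hEZ : ∀ t, b * c / 2 ≤ k t → p₀ * k t / 2 ≤ ∫ ω, Z t ω ∂μ := by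
    intro t ht
    have hk0 : 0 ≤ k t := hK0 _
    set E := {ω | |(∑ p ∈ window n M t, ζ p ω) / q| ≤ s₀} with hE
    have hEm : MeasurableSet E :=
      measurableSet_le (f := fun ω => |(∑ p ∈ window n M t, ζ p ω) / q|)
        (by have := (h.measurable_sum (window n M t)).div_const q; fun_prop) measurable_const
    calc p₀ * k t / 2 ≤ μ.real E * (k t / 2) := by
          rw [mul_div_assoc]
          have := hball t
          gcongr
      _ = ∫ ω, E.indicator (fun _ => k t / 2) ω ∂μ := by
          rw [integral_indicator hEm]; simp
      _ ≤ ∫ ω, Z t ω ∂μ := by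
          refine integral_mono ((integrable_const _).indicator hEm) (hZi t) fun ω => ?_
          simp only [Set.indicator_apply]
          split_ifs with hω
          · rw [hE, Set.mem_ofPred_eq, hq, ← windowMean_mul_sqrt, ← hq, abs_mul,
              abs_of_pos hq0] at hω
            have h1 : |ν t ω| ≤ b ^ 2 * c / (4 * L) := by
              have := hω.trans hs₀
              rw [mul_comm] at this
              exact le_of_mul_le_mul_right this hq0
            have h2 : L / b * |ν t ω| ≤ b * c / 4 := by
              calc L / b * |ν t ω| ≤ L / b * (b ^ 2 * c / (4 * L)) := by gcongr
                _ = b * c / 4 := by field_simp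
            have h3 := le_of_abs_le (hZk t ω)
            linarith
          · exact hK0 _
  have hsum : p₀ * (n * b * c) / 4 ≤ ∑ t ∈ Finset.Icc 1 n, ∫ ω, Z t ω ∂μ := by
    -- Subtracting the cutoff bc/2 covers the points with small kernel value in the same linear
    -- inequality. Summed up it costs half of nbc.
    have key : ∀ t ∈ Finset.Icc 1 n, p₀ / 2 * k t - p₀ / 2 * (b * c / 2) ≤ ∫ ω, Z t ω ∂μ := by
      intro t _
      by_cases ht : b * c / 2 ≤ k t
      · have := hEZ t ht
        have h2 : 0 < p₀ / 2 * (b * c / 2) := by positivity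
        linarith
      · have h2 : 0 ≤ ∫ ω, Z t ω ∂μ := integral_nonneg fun ω => hK0 _
        have h3 : p₀ / 2 * k t ≤ p₀ / 2 * (b * c / 2) := by
          have := (not_le.mp ht).le
          gcongr
        linarith
    refine le_trans ?_ (Finset.sum_le_sum key)
    rw [Finset.sum_sub_distrib, ← Finset.mul_sum, Finset.sum_const, Nat.card_Icc, nsmul_eq_mul]
    simp only [add_tsub_cancel_right]
    have := mul_le_mul_of_nonneg_left hg (by positivity : 0 ≤ p₀ / 2)
    linarith
  -- The expected sum is at least p₀nbc/4 and the threshold is half of that. The gap p₀nbc/8, scaled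
  -- by qb/L, equals y √n q, which fixes y.
  refine le_trans (measureReal_mono ?_ (measure_ne_top _ _))
    (h.measureReal_window_sum_ge_le hn hs hsB (W := fun t ω => q * b / L * (k t - Z t ω))
      (fun t _ => ?_) ?_ (y := p₀ * c * √n * b ^ 2 / (8 * L)) (by positivity))
  · intro ω hω
    simp only [Set.mem_ofPred_eq] at hω ⊢
    have h1 : ∑ t ∈ Finset.Icc 1 n,
        (q * b / L * (k t - Z t ω) - ∫ ω', q * b / L * (k t - Z t ω') ∂μ) =
        q * b / L * (∑ t ∈ Finset.Icc 1 n, ∫ ω', Z t ω' ∂μ - ∑ t ∈ Finset.Icc 1 n, Z t ω) := by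
      rw [← Finset.sum_sub_distrib, Finset.mul_sum]
      refine Finset.sum_congr rfl fun t _ => ?_
      rw [integral_const_mul, integral_sub (integrable_const _) (hZi t)]
      simp
      ring
    rw [h1, Real.sqrt_mul hn0.le, ← hq]
    have h2 : ∑ t ∈ Finset.Icc 1 n, Z t ω ≤ p₀ * (n * b * c) / 8 := hω
    have hnn : √(n : ℝ) * √n = n := Real.mul_self_sqrt hn0.le
    calc p₀ * c * √n * b ^ 2 / (8 * L) * (√n * q) = q * b / L * (p₀ * ((√n * √n) * b * c) / 8) := by
          field_simp
      _ ≤ _ := by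
          rw [hnn]
          gcongr
          linarith
  · have := isBlockMeasurable_kernel ζ hKm n M t (g t - u) b (q * b / L) (k t)
    simp only [hZ, hν]
    convert this using 7
    ring
  · intro t _ ω
    rw [← windowMean_mul_sqrt, ← hq, abs_mul, abs_mul, abs_of_pos hq0,
      abs_of_pos (by positivity : 0 < q * b / L)]
    change _ ≤ q * |ν t ω|
    calc q * b / L * |k t - Z t ω| ≤ q * b / L * (L / b * |ν t ω|) := by
          gcongr; exact hZk t ω
      _ = _ := by field_simp

end IsCentredNoise

end

/-! ### Deterministic decomposition of the deviation -/

/-- Deterministic bound for one summand of the perturbation of the numerator of the variance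
estimator. -/
theorem abs_perturbation_summand_le {c Kb L hb H U a x g ω ω₀ v v₀ b : ℝ} (hc : 0 ≤ c)
    (hKb : 0 ≤ Kb) (hL : 0 ≤ L) (hhb : 0 ≤ hb) (hH : 0 ≤ H) (hU : 0 ≤ U) (hω : 0 ≤ ω)
    (hωK : ω ≤ Kb * c) (hωω : |ω - ω₀| ≤ L * c * (|a - g| + U)) (hv : |v| ≤ hb)
    (hωv : ω * |v - v₀| ≤ H * b / 2 * ω + Kb * H * c * (|a - g| + U)) :
    |ω * ((x - a) ^ 2 - (x - g) ^ 2) + (ω - ω₀) * ((x - g) ^ 2 - v) + ω * (v - v₀)| ≤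
      H * b / 2 * ω + (Kb + L * (1 + hb) + Kb * H) * c *
        (|a - g| * (1 + (x - g) ^ 2) + (a - g) ^ 2 + U * (1 + (x - g) ^ 2)) := by
  obtain ⟨y, rfl⟩ : ∃ y, x = g + y := ⟨x - g, by ring⟩
  obtain ⟨Δ, rfl⟩ : ∃ Δ, a = g + Δ := ⟨a - g, by ring⟩
  simp only [add_sub_cancel_left] at *
  have hΔ0 := abs_nonneg Δ
  have hy := sq_nonneg y
  have ha : |ω * ((g + y - (g + Δ)) ^ 2 - y ^ 2)| ≤ Kb * c * (|Δ| * (1 + y ^ 2) + Δ ^ 2) := by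
    rw [abs_mul, abs_of_nonneg hω]
    refine mul_le_mul hωK ?_ (abs_nonneg _) (by positivity)
    have e : (g + y - (g + Δ)) ^ 2 - y ^ 2 = -(2 * (Δ * y)) + Δ ^ 2 := by ring
    rw [e]
    refine (abs_add_le _ _).trans ?_
    rw [abs_neg, abs_mul, abs_mul, abs_two, abs_of_nonneg (sq_nonneg Δ)]
    have : 2 * |y| ≤ 1 + y ^ 2 := by rw [← sq_abs]; nlinarith [sq_nonneg (|y| - 1)]
    have h2 := mul_le_mul_of_nonneg_left this hΔ0
    linarith
  have hb' : |(ω - ω₀) * (y ^ 2 - v)| ≤ L * c * (|Δ| + U) * ((1 + hb) * (1 + y ^ 2)) := by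
    rw [abs_mul]
    have h2 : |y ^ 2 - v| ≤ (1 + hb) * (1 + y ^ 2) := by
      refine (abs_sub _ _).trans ?_
      rw [abs_of_nonneg hy]
      have := mul_nonneg hhb hy
      linarith
    exact mul_le_mul hωω h2 (abs_nonneg _) (by positivity)
  have hc' : |ω * (v - v₀)| ≤ H * b / 2 * ω + Kb * H * c * ((|Δ| + U) * (1 + y ^ 2)) := by
    rw [abs_mul, abs_of_nonneg hω]
    refine hωv.trans ?_
    gcongr
    exact le_mul_of_one_le_right (by positivity) (by linarith)
  have he := abs_add_three (ω * ((g + y - (g + Δ)) ^ 2 - y ^ 2)) ((ω - ω₀) * (y ^ 2 - v))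
    (ω * (v - v₀))
  have p4 : 0 ≤ U * (1 + y ^ 2) := by positivity
  have p1 := mul_nonneg (by positivity : 0 ≤ Kb * c) p4
  have p2 := mul_nonneg (by positivity : 0 ≤ L * (1 + hb) * c) (sq_nonneg Δ)
  have p3 := mul_nonneg (by positivity : 0 ≤ Kb * H * c) (sq_nonneg Δ)
  linarith

/-- A deterministic bound for the deviation of the variance estimator: once the sum of the
empirical kernel weights is at least `θ`, a deviation of size `δ` forces either the noise part or
one of the perturbation terms to be large. -/
theorem le_noise_add_perturbation {K h : ℝ → ℝ} {J M : ℕ} {b Kb L H hb u w θ δ : ℝ} {x g : ℕ → ℝ}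
    (hK0 : ∀ z, 0 ≤ K z) (hKs : ∀ z, z ∉ Set.Icc (-(1 / 2) : ℝ) (1 / 2) → K z = 0)
    (hKb : ∀ z, K z ≤ Kb) (hKL : ∀ z w, |K z - K w| ≤ L * |z - w|) (hL : 0 ≤ L)
    (hb0 : 0 < b) (hb1 : b ≤ 1) (hH : 0 ≤ H)
    (hD : θ ≤ ∑ t ∈ Finset.Icc 1 (nObs J), kernelWeight K J b (movingAverage J M x t) w)
    (hbδ : b * H ≤ δ) (hh : ∀ t ∈ Finset.Icc 1 (nObs J), |h (g t) - h u| ≤ H * |g t - u|)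
    (hhb : ∀ t ∈ Finset.Icc 1 (nObs J), |h (g t)| ≤ hb) (hhb0 : 0 ≤ hb) (hθ : 0 < θ)
    (hδ : δ ≤ |varianceEstimator K J M b x w - h u|) :
    θ * (δ - b * H) / 2 + θ * δ / 4 ≤
      |∑ t ∈ Finset.Icc 1 (nObs J), kernelWeight K J b (g t) u * ((x t - g t) ^ 2 - h (g t))| +
      (Kb + L * (1 + hb) + Kb * H) / (nObs J * b ^ 2) * ∑ t ∈ Finset.Icc 1 (nObs J),
        (|movingAverage J M x t - g t| * (1 + (x t - g t) ^ 2) +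
          (movingAverage J M x t - g t) ^ 2 + |w - u| * (1 + (x t - g t) ^ 2)) := by
  have hn := nObs_cast_pos J
  have hKb0 : 0 ≤ Kb := (hK0 0).trans (hKb 0)
  set n : ℝ := ((nObs J : ℕ) : ℝ) with hndef
  set I := Finset.Icc 1 (nObs J) with hI
  set A : ℕ → ℝ := movingAverage J M x with hA
  set ω : ℕ → ℝ := fun t => kernelWeight K J b (A t) w with hω
  set ω₀ : ℕ → ℝ := fun t => kernelWeight K J b (g t) u with hω₀
  set D := ∑ t ∈ I, ω t with hDdef
  set U := |w - u| with hU
  set ε : ℕ → ℝ := fun t => x t - g t with hε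
  set Δ : ℕ → ℝ := fun t => A t - g t with hΔ
  set Q := Kb + L * (1 + hb) + Kb * H with hQ
  have hDpos : 0 < D := hθ.trans_le hD
  have hω0 : ∀ t, 0 ≤ ω t := fun t => by
    simp only [hω, kernelWeight]
    have := hK0 ((A t - w) / b)
    positivity
  -- Weakened from 1/(nb) by b ≤ 1, so that all perturbation terms share the factor 1/(nb²) of the
  -- Lipschitz term.
  have hωK : ∀ t, ω t ≤ Kb / (n * b ^ 2) := fun t => by
    simp only [hω, kernelWeight]
    have := hKb ((A t - w) / b)
    rw [div_mul_eq_mul_div, one_mul]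
    calc K ((A t - w) / b) / (n * b) ≤ Kb / (n * b) := by gcongr
      _ ≤ Kb / (n * b ^ 2) := by gcongr; nlinarith
  have hωω : ∀ t, |ω t - ω₀ t| ≤ L / (n * b ^ 2) * (|Δ t| + U) := fun t => by
    simp only [hω, hω₀, kernelWeight]
    rw [← mul_sub, abs_mul, abs_of_pos (by positivity)]
    have h1 : |(A t - w) / b - (g t - u) / b| ≤ (|Δ t| + U) / b := by
      rw [← sub_div, abs_div, abs_of_pos hb0]
      gcongr
      rw [show A t - w - (g t - u) = Δ t - (w - u) by simp only [hΔ]; ring]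
      exact abs_sub _ _
    calc 1 / (n * b) * |K ((A t - w) / b) - K ((g t - u) / b)|
        ≤ 1 / (n * b) * (L * ((|Δ t| + U) / b)) := by
          gcongr
          exact (hKL _ _).trans (by gcongr)
      _ = _ := by field_simp
  have hU0 : 0 ≤ U := abs_nonneg _
  -- A nonzero weight forces |A t - w| ≤ b/2. The smoothing bias is therefore Hb/2 and not Hb, which
  -- leaves room for the perturbation terms.
  have hωh : ∀ t ∈ I, ω t * |h (g t) - h u| ≤ H * b / 2 * ω t +
      Kb * H / (n * b ^ 2) * (|Δ t| + U) := fun t ht => by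
    by_cases hz : (A t - w) / b ∈ Set.Icc (-(1 / 2) : ℝ) (1 / 2)
    · have hAw : |A t - w| ≤ b / 2 := by
        rw [Set.mem_Icc, ← abs_le, abs_div, abs_of_pos hb0, div_le_iff₀ hb0] at hz
        linarith
      have h1 : |g t - u| ≤ b / 2 + (|Δ t| + U) := by
        have h2 := abs_sub (A t - w) (Δ t - (w - u))
        have h3 := abs_sub (Δ t) (w - u)
        rw [show A t - w - (Δ t - (w - u)) = g t - u by simp only [hΔ]; ring] at h2
        linarith
      calc ω t * |h (g t) - h u| ≤ ω t * (H * (b / 2 + (|Δ t| + U))) := by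
            have := hω0 t
            gcongr
            exact (hh t ht).trans (by gcongr)
        _ = H * b / 2 * ω t + ω t * (H * (|Δ t| + U)) := by ring
        _ ≤ H * b / 2 * ω t + Kb / (n * b ^ 2) * (H * (|Δ t| + U)) := by
            have := hωK t
            gcongr
        _ = _ := by ring
    · have : ω t = 0 := by simp only [hω, kernelWeight]; rw [hKs _ hz, mul_zero]
      rw [this, zero_mul, mul_zero, zero_add]
      positivity
  have hδD : δ * D ≤ |∑ t ∈ I, ω t * ((x t - A t) ^ 2 - h u)| := by
    have h1 : ∑ t ∈ I, ω t * ((x t - A t) ^ 2 - h u) =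
        (varianceEstimator K J M b x w - h u) * D := by
      simp only [varianceEstimator]
      rw [sub_mul, div_mul_cancel₀ _ hDpos.ne', hDdef, Finset.mul_sum, ← Finset.sum_sub_distrib]
      refine Finset.sum_congr rfl fun t _ => ?_
      simp only [hω, hA]; ring
    rw [h1, abs_mul, abs_of_pos hDpos]
    gcongr
  set G := ∑ t ∈ I, (|Δ t| * (1 + ε t ^ 2) + Δ t ^ 2 + U * (1 + ε t ^ 2)) with hG
  have hsplit : |∑ t ∈ I, ω t * ((x t - A t) ^ 2 - h u)| ≤
      |∑ t ∈ I, ω₀ t * (ε t ^ 2 - h (g t))| + (H * b / 2 * D + Q / (n * b ^ 2) * G) := by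
    have h1 : ∑ t ∈ I, ω t * ((x t - A t) ^ 2 - h u) = ∑ t ∈ I, ω₀ t * (ε t ^ 2 - h (g t)) +
        ∑ t ∈ I, (ω t * ((x t - A t) ^ 2 - ε t ^ 2) + (ω t - ω₀ t) * (ε t ^ 2 - h (g t)) +
          ω t * (h (g t) - h u)) := by
      rw [← Finset.sum_add_distrib]
      exact Finset.sum_congr rfl fun t _ => by ring
    rw [h1]
    refine (abs_add_le _ _).trans (add_le_add le_rfl ((Finset.abs_sum_le_sum_abs _ _).trans ?_))
    rw [hDdef, hG, Finset.mul_sum, Finset.mul_sum, ← Finset.sum_add_distrib]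
    refine Finset.sum_le_sum fun t ht => ?_
    have e : Q / (n * b ^ 2) = Q * (1 / (n * b ^ 2)) := by ring
    rw [e]
    refine abs_perturbation_summand_le (by positivity) hKb0 hL hhb0 hH hU0 (hω0 t) ?_ ?_
      (hhb t ht) ?_
    · exact (hωK t).trans_eq (by ring)
    · exact (hωω t).trans_eq (by ring)
    · exact (hωh t ht).trans_eq (by ring)
  have hδ0 : 0 ≤ δ := le_trans (by positivity) hbδ
  have hbH : 0 ≤ b * H := by positivity
  -- Since δ - Hb/2 = (δ - bH)/2 + δ/2, the noise receives (δ - bH)/2, and a quarter of δ is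
  -- reserved for the perturbation.
  have h1 : θ * (δ - b * H) / 2 + θ * δ / 4 ≤ (δ - H * b / 2) * D := by
    have h2 : 0 ≤ δ - H * b / 2 := by linarith
    have h3 := mul_nonneg hθ.le hδ0
    calc θ * (δ - b * H) / 2 + θ * δ / 4 ≤ (δ - H * b / 2) * θ := by linarith
      _ ≤ _ := by gcongr
  linarith

/-! ### The six alternatives and two-sided tails -/

section

theorem windowMean_add (n M : ℕ) (x y : ℕ → ℝ) (t : ℕ) :
    windowMean n M (fun p => x p + y p) t = windowMean n M x t + windowMean n M y t := by
  simp only [windowMean, Finset.sum_add_distrib, add_div]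

theorem windowMean_congr {n M : ℕ} {x y : ℕ → ℝ} (h : ∀ p ∈ Finset.Icc 1 n, x p = y p) (t : ℕ) :
    windowMean n M x t = windowMean n M y t := by
  simp only [windowMean]
  congr 1
  exact Finset.sum_congr rfl fun p hp => h p (Finset.mem_filter.1 hp).1

/-- Separates the deterministic bias β of the pre-fit from its noise ν. The quadratic bias becomes
linear through |β| ≤ C, so that only the total bias Σ|β| has to be controlled. -/
theorem abs_mul_add_sq_le {a β ν y C : ℝ} (ha : a = β + ν) (hβ : |β| ≤ C) :
    |a| * (1 + y ^ 2) + a ^ 2 ≤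
      |β| * (1 + 2 * C + y ^ 2) + |ν| * (1 + y ^ 2 + 2 * |ν|) := by
  subst ha
  have h1 := mul_le_mul_of_nonneg_right (abs_add_le β ν) (by positivity : 0 ≤ 1 + y ^ 2)
  have h2 : (β + ν) ^ 2 ≤ 2 * |β| ^ 2 + 2 * |ν| ^ 2 := by
    rw [sq_abs, sq_abs]; linarith [sq_nonneg (β - ν)]
  have h3 := mul_le_mul_of_nonneg_left hβ (abs_nonneg β)
  linarith

/-- If the variance estimator deviates by `δ`, then one of six elementary sums is atypical. -/
theorem deviation_alternatives {K h : ℝ → ℝ} {J M : ℕ} {b B Cb Kb L H hb r θ δ : ℝ}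
    {k x g e ζ : ℕ → ℝ}
    (hK0 : ∀ z, 0 ≤ K z) (hKs : ∀ z, z ∉ Set.Icc (-(1 / 2) : ℝ) (1 / 2) → K z = 0)
    (hKb : ∀ z, K z ≤ Kb) (hKb0 : 0 < Kb) (hKL : ∀ z w, |K z - K w| ≤ L * |z - w|) (hL : 0 < L)
    (hb0 : 0 < b) (hb1 : b ≤ 1) (hH : 0 ≤ H) (hbδ : b * H ≤ δ)
    (hh : ∀ t ∈ Finset.Icc 1 (nObs J),
      |h (g t) - h (∑ q ∈ Finset.Icc 1 (nObs J), k q * g q)| ≤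
        H * |g t - ∑ q ∈ Finset.Icc 1 (nObs J), k q * g q|)
    (hhb : ∀ t ∈ Finset.Icc 1 (nObs J), |h (g t)| ≤ hb) (hhb0 : 0 ≤ hb) (hθ : 0 < θ)
    (hk : ∀ q ∈ Finset.Icc 1 (nObs J), 0 ≤ k q) (hk1 : ∑ q ∈ Finset.Icc 1 (nObs J), k q = 1)
    (hx : ∀ t ∈ Finset.Icc 1 (nObs J), x t = g t + e t + ζ t)
    (he : ∀ t ∈ Finset.Icc 1 (nObs J), |e t| ≤ r)
    (hζ : ∀ t ∈ Finset.Icc 1 (nObs J), |ζ t + e t| ≤ B)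
    (hβ : ∀ t ∈ Finset.Icc 1 (nObs J), |windowMean (nObs J) M (fun p => g p + e p) t - g t| ≤ Cb)
    (hr : r ≤ θ * b ^ 2 / (2 * L))
    (hr' : r ≤ θ * δ * b ^ 2 / (24 * (Kb + L * (1 + hb) + Kb * H) * (1 + B ^ 2)))
    (hδ : δ ≤ |varianceEstimator K J M b x (∑ q ∈ Finset.Icc 1 (nObs J), k q * x q) -
      h (∑ q ∈ Finset.Icc 1 (nObs J), k q * g q)|) :
    (∑ t ∈ Finset.Icc 1 (nObs J), K ((windowMean (nObs J) M (fun p => g p + e p) t +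
        windowMean (nObs J) M ζ t - ∑ q ∈ Finset.Icc 1 (nObs J), k q * g q) / b) ≤
          2 * θ * (nObs J * b)) ∨
    (θ * b ^ 2 / (2 * L) ≤ |∑ q ∈ Finset.Icc 1 (nObs J), k q * ζ q|) ∨
    (θ * δ * b ^ 2 / (24 * (Kb + L * (1 + hb) + Kb * H) * (1 + B ^ 2)) ≤
      |∑ q ∈ Finset.Icc 1 (nObs J), k q * ζ q|) ∨
    (θ * δ * nObs J * b ^ 2 / (12 * (Kb + L * (1 + hb) + Kb * H)) ≤
      ∑ t ∈ Finset.Icc 1 (nObs J), |windowMean (nObs J) M ζ t| *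
        (1 + (ζ t + e t) ^ 2 + 2 * |windowMean (nObs J) M ζ t|)) ∨
    (θ * δ * nObs J * b ^ 2 / (12 * (Kb + L * (1 + hb) + Kb * H)) ≤
      ∑ t ∈ Finset.Icc 1 (nObs J), |windowMean (nObs J) M (fun p => g p + e p) t - g t| *
        (1 + 2 * Cb + (ζ t + e t) ^ 2)) ∨
    (θ * (δ - b * H) / 2 ≤ |∑ t ∈ Finset.Icc 1 (nObs J), kernelWeight K J b (g t)
      (∑ q ∈ Finset.Icc 1 (nObs J), k q * g q) * ((ζ t + e t) ^ 2 - h (g t))|) := by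
  by_contra! hcon
  obtain ⟨hD, hU1, hU2, hν, hβs, hS⟩ := hcon
  have hn := nObs_cast_pos J
  generalize hu : ∑ q ∈ Finset.Icc 1 (nObs J), k q * g q = u at *
  generalize hw : ∑ q ∈ Finset.Icc 1 (nObs J), k q * x q = w at *
  generalize hQ : Kb + L * (1 + hb) + Kb * H = Q at *
  generalize hZ : ∑ q ∈ Finset.Icc 1 (nObs J), k q * ζ q = Z at *
  have hQ0 : 0 < Q := by rw [← hQ]; positivity
  have hU : |w - u| ≤ r + |Z| := by
    have h1 : w - u = ∑ q ∈ Finset.Icc 1 (nObs J), k q * e q + Z := by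
      rw [← hw, ← hu, ← hZ, ← Finset.sum_sub_distrib, ← Finset.sum_add_distrib]
      exact Finset.sum_congr rfl fun q hq => by rw [hx q hq]; ring
    rw [h1]
    refine (abs_add_le _ _).trans (add_le_add_left ?_ _)
    refine (Finset.abs_sum_le_sum_abs _ _).trans ?_
    calc ∑ q ∈ Finset.Icc 1 (nObs J), |k q * e q| ≤ ∑ q ∈ Finset.Icc 1 (nObs J), k q * r :=
          Finset.sum_le_sum fun q hq => by
            rw [abs_mul, abs_of_nonneg (hk q hq)]
            exact mul_le_mul_of_nonneg_left (he q hq) (hk q hq)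
      _ = r := by rw [← Finset.sum_mul, hk1, one_mul]
  have hA : ∀ t, movingAverage J M x t = windowMean (nObs J) M (fun p => g p + e p) t +
      windowMean (nObs J) M ζ t := fun t => by
    rw [movingAverage_eq, ← windowMean_add]
    exact windowMean_congr (fun p hp => hx p hp) t
  have hcard : ((Finset.Icc 1 (nObs J)).card : ℝ) = nObs J := by simp
  have hDθ : θ ≤ ∑ t ∈ Finset.Icc 1 (nObs J), kernelWeight K J b (movingAverage J M x t) w := by
    -- Moving the centre of the kernel from u to w costs at most θb per term, so a kernel sum above
    -- 2θnb leaves the normalized sum above θ.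
    have hUb : L * |w - u| / b ≤ θ * b := by
      rw [div_le_iff₀ hb0]
      have h1 : |w - u| ≤ θ * b ^ 2 / L := by
        have : θ * b ^ 2 / L = θ * b ^ 2 / (2 * L) + θ * b ^ 2 / (2 * L) := by field_simp; norm_num
        linarith
      rw [le_div_iff₀ hL] at h1
      linarith
    have h1 : ∀ t ∈ Finset.Icc 1 (nObs J), 1 / (nObs J * b) * (K ((windowMean (nObs J) M
        (fun p => g p + e p) t + windowMean (nObs J) M ζ t - u) / b) - θ * b) ≤
          kernelWeight K J b (movingAverage J M x t) w := fun t _ => by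
      rw [kernelWeight, hA]
      refine mul_le_mul_of_nonneg_left ?_ (by positivity)
      set y := windowMean (nObs J) M (fun p => g p + e p) t + windowMean (nObs J) M ζ t
      have h2 := (abs_le.1 (hKL ((y - u) / b) ((y - w) / b))).2
      rw [← sub_div, abs_div, abs_of_pos hb0, show y - u - (y - w) = w - u by ring,
        ← mul_div_assoc] at h2
      linarith
    refine le_trans ?_ (Finset.sum_le_sum h1)
    rw [← Finset.mul_sum, Finset.sum_sub_distrib, Finset.sum_const, nsmul_eq_mul, hcard,
      one_div, ← div_eq_inv_mul, le_div_iff₀ (by positivity)]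
    linarith
  have hmain := le_noise_add_perturbation hK0 hKs hKb hKL hL.le hb0 hb1 hH hDθ hbδ hh hhb hhb0 hθ hδ
  have hε : ∀ t ∈ Finset.Icc 1 (nObs J), x t - g t = ζ t + e t := fun t ht => by
    rw [hx t ht]; ring
  rw [hQ] at hmain
  have hS' : ∑ t ∈ Finset.Icc 1 (nObs J), kernelWeight K J b (g t) u * ((x t - g t) ^ 2 - h (g t)) =
      ∑ t ∈ Finset.Icc 1 (nObs J), kernelWeight K J b (g t) u * ((ζ t + e t) ^ 2 - h (g t)) :=
    Finset.sum_congr rfl fun t ht => by rw [hε t ht]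
  rw [hS'] at hmain
  set T := θ * δ * nObs J * b ^ 2 / (12 * Q) with hT
  -- The squared noise is bounded by B² here, which is why 1 + B², and with it log^{2d} n, appears
  -- in the second threshold for the local mean.
  have hUs : ∑ t ∈ Finset.Icc 1 (nObs J), |w - u| * (1 + (ζ t + e t) ^ 2) ≤ T := by
    have hB : 0 < 1 + B ^ 2 := by positivity
    have h1 : |w - u| ≤ θ * δ * b ^ 2 / (12 * Q * (1 + B ^ 2)) := by
      have : θ * δ * b ^ 2 / (12 * Q * (1 + B ^ 2)) = θ * δ * b ^ 2 / (24 * Q * (1 + B ^ 2)) +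
        θ * δ * b ^ 2 / (24 * Q * (1 + B ^ 2)) := by field_simp; ring
      linarith
    calc ∑ t ∈ Finset.Icc 1 (nObs J), |w - u| * (1 + (ζ t + e t) ^ 2)
        ≤ ∑ t ∈ Finset.Icc 1 (nObs J), θ * δ * b ^ 2 / (12 * Q * (1 + B ^ 2)) * (1 + B ^ 2) := by
          refine Finset.sum_le_sum fun t ht => mul_le_mul h1 ?_ (by positivity)
            ((abs_nonneg _).trans h1)
          have := sq_le_sq' (by linarith [(abs_le.1 (hζ t ht)).1]) (abs_le.1 (hζ t ht)).2
          linarith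
      _ = T := by
          rw [Finset.sum_const, nsmul_eq_mul, hcard, hT]; field_simp
  have hsum : ∑ t ∈ Finset.Icc 1 (nObs J), (|movingAverage J M x t - g t| * (1 + (x t - g t) ^ 2) +
      (movingAverage J M x t - g t) ^ 2 + |w - u| * (1 + (x t - g t) ^ 2)) ≤ T + T + T := by
    refine (Finset.sum_le_sum (fun t ht => add_le_add_left
      (abs_mul_add_sq_le (ν := windowMean (nObs J) M ζ t) (by rw [hA]; ring) (hβ t ht)) _)).trans ?_
    rw [Finset.sum_add_distrib, Finset.sum_add_distrib]
    refine add_le_add (add_le_add ?_ ?_) ?_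
    · exact le_trans (Finset.sum_congr rfl fun t ht => by rw [hε t ht]).le hβs.le
    · exact le_trans (Finset.sum_congr rfl fun t ht => by rw [hε t ht]).le hν.le
    · exact le_trans (Finset.sum_congr rfl fun t ht => by rw [hε t ht]).le hUs
  have h3 := mul_le_mul_of_nonneg_left hsum (by positivity : 0 ≤ Q / (nObs J * b ^ 2))
  -- The 12 in T is chosen so that the three perturbation sums use up exactly the reserve θδ/4.
  have h4 : Q / (nObs J * b ^ 2) * (T + T + T) = θ * δ / 4 := by
    rw [hT]; field_simp; ring
  linarith

variable {Ω : Type*} [mΩ : MeasurableSpace Ω] {μ : Measure Ω} {ζ : ℕ → Ω → ℝ} {B v : ℝ}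

namespace IsCentredNoise

/-- Two-sided tails of weighted sums of centred noise. -/
theorem measureReal_abs_weighted_sum_ge_le (h : IsCentredNoise μ ζ B v) (S : Finset ℕ) {w : ℕ → ℝ}
    {R V x : ℝ} (hB : 0 < B) (hv : 0 < v) (hR : 0 < R) (hV : 0 < V) (hx : 0 ≤ x)
    (hw : ∀ t ∈ S, |w t| ≤ R) (hw2 : ∑ t ∈ S, w t ^ 2 ≤ V) :
    μ.real {ω | x ≤ |∑ t ∈ S, w t * ζ t ω|} ≤
      2 * Real.exp (-min (x ^ 2 / (4 * (v * V))) (x / (2 * (R * B)))) := by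
  have := h.isProbabilityMeasure
  have h1 := h.measureReal_weighted_sum_ge_le S hB hv hR hV hx hw hw2
  have h2 := h.measureReal_weighted_sum_ge_le S (w := fun t => -w t) hB hv hR hV hx
    (by simpa using hw) (by simpa using hw2)
  have h3 : {ω | x ≤ |∑ t ∈ S, w t * ζ t ω|} ⊆
      {ω | x ≤ ∑ t ∈ S, w t * ζ t ω} ∪ {ω | x ≤ ∑ t ∈ S, -w t * ζ t ω} := fun ω hω => by
    simp only [Set.mem_ofPred_eq, Set.mem_union, neg_mul, Finset.sum_neg_distrib] at hω ⊢
    exact le_abs.1 hω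
  linarith [(measureReal_mono (μ := μ) h3).trans (measureReal_union_le _ _)]

/-- Two-sided tails of weighted sums of squares, centred up to a small bias. -/
theorem measureReal_abs_weighted_sq_sum_ge_le (h : IsCentredNoise μ ζ B v) (S : Finset ℕ)
    {w e η : ℕ → ℝ} {A R V x : ℝ} (hA : 0 < A) (hR : 0 < R) (hV : 0 < V) (hx : 0 ≤ x)
    (he : ∀ t ∈ S, |e t| ≤ 1) (hξ : ∀ t ∈ S, ∀ ω, |ζ t ω + e t| ≤ A)
    (hw : ∀ t ∈ S, |w t| ≤ R) (hw2 : ∑ t ∈ S, w t ^ 2 ≤ V)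
    (hη : ∑ t ∈ S, |w t| * |∫ ω', (ζ t ω' + e t) ^ 2 ∂μ - η t| ≤ x / 2) :
    μ.real {ω | x ≤ |∑ t ∈ S, w t * ((ζ t ω + e t) ^ 2 - η t)|} ≤
      2 * Real.exp (-min ((x / 2) ^ 2 / (4 * (8 * (v + 1) * V)))
        ((x / 2) / (2 * (R * A ^ 2)))) := by
  have := h.isProbabilityMeasure
  have hx2 : 0 ≤ x / 2 := by positivity
  have h1 := h.measureReal_weighted_sq_sum_ge_le S hA hR hV hx2 he hξ hw hw2
  have h2 := h.measureReal_weighted_sq_sum_ge_le S (w := fun t => -w t) hA hR hV hx2 he hξ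
    (by simpa using hw) (by simpa using hw2)
  have h3 : {ω | x ≤ |∑ t ∈ S, w t * ((ζ t ω + e t) ^ 2 - η t)|} ⊆
      {ω | x / 2 ≤ ∑ t ∈ S, w t * ((ζ t ω + e t) ^ 2 - ∫ ω', (ζ t ω' + e t) ^ 2 ∂μ)} ∪
      {ω | x / 2 ≤ ∑ t ∈ S, -w t * ((ζ t ω + e t) ^ 2 - ∫ ω', (ζ t ω' + e t) ^ 2 ∂μ)} :=
    fun ω hω => by
    simp only [Set.mem_ofPred_eq, Set.mem_union, neg_mul, Finset.sum_neg_distrib] at hω ⊢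
    rw [← le_abs]
    have e1 : ∑ t ∈ S, w t * ((ζ t ω + e t) ^ 2 - η t) =
        ∑ t ∈ S, w t * ((ζ t ω + e t) ^ 2 - ∫ ω', (ζ t ω' + e t) ^ 2 ∂μ) +
        ∑ t ∈ S, w t * (∫ ω', (ζ t ω' + e t) ^ 2 ∂μ - η t) := by
      rw [← Finset.sum_add_distrib]
      exact Finset.sum_congr rfl fun t _ => by ring
    have e2 : |∑ t ∈ S, w t * (∫ ω', (ζ t ω' + e t) ^ 2 ∂μ - η t)| ≤ x / 2 := by
      refine (Finset.abs_sum_le_sum_abs _ _).trans ?_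
      simpa only [abs_mul] using hη
    rw [e1] at hω
    linarith [hω.trans (abs_add_le _ _)]
  linarith [(measureReal_mono (μ := μ) h3).trans (measureReal_union_le _ _)]

/-- The effect of the bias of the pre-fit: an upper tail. -/
theorem measureReal_weighted_shift_sq_sum_ge_le (h : IsCentredNoise μ ζ B v) (S : Finset ℕ)
    {w e : ℕ → ℝ} {A R V C T : ℝ} (hA : 0 < A) (hR : 0 < R) (hV : 0 < V) (hC : 0 ≤ C) (hT : 0 ≤ T)
    (he : ∀ t ∈ S, |e t| ≤ 1) (hξ : ∀ t ∈ S, ∀ ω, |ζ t ω + e t| ≤ A)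
    (hw0 : ∀ t ∈ S, 0 ≤ w t) (hw : ∀ t ∈ S, w t ≤ R) (hw1 : ∑ t ∈ S, w t ≤ V)
    (hVT : V * (C + v + 1) ≤ T / 2) :
    μ.real {ω | T ≤ ∑ t ∈ S, w t * (C + (ζ t ω + e t) ^ 2)} ≤
      Real.exp (-min ((T / 2) ^ 2 / (4 * (8 * (v + 1) * (R * V))))
        ((T / 2) / (2 * (R * A ^ 2)))) := by
  have := h.isProbabilityMeasure
  have hv := h.nonneg
  -- The variance is controlled by maximum times total: the weights are biases, bounded one by one
  -- and small in total.
  have hw2 : ∑ t ∈ S, w t ^ 2 ≤ R * V := by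
    calc ∑ t ∈ S, w t ^ 2 ≤ ∑ t ∈ S, R * w t := Finset.sum_le_sum fun t ht => by
          rw [pow_two]; exact mul_le_mul_of_nonneg_right (hw t ht) (hw0 t ht)
      _ ≤ R * V := by rw [← Finset.mul_sum]; gcongr
  refine le_trans (measureReal_mono fun ω hω => ?_) (h.measureReal_weighted_sq_sum_ge_le S hA hR
    (by positivity : 0 < R * V) (by positivity : 0 ≤ T / 2) he hξ
    (fun t ht => by rw [abs_of_nonneg (hw0 t ht)]; exact hw t ht) hw2)
  simp only [Set.mem_ofPred_eq] at hω ⊢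
  have e1 : ∑ t ∈ S, w t * (C + (ζ t ω + e t) ^ 2) =
      ∑ t ∈ S, w t * ((ζ t ω + e t) ^ 2 - ∫ ω', (ζ t ω' + e t) ^ 2 ∂μ) +
      ∑ t ∈ S, w t * (C + ∫ ω', (ζ t ω' + e t) ^ 2 ∂μ) := by
    rw [← Finset.sum_add_distrib]
    exact Finset.sum_congr rfl fun t _ => by ring
  have e2 : ∑ t ∈ S, w t * (C + ∫ ω', (ζ t ω' + e t) ^ 2 ∂μ) ≤ T / 2 := by
    refine le_trans ?_ hVT
    calc _ ≤ ∑ t ∈ S, w t * (C + v + 1) := Finset.sum_le_sum fun t ht =>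
          mul_le_mul_of_nonneg_left (by linarith [h.integral_shift_sq_le t (he t ht)]) (hw0 t ht)
      _ ≤ _ := by rw [← Finset.sum_mul]; gcongr
  linarith

end IsCentredNoise

end

/-! ### Exponents compared with Gaussian ones, and the asymptotic tail bounds -/

theorem tendsto_nObs : Tendsto (fun J => (nObs J : ℝ)) atTop atTop := by
  simp only [nObs, Nat.cast_pow, Nat.cast_ofNat]
  exact tendsto_pow_atTop_atTop_of_one_lt one_lt_two

theorem tendsto_log_nObs : Tendsto (fun J => Real.log (nObs J)) atTop atTop :=
  Real.tendsto_log_atTop.comp tendsto_nObs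

theorem eventually_mul_log_rpow_le (C p : ℝ) {q : ℝ} (hq : 0 < q) :
    ∀ᶠ J in atTop, C * Real.log (nObs J) ^ p ≤ (nObs J : ℝ) ^ q := by
  have h1 := tendsto_nObs.eventually
    ((isLittleO_log_rpow_rpow_atTop p hq).def (by positivity : 0 < 1 / (|C| + 1)))
  filter_upwards [h1, tendsto_log_nObs.eventually_ge_atTop 0] with J h hl
  rw [Real.norm_of_nonneg (by positivity), Real.norm_of_nonneg (by positivity)] at h
  have hp : 0 ≤ Real.log (nObs J) ^ p := by positivity
  rw [one_div, ← div_eq_inv_mul, le_div_iff₀ (by positivity)] at h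
  nlinarith [le_abs_self C, mul_le_mul_of_nonneg_right (le_abs_self C) hp]

theorem exp_neg_le_of_log {n E : ℝ} (hn : 0 < n) {k : ℕ} (h : k * Real.log n ≤ E) :
    Real.exp (-E) ≤ (n ^ k)⁻¹ := by
  rw [← Real.exp_log (inv_pos.2 (pow_pos hn k)), Real.log_inv, Real.log_pow, Real.exp_le_exp]
  linarith

/-- Comparison of a Bernstein exponent with a Gaussian one, up to `n⁻²`. -/
theorem exists_bernstein_exp_le {c q : ℝ} (hc : 0 < c) (hq : 0 < q) (p : ℝ) :
    ∃ A : ℝ, 0 < A ∧ ∀ᶠ J in atTop, ∀ y ρ E z : ℝ, c * ρ ≤ y → z ≤ A * ρ → 1 < z →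
      min (c * y ^ 2) (c * y * (nObs J : ℝ) ^ q / Real.log (nObs J) ^ p) ≤ E →
        Real.exp (-E) ≤ Real.exp (-z ^ 2) + ((nObs J : ℝ) ^ 2)⁻¹ := by
  have hsc : 0 < √c := Real.sqrt_pos.2 hc
  refine ⟨√c * c, by positivity, ?_⟩
  filter_upwards [eventually_mul_log_rpow_le (2 / √c) (p + 1) hq,
    tendsto_log_nObs.eventually_gt_atTop 0] with J hJ hl y ρ E z hρ hz hz1 hE
  have hn := nObs_cast_pos J
  have hzy : z ≤ √c * y := hz.trans (by rw [mul_assoc]; gcongr)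
  have hin : 0 ≤ ((nObs J : ℝ) ^ 2)⁻¹ := by positivity
  rcases min_le_iff.1 hE with h | h
  · have h1 : z ^ 2 ≤ E := by
      calc z ^ 2 ≤ (√c * y) ^ 2 := by gcongr
        _ = c * y ^ 2 := by rw [mul_pow, Real.sq_sqrt hc.le]
        _ ≤ E := h
    have : Real.exp (-E) ≤ Real.exp (-z ^ 2) := by gcongr
    linarith
  -- In the linear branch z > 1 keeps y away from zero, and then n^q over a power of log n beats 2
  -- log n.
  · have h1 : √c ≤ c * y := by
      calc √c ≤ √c * (√c * y) := le_mul_of_one_le_right hsc.le (by linarith)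
        _ = c * y := by rw [← mul_assoc, Real.mul_self_sqrt hc.le]
    have h2 : ((2 : ℕ) : ℝ) * Real.log (nObs J) ≤ E := by
      refine le_trans ?_ h
      rw [le_div_iff₀ (by positivity), Nat.cast_ofNat, mul_assoc, mul_comm (Real.log _),
        ← Real.rpow_add_one hl.ne']
      rw [div_mul_eq_mul_div, div_le_iff₀ hsc] at hJ
      calc _ ≤ (nObs J : ℝ) ^ q * √c := hJ
        _ ≤ (nObs J : ℝ) ^ q * (c * y) := by gcongr
        _ = _ := by ring
    linarith [exp_neg_le_of_log hn h2, Real.exp_pos (-z ^ 2)]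

/-- Comparison of the exponent of the window sums with a Gaussian one, up to `n⁻³`. -/
theorem exists_window_exp_le {M : ℕ → ℕ} (hM : Tendsto M atTop atTop)
    (hnM : Tendsto (fun J => (nObs J : ℝ) / M J) atTop atTop) {bseq : ℕ → ℝ} {γ : ℝ} (hγ : 0 ≤ γ)
    (hbseq : bseq =o[atTop] fun J => ((nObs J : ℝ) / M J) ^ (1 / (6 + 4 * γ)))
    {a d κ c : ℝ} (ha : 0 < a) (hκ : 0 < κ) (hc : 0 < c) :
    ∃ A : ℝ, 0 < A ∧ ∀ᶠ J in atTop, ∀ y ρ z : ℝ, c * ρ ≤ y →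
      c * (√(nObs J : ℝ) / √(M J : ℝ)) ≤ y → z ≤ A * ρ → z ≤ bseq J → 1 < z →
        Real.exp (-min (y ^ 2 / (κ * max 1 (2 * (a * Real.log (nObs J) ^ d) /
            √(2 * M J + 1 : ℕ)) ^ 2))
          (y * √((nObs J : ℝ) / (2 * M J + 1 : ℕ)) / (8 * max 1 (2 * (a * Real.log (nObs J) ^ d) /
            √(2 * M J + 1 : ℕ))))) ≤ Real.exp (-z ^ 2) + ((nObs J : ℝ) ^ 3)⁻¹ := by
  have hsκ : 0 < √κ := Real.sqrt_pos.2 hκ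
  refine ⟨c / √κ, by positivity, ?_⟩
  have hη : 0 < √κ / (8 * √3) := by positivity
  filter_upwards [hbseq.def hη, hnM.eventually_ge_atTop 1, hM.eventually_ge_atTop 1,
    tendsto_log_nObs.eventually_gt_atTop 0,
    eventually_mul_log_rpow_le (48 * κ * a ^ 4 / c ^ 2) (4 * d + 1) one_pos,
    eventually_mul_log_rpow_le (192 * a ^ 3 / c) (3 * d + 1) one_pos]
    with J hbJ hnMJ hMJ hl h4 h3 y ρ z hρ hyM hz hzb hz1
  have hn := nObs_cast_pos J
  have hM0 : (0 : ℝ) < M J := by exact_mod_cast hMJ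
  have hm0 : (0 : ℝ) < (2 * M J + 1 : ℕ) := by positivity
  have hmM : ((2 * M J + 1 : ℕ) : ℝ) ≤ 3 * M J := by
    have : (1 : ℝ) ≤ M J := by exact_mod_cast hMJ
    push_cast; linarith
  have hMm : (M J : ℝ) ≤ (2 * M J + 1 : ℕ) := by push_cast; linarith
  set n : ℝ := ((nObs J : ℕ) : ℝ) with hndef
  set m : ℝ := ((2 * M J + 1 : ℕ) : ℝ) with hmdef
  set B : ℝ := a * Real.log n ^ d with hB
  have hB0 : 0 < B := by positivity
  have hin : 0 ≤ (n ^ 3)⁻¹ := by positivity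
  have hy0 : 0 < y := lt_of_lt_of_le (by positivity) hyM
  -- Two regimes. If √m ≥ 2B, the normalized window sums are sub-exponential at scale 1. Otherwise M
  -- is at most of order log^{2d} n.
  rcases le_or_gt (2 * B / √m) 1 with hs | hs
  · rw [max_eq_left hs]
    have hzy : z ≤ y / √κ := hz.trans (by rw [div_mul_eq_mul_div]; gcongr)
    -- The cap z ≤ b_n enters: b_n is eventually below a small multiple of √(n/M), as 1/(6+4γ) ≤
    -- 1/2. The √3 comes from m ≤ 3M. Hence the linear exponent is also at least z².
    have hzn : z ≤ √κ / 8 * √(n / m) := by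
      have h1 : z ≤ √κ / (8 * √3) * (n / M J) ^ (1 / (6 + 4 * γ)) := by
        refine hzb.trans ((le_abs_self _).trans ?_)
        rwa [Real.norm_eq_abs, Real.norm_of_nonneg (by positivity)] at hbJ
      have h2 : (n / M J) ^ (1 / (6 + 4 * γ)) ≤ √(n / M J) := by
        rw [Real.sqrt_eq_rpow]
        refine Real.rpow_le_rpow_of_exponent_le hnMJ ?_
        gcongr; linarith
      have h3 : √(n / M J) ≤ √3 * √(n / m) := by
        rw [← Real.sqrt_mul (by norm_num)]
        refine Real.sqrt_le_sqrt ?_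
        rw [← mul_div_assoc, div_le_div_iff₀ hM0 hm0]
        nlinarith
      calc z ≤ √κ / (8 * √3) * (√3 * √(n / m)) := h1.trans (by gcongr; exact h2.trans h3)
        _ = _ := by field_simp
    have hz2 : z ^ 2 ≤ min (y ^ 2 / (κ * 1 ^ 2)) (y * √(n / m) / (8 * 1)) := by
      refine le_min ?_ ?_
      · calc z ^ 2 ≤ (y / √κ) ^ 2 := by gcongr
          _ = _ := by rw [div_pow, Real.sq_sqrt hκ.le]; simp
      · calc z ^ 2 = z * z := pow_two z
          _ ≤ y / √κ * (√κ / 8 * √(n / m)) := by gcongr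
          _ = _ := by field_simp
    have : Real.exp (-min (y ^ 2 / (κ * 1 ^ 2)) (y * √(n / m) / (8 * 1))) ≤ Real.exp (-z ^ 2) :=
      Real.exp_le_exp.2 (neg_le_neg hz2)
    linarith
  -- Here y and √(n/m) are at least of order √n up to logarithms, so both exponents exceed 3 log n
  -- regardless of z.
  · rw [max_eq_right hs.le]
    have hsm : 0 < √m := Real.sqrt_pos.2 hm0
    have hm1 : 1 ≤ √m := by
      rw [Real.one_le_sqrt, hmdef]; exact_mod_cast Nat.le_add_left 1 _
    rw [one_lt_div hsm] at hs
    have hsB : 2 * B / √m ≤ 2 * B := div_le_self (by positivity) hm1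
    have hyB : c * √n / (2 * B) ≤ y := by
      refine le_trans ?_ hyM
      rw [mul_div_assoc]
      have : √(M J : ℝ) ≤ 2 * B := (Real.sqrt_le_sqrt hMm).trans hs.le
      have : 0 < √(M J : ℝ) := Real.sqrt_pos.2 hM0
      gcongr
    have hnm : √n / (2 * B) ≤ √(n / m) := by
      rw [Real.sqrt_div hn.le]; gcongr
    have hlog : ∀ k : ℕ, Real.log n ^ (k * d + 1) = (Real.log n ^ d) ^ k * Real.log n := fun k => by
      rw [Real.rpow_add_one hl.ne', mul_comm (k : ℝ) d, Real.rpow_mul_natCast hl.le]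
    have h4' := hlog 4
    have h3' := hlog 3
    push_cast at h4' h3'
    rw [h4', Real.rpow_one] at h4
    rw [h3', Real.rpow_one] at h3
    have hE : ((3 : ℕ) : ℝ) * Real.log n ≤ min (y ^ 2 / (κ * (2 * B / √m) ^ 2))
        (y * √(n / m) / (8 * (2 * B / √m))) := by
      refine le_min ?_ ?_
      · calc ((3 : ℕ) : ℝ) * Real.log n ≤ (c * √n / (2 * B)) ^ 2 / (κ * (2 * B) ^ 2) := by
              rw [div_pow, mul_pow, Real.sq_sqrt hn.le, div_div, le_div_iff₀ (by positivity), hB]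
              rw [div_mul_eq_mul_div, div_le_iff₀ (by positivity)] at h4
              push_cast
              linarith
          _ ≤ _ := by gcongr
      · calc ((3 : ℕ) : ℝ) * Real.log n ≤ (c * √n / (2 * B)) * (√n / (2 * B)) / (8 * (2 * B)) := by
              rw [div_mul_div_comm, mul_assoc c, Real.mul_self_sqrt hn.le, div_div,
                le_div_iff₀ (by positivity), hB]
              rw [div_mul_eq_mul_div, div_le_iff₀ (by positivity)] at h3
              push_cast
              linarith
          _ ≤ _ := by gcongr
    linarith [exp_neg_le_of_log hn hE, Real.exp_pos (-z ^ 2)]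

/-- Deviations of the local means of the noise. -/
theorem exists_localMean_tail_le {a d v C ε c : ℝ} (ha : 0 < a) (hv : 0 < v)
    (hC : 0 < C) (hε : 0 < ε) (hc : 0 < c) :
    ∃ A : ℝ, 0 < A ∧ ∀ᶠ J in atTop, ∀ (Ω : Type*) [MeasurableSpace Ω] (μ : Measure Ω)
      (ζ : ℕ → Ω → ℝ), IsCentredNoise μ ζ (2 * (a * Real.log (nObs J) ^ d)) v →
      ∀ j ∈ coarseScales ε J, ∀ k : ℕ → ℝ, (∀ q ∈ Finset.Icc 1 (nObs J), 0 ≤ k q) →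
      (∀ q ∈ Finset.Icc 1 (nObs J), k q ≤ C * (2 : ℝ) ^ ((j : ℝ) - J)) →
      ∑ q ∈ Finset.Icc 1 (nObs J), k q ^ 2 ≤ C * (2 : ℝ) ^ ((j : ℝ) - J) →
      ∀ ρ x z : ℝ, 0 ≤ x → c * ρ ≤ x * (2 : ℝ) ^ ((1 / 2 : ℝ) * (J - j)) → z ≤ A * ρ → 1 < z →
        μ.real {ω | x ≤ |∑ q ∈ Finset.Icc 1 (nObs J), k q * ζ q ω|} ≤
          2 * (Real.exp (-z ^ 2) + ((nObs J : ℝ) ^ 2)⁻¹) := by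
  set c' := min (1 / (4 * v * C)) (1 / (4 * C * a)) with hc'
  have hc'0 : 0 < c' := by positivity
  obtain ⟨A, hA, h⟩ := exists_bernstein_exp_le hc'0 (half_pos hε) d
  refine ⟨A * (c / c'), by positivity, ?_⟩
  filter_upwards [h, tendsto_log_nObs.eventually_gt_atTop 0] with J hJ hl
  intro Ω _ μ ζ hζ j hj k hk0 hk hk2 ρ x z hx hρ hz hz1
  have hl' : 0 < Real.log (nObs J) ^ d := by positivity
  have hs0 : (0 : ℝ) < (2 : ℝ) ^ ((1 / 2 : ℝ) * (J - j)) := by positivity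
  have hV : (2 : ℝ) ^ ((j : ℝ) - J) = (((2 : ℝ) ^ ((1 / 2 : ℝ) * (J - j))) ^ 2)⁻¹ := by
    rw [← Real.rpow_natCast, ← Real.rpow_mul (by norm_num), ← Real.rpow_neg (by norm_num)]
    congr 1; push_cast; ring
  -- The restriction to coarse scales makes each local mean average over at least a power of n,
  -- which supplies the power of n in the linear exponent.
  have hsn : (nObs J : ℝ) ^ (ε / 2) ≤ (2 : ℝ) ^ ((1 / 2 : ℝ) * (J - j)) := by
    rw [nObs, Nat.cast_pow, ← Real.rpow_natCast, ← Real.rpow_mul (by positivity), Nat.cast_ofNat]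
    refine Real.rpow_le_rpow_of_exponent_le one_le_two ?_
    have : (j : ℝ) ≤ (1 - ε) * J - 1 := hj
    linarith
  rw [hV] at hk hk2
  set s := (2 : ℝ) ^ ((1 / 2 : ℝ) * (J - j)) with hs
  refine (hζ.measureReal_abs_weighted_sum_ge_le (Finset.Icc 1 (nObs J)) (by positivity) hv
    (by positivity : 0 < C * (s ^ 2)⁻¹) (by positivity) hx
    (fun q hq => by rw [abs_of_nonneg (hk0 q hq)]; exact hk q hq) hk2).trans ?_
  refine mul_le_mul_of_nonneg_left ?_ zero_le_two
  refine hJ (x * s) (c / c' * ρ) _ z ?_ (by rwa [← mul_assoc]) hz1 (min_le_min ?_ ?_)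
  · rwa [← mul_assoc, mul_div_cancel₀ _ hc'0.ne']
  · calc c' * (x * s) ^ 2 ≤ 1 / (4 * v * C) * (x * s) ^ 2 := by
          gcongr; exact min_le_left _ _
      _ = _ := by field_simp
  · calc c' * (x * s) * (nObs J : ℝ) ^ (ε / 2) / Real.log (nObs J) ^ d
        ≤ 1 / (4 * C * a) * (x * s) * s / Real.log (nObs J) ^ d := by
          gcongr; exact min_le_right _ _
      _ = _ := by field_simp; ring

/-- Deviations of the kernel sums of the centred squared noise. -/
theorem exists_kernel_noise_tail_le {a d v Kb r₀ θ : ℝ} (ha : 0 < a) (hv : 0 < v) (hKb : 0 < Kb)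
    (hr₀ : 0 < r₀) (hθ : 0 < θ) {K : ℝ → ℝ} (hK0 : ∀ z, 0 ≤ K z) (hKle : ∀ z, K z ≤ Kb) :
    ∃ A : ℝ, 0 < A ∧ ∀ᶠ J in atTop, ∀ (Ω : Type*) [MeasurableSpace Ω] (μ : Measure Ω)
      (ζ : ℕ → Ω → ℝ), IsCentredNoise μ ζ (2 * (a * Real.log (nObs J) ^ d)) v →
      ∀ e η g : ℕ → ℝ, ∀ b D u z : ℝ, 0 < b → 0 ≤ D →
      (∀ t ∈ Finset.Icc 1 (nObs J), |e t| ≤ 1) →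
      (∀ t ∈ Finset.Icc 1 (nObs J), ∀ ω, |ζ t ω + e t| ≤ a * Real.log (nObs J) ^ d) →
      (∀ t ∈ Finset.Icc 1 (nObs J), |∫ ω, (ζ t ω + e t) ^ 2 ∂μ - η t| ≤ r₀ / nObs J) →
      z ≤ A * (D * √(nObs J : ℝ) * b) → 1 < z →
        μ.real {ω | θ * D / 2 ≤ |∑ t ∈ Finset.Icc 1 (nObs J),
          kernelWeight K J b (g t) u * ((ζ t ω + e t) ^ 2 - η t)|} ≤
          2 * (Real.exp (-z ^ 2) + ((nObs J : ℝ) ^ 2)⁻¹) := by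
  set c := min (θ ^ 2 / (512 * (v + 1) * Kb ^ 2)) (θ / (8 * Kb * a ^ 2)) with hc
  have hc0 : 0 < c := by positivity
  obtain ⟨A, hA, h⟩ := exists_bernstein_exp_le hc0 (half_pos one_pos) (2 * d)
  refine ⟨A / c, by positivity, ?_⟩
  filter_upwards [h, tendsto_log_nObs.eventually_gt_atTop 0,
    (tendsto_nObs.eventually_ge_atTop ((4 * (A / c) * Kb * r₀ / θ) ^ 2))] with J hJ hl hnJ
  intro Ω _ μ ζ hζ e η g b D u z hb hD he hξ hη hz hz1
  have hn := nObs_cast_pos J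
  have hl' : 0 < Real.log (nObs J) ^ d := by positivity
  have hl2 : Real.log (nObs J) ^ (2 * d) = (Real.log (nObs J) ^ d) ^ 2 := by
    rw [mul_comm, ← Real.rpow_mul_natCast hl.le]; norm_num
  rw [hl2] at hJ
  have hsn : √(nObs J : ℝ) ^ 2 = nObs J := Real.sq_sqrt hn.le
  have hsn0 : 0 < √(nObs J : ℝ) := Real.sqrt_pos.2 hn
  have hsn1 : 4 * (A / c) * Kb * r₀ / θ ≤ √(nObs J : ℝ) := Real.le_sqrt_of_sq_le hnJ
  rw [← Real.sqrt_eq_rpow] at hJ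
  have hcard : ((Finset.Icc 1 (nObs J)).card : ℝ) = nObs J := by simp
  have hWle : ∀ t, |kernelWeight K J b (g t) u| ≤ Kb / (nObs J * b) := fun t => by
    rw [kernelWeight, abs_mul, abs_of_pos (by positivity), abs_of_nonneg (hK0 _),
      one_div, ← div_eq_inv_mul]
    gcongr; exact hKle _
  -- Termwise bound that ignores the support of the kernel. It yields the rate n^{1/2} b of h_n.
  have hWsq : ∑ t ∈ Finset.Icc 1 (nObs J), kernelWeight K J b (g t) u ^ 2 ≤
      Kb ^ 2 / (nObs J * b ^ 2) := by
    calc ∑ t ∈ Finset.Icc 1 (nObs J), kernelWeight K J b (g t) u ^ 2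
        ≤ ∑ t ∈ Finset.Icc 1 (nObs J), (Kb / (nObs J * b)) ^ 2 := Finset.sum_le_sum fun t _ => by
          rw [← sq_abs]; have := hWle t; gcongr
      _ = _ := by rw [Finset.sum_const, nsmul_eq_mul, hcard]; field_simp
  -- From 1 < z ≤ (A/c) D√n b the level D has at least order 1/(√n b), while the truncation bias has
  -- order 1/(nb).
  have hbias : ∑ t ∈ Finset.Icc 1 (nObs J), |kernelWeight K J b (g t) u| *
      |∫ ω', (ζ t ω' + e t) ^ 2 ∂μ - η t| ≤ θ * D / 2 / 2 := by
    calc ∑ t ∈ Finset.Icc 1 (nObs J), |kernelWeight K J b (g t) u| *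
          |∫ ω', (ζ t ω' + e t) ^ 2 ∂μ - η t|
        ≤ ∑ t ∈ Finset.Icc 1 (nObs J), Kb / (nObs J * b) * (r₀ / nObs J) :=
          Finset.sum_le_sum fun t ht => by
            have := hWle t; have := hη t ht; gcongr
      _ = Kb * r₀ / (nObs J * b) := by
          rw [Finset.sum_const, nsmul_eq_mul, hcard]; field_simp
      _ ≤ θ * D / 2 / 2 := by
          rw [div_le_iff₀ (by positivity)]
          rw [div_le_iff₀ hθ] at hsn1
          have h1 : Kb * r₀ * 1 ≤ Kb * r₀ * (A / c * (D * √(nObs J : ℝ) * b)) := by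
            gcongr; linarith
          have h2 := mul_le_mul_of_nonneg_right hsn1 (by positivity : 0 ≤ D * √(nObs J : ℝ) * b)
          have h3 : √(nObs J : ℝ) * θ * (D * √(nObs J : ℝ) * b) = θ * D * (nObs J * b) := by
            linear_combination θ * D * b * hsn
          linarith
  refine (hζ.measureReal_abs_weighted_sq_sum_ge_le (Finset.Icc 1 (nObs J))
    (by positivity : 0 < a * Real.log (nObs J) ^ d) (by positivity : 0 < Kb / (nObs J * b))
    (by positivity : 0 < Kb ^ 2 / (nObs J * b ^ 2)) (by positivity) he hξ
    (fun t _ => hWle t) hWsq hbias).trans ?_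
  refine mul_le_mul_of_nonneg_left ?_ zero_le_two
  refine hJ (D * √(nObs J : ℝ) * b) (1 / c * (D * √(nObs J : ℝ) * b)) _ z
    (le_of_eq (by field_simp)) (hz.trans_eq (by ring)) hz1 (min_le_min ?_ ?_)
  · calc c * (D * √(nObs J : ℝ) * b) ^ 2
        ≤ θ ^ 2 / (512 * (v + 1) * Kb ^ 2) * (D * √(nObs J : ℝ) * b) ^ 2 := by
          gcongr; exact min_le_left _ _
      _ = _ := by rw [mul_pow, mul_pow, hsn]; field_simp; ring
  · calc c * (D * √(nObs J : ℝ) * b) * √(nObs J : ℝ) / (Real.log (nObs J) ^ d) ^ 2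
        ≤ θ / (8 * Kb * a ^ 2) * (D * √(nObs J : ℝ) * b) * √(nObs J : ℝ) /
          (Real.log (nObs J) ^ d) ^ 2 := by
          gcongr; exact min_le_right _ _
      _ = θ / (8 * Kb * a ^ 2) * (D * √(nObs J : ℝ) ^ 2 * b) / (Real.log (nObs J) ^ d) ^ 2 := by
          ring
      _ = _ := by rw [hsn]; field_simp; ring

theorem eventually_le_log_rpow {p : ℝ} (hp : 0 < p) (C : ℝ) :
    ∀ᶠ J in atTop, C ≤ Real.log (nObs J) ^ p :=
  ((tendsto_rpow_atTop hp).comp tendsto_log_nObs).eventually_ge_atTop C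

/-- The effect of the bias of the pre-fit. -/
theorem exists_bias_tail_le {a d v S₀ C R τ κ : ℝ} (ha : 0 < a) (hd : 0 < d)
    (hS₀ : 0 < S₀) (hC : 0 ≤ C) (hR : 0 < R) (hτ : 0 < τ) (hκ : 0 < κ) :
    ∃ A : ℝ, 0 < A ∧ ∀ᶠ J in atTop, ∀ (Ω : Type*) [MeasurableSpace Ω] (μ : Measure Ω)
      (ζ : ℕ → Ω → ℝ), IsCentredNoise μ ζ (2 * (a * Real.log (nObs J) ^ d)) v →
      ∀ (e w : ℕ → ℝ) (m b δ ρ z : ℝ), 0 < m → m ≤ nObs J → 0 < δ →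
      (∀ t ∈ Finset.Icc 1 (nObs J), |e t| ≤ 1) →
      (∀ t ∈ Finset.Icc 1 (nObs J), ∀ ω, |ζ t ω + e t| ≤ a * Real.log (nObs J) ^ d) →
      (∀ t ∈ Finset.Icc 1 (nObs J), 0 ≤ w t) → (∀ t ∈ Finset.Icc 1 (nObs J), w t ≤ R) →
      ∑ t ∈ Finset.Icc 1 (nObs J), w t ≤ S₀ * m →
      m / √(nObs J : ℝ) ≤ κ * (δ * √(nObs J : ℝ) * b ^ 2 * Real.log (nObs J) ^ (-2 * d)) →
      ρ ≤ κ * (δ * √(nObs J : ℝ) * b ^ 2 * Real.log (nObs J) ^ (-2 * d)) →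
      z ≤ A * ρ → 1 < z →
        μ.real {ω | τ * δ * nObs J * b ^ 2 ≤ ∑ t ∈ Finset.Icc 1 (nObs J),
          w t * (C + (ζ t ω + e t) ^ 2)} ≤ Real.exp (-z ^ 2) + ((nObs J : ℝ) ^ 2)⁻¹ := by
  by_cases hv : 0 ≤ v
  swap
  · exact ⟨1, one_pos, Eventually.of_forall fun J Ω _ μ ζ hζ => absurd hζ.nonneg hv⟩
  set c := min (τ ^ 2 / (128 * (v + 1) * R * S₀)) (τ / (4 * R * a ^ 2)) with hc
  have hc0 : 0 < c := by positivity
  obtain ⟨A, hA, h⟩ := exists_bernstein_exp_le hc0 (half_pos one_pos) 0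
  refine ⟨A / (κ * c), by positivity, ?_⟩
  filter_upwards [h, tendsto_log_nObs.eventually_gt_atTop 0, eventually_le_log_rpow hd 1,
    eventually_le_log_rpow (by positivity : 0 < 2 * d) (2 * κ * S₀ * (C + v + 1) / τ)]
    with J hJ hl hl1 hlC
  intro Ω _ μ ζ hζ e w m b δ ρ z hm hmn hδ he hξ hw0 hw hws hmy hρ hz hz1
  have hn := nObs_cast_pos J
  have hl' : 0 < Real.log (nObs J) ^ d := by positivity
  have hl2 : Real.log (nObs J) ^ (2 * d) = (Real.log (nObs J) ^ d) ^ 2 := by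
    rw [mul_comm, ← Real.rpow_mul_natCast hl.le]; norm_num
  rw [show -2 * d = -(2 * d) by ring, Real.rpow_neg hl.le, hl2] at hmy hρ
  rw [hl2] at hlC
  simp only [Real.rpow_zero, div_one, ← Real.sqrt_eq_rpow] at hJ
  set ℓ := Real.log (nObs J) ^ d with hℓ
  set y := δ * √(nObs J : ℝ) * b ^ 2 * (ℓ ^ 2)⁻¹ with hy
  have hsn : √(nObs J : ℝ) ^ 2 = nObs J := Real.sq_sqrt hn.le
  have hsn0 : 0 < √(nObs J : ℝ) := Real.sqrt_pos.2 hn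
  have hT : τ * δ * nObs J * b ^ 2 = τ * (y * √(nObs J : ℝ)) * ℓ ^ 2 := by
    have : y * √(nObs J : ℝ) * ℓ ^ 2 = δ * b ^ 2 * √(nObs J : ℝ) ^ 2 := by
      rw [hy]; field_simp
    rw [hsn] at this
    linear_combination -τ * this
  have hy0 : 0 ≤ y := by positivity
  have hyn : m ≤ κ * (y * √(nObs J : ℝ)) := by
    rw [div_le_iff₀ hsn0] at hmy; linarith
  rw [hT]
  -- The mean of the sum is only comparable to y√n. The extra ℓ² = log^{2d} n in the threshold
  -- absorbs all constants.
  have hVT : S₀ * m * (C + v + 1) ≤ τ * (y * √(nObs J : ℝ)) * ℓ ^ 2 / 2 := by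
    rw [div_le_iff₀ hτ] at hlC
    calc S₀ * m * (C + v + 1) ≤ S₀ * (κ * (y * √(nObs J : ℝ))) * (C + v + 1) := by gcongr
      _ = 2 * κ * S₀ * (C + v + 1) * (y * √(nObs J : ℝ)) / 2 := by ring
      _ ≤ ℓ ^ 2 * τ * (y * √(nObs J : ℝ)) / 2 := by gcongr
      _ = _ := by ring
  refine (hζ.measureReal_weighted_shift_sq_sum_ge_le (Finset.Icc 1 (nObs J))
    (by positivity : 0 < a * ℓ) hR (by positivity) hC (by positivity) he hξ hw0 hw hws hVT).trans ?_
  refine hJ y (1 / (κ * c) * ρ) _ z ?_ (hz.trans_eq (by ring)) hz1 (min_le_min ?_ ?_)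
  · calc c * (1 / (κ * c) * ρ) ≤ c * (1 / (κ * c) * (κ * y)) := by gcongr
      _ = y := by field_simp
  · calc c * y ^ 2 ≤ τ ^ 2 / (128 * (v + 1) * R * S₀) * y ^ 2 := by
          gcongr; exact min_le_left _ _
      _ = τ ^ 2 * y ^ 2 * m * 1 ^ 4 / (128 * (v + 1) * R * (S₀ * m)) := by field_simp
      _ ≤ τ ^ 2 * y ^ 2 * nObs J * ℓ ^ 4 / (128 * (v + 1) * R * (S₀ * m)) := by gcongr
      _ = τ ^ 2 * y ^ 2 * √(nObs J : ℝ) ^ 2 * ℓ ^ 4 / (128 * (v + 1) * R * (S₀ * m)) := by rw [hsn]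
      _ = _ := by field_simp; ring
  · calc c * y * √(nObs J : ℝ) ≤ τ / (4 * R * a ^ 2) * y * √(nObs J : ℝ) := by
          gcongr; exact min_le_right _ _
      _ = _ := by field_simp; ring

/-- The effect of the noise of the pre-fit. -/
theorem exists_prefit_noise_tail_le {M : ℕ → ℕ} (hM : Tendsto M atTop atTop)
    (hnM : Tendsto (fun J => (nObs J : ℝ) / M J) atTop atTop) {bseq : ℕ → ℝ} {γ : ℝ} (hγ : 0 ≤ γ)
    (hbseq : bseq =o[atTop] fun J => ((nObs J : ℝ) / M J) ^ (1 / (6 + 4 * γ)))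
    {a d v τ κ : ℝ} (ha : 0 < a) (hd : 0 < d) (hτ : 0 < τ) (hκ : 0 < κ) :
    ∃ A : ℝ, 0 < A ∧ ∀ᶠ J in atTop, ∀ (Ω : Type*) [MeasurableSpace Ω] (μ : Measure Ω)
      (ζ : ℕ → Ω → ℝ), IsCentredNoise μ ζ (2 * (a * Real.log (nObs J) ^ d)) v →
      ∀ (e : ℕ → ℝ) (b δ ρ z : ℝ),
      (∀ t ∈ Finset.Icc 1 (nObs J), |e t| ≤ 1) →
      (∀ t ∈ Finset.Icc 1 (nObs J), ∀ ω, |ζ t ω + e t| ≤ a * Real.log (nObs J) ^ d) →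
      √(nObs J : ℝ) / √(M J : ℝ) ≤
        κ * (δ * √(nObs J : ℝ) * b ^ 2 * Real.log (nObs J) ^ (-2 * d)) →
      ρ ≤ κ * (δ * √(nObs J : ℝ) * b ^ 2 * Real.log (nObs J) ^ (-2 * d)) →
      z ≤ A * ρ → z ≤ bseq J → 1 < z →
        μ.real {ω | τ * δ * nObs J * b ^ 2 ≤ ∑ t ∈ Finset.Icc 1 (nObs J),
          |windowMean (nObs J) (M J) (fun p => ζ p ω) t| * (1 + (ζ t ω + e t) ^ 2 +
            2 * |windowMean (nObs J) (M J) (fun p => ζ p ω) t|)} ≤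
          (2 * M J + 1 : ℕ) * (Real.exp (-z ^ 2) + ((nObs J : ℝ) ^ 3)⁻¹) := by
  by_cases hv : 0 ≤ v
  swap
  · exact ⟨1, one_pos, Eventually.of_forall fun J Ω _ μ ζ hζ => absurd hζ.nonneg hv⟩
  have hc0 : 0 < τ / (12 * a ^ 2 * κ) := by positivity
  obtain ⟨A, hA, h⟩ := exists_window_exp_le hM hnM hγ hbseq (d := d) ha
    (by positivity : 0 < 512 * Real.exp (v + 2 * Real.exp v)) hc0
  refine ⟨A, hA, ?_⟩
  filter_upwards [h, tendsto_log_nObs.eventually_gt_atTop 0, eventually_le_log_rpow hd (1 / a),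
    eventually_le_log_rpow (by positivity : 0 < 2 * d) (40 * κ * (v + 1) / τ),
    hM.eventually_ge_atTop 1, hnM.eventually_ge_atTop 3] with J hJ hl hl1 hlC hMJ hnMJ
  intro Ω _ μ ζ hζ e b δ ρ z he hξ hMy hρ hz hzb hz1
  have hn := nObs_cast_pos J
  have hM0 : (0 : ℝ) < M J := by exact_mod_cast hMJ
  have hl' : 0 < Real.log (nObs J) ^ d := by positivity
  have hl2 : Real.log (nObs J) ^ (2 * d) = (Real.log (nObs J) ^ d) ^ 2 := by
    rw [mul_comm, ← Real.rpow_mul_natCast hl.le]; norm_num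
  rw [show -2 * d = -(2 * d) by ring, Real.rpow_neg hl.le, hl2] at hMy hρ
  rw [hl2] at hlC
  set ℓ := Real.log (nObs J) ^ d with hℓ
  set y := δ * √(nObs J : ℝ) * b ^ 2 * (ℓ ^ 2)⁻¹ with hy
  have hsn : √(nObs J : ℝ) ^ 2 = nObs J := Real.sq_sqrt hn.le
  have hsn0 : 0 < √(nObs J : ℝ) := Real.sqrt_pos.2 hn
  have hsM0 : 0 < √(M J : ℝ) := Real.sqrt_pos.2 hM0
  have hm : 2 * M J + 1 ≤ nObs J := by
    rw [le_div_iff₀ hM0] at hnMJ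
    have : 3 * M J ≤ nObs J := by exact_mod_cast hnMJ
    omega
  have hMm : (M J : ℝ) ≤ (2 * M J + 1 : ℕ) := by push_cast; linarith
  have hm0 : (0 : ℝ) < (2 * M J + 1 : ℕ) := by positivity
  have hsm0 : 0 < √((2 * M J + 1 : ℕ) : ℝ) := Real.sqrt_pos.2 hm0
  have hT : τ * δ * nObs J * b ^ 2 = τ * (y * √(nObs J : ℝ)) * ℓ ^ 2 := by
    have : y * √(nObs J : ℝ) * ℓ ^ 2 = δ * b ^ 2 * √(nObs J : ℝ) ^ 2 := by
      rw [hy]; field_simp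
    rw [hsn] at this
    linear_combination -τ * this
  have hκy : 0 < κ * y := lt_of_lt_of_le (by positivity) hMy
  have hy0 : 0 < y := pos_of_mul_pos_right hκy hκ.le
  have haℓ : 1 ≤ a * ℓ := by rw [div_le_iff₀ ha] at hl1; linarith
  have hTn : 40 * (v + 1) * nObs J / √(2 * M J + 1 : ℕ) ≤ τ * (y * √(nObs J : ℝ)) * ℓ ^ 2 := by
    rw [div_le_iff₀ hτ] at hlC
    calc 40 * (v + 1) * nObs J / √(2 * M J + 1 : ℕ) ≤ 40 * (v + 1) * nObs J / √(M J : ℝ) := by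
          gcongr
      _ = 40 * (v + 1) * √(nObs J : ℝ) ^ 2 / √(M J : ℝ) := by rw [hsn]
      _ = 40 * (v + 1) * √(nObs J : ℝ) * (√(nObs J : ℝ) / √(M J : ℝ)) := by ring
      _ ≤ 40 * (v + 1) * √(nObs J : ℝ) * (κ * y) := by gcongr
      _ = 40 * κ * (v + 1) * (y * √(nObs J : ℝ)) := by ring
      _ ≤ ℓ ^ 2 * τ * (y * √(nObs J : ℝ)) := by gcongr
      _ = _ := by ring
  rw [hT]
  refine (hζ.measureReal_sum_abs_windowMean_ge_le hm
    (s := max 1 (2 * (a * ℓ) / √(2 * M J + 1 : ℕ))) (le_max_left _ _)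
    ((div_le_iff₀ hsm0).1 (le_max_right _ _)) he hξ hTn).trans ?_
  refine mul_le_mul_of_nonneg_left ?_ hm0.le
  -- Because aℓ ≥ 1, the envelope 1 + (aℓ)² + 4aℓ is at most 6(aℓ)². Its ℓ² cancels the ℓ² of the
  -- threshold and leaves a constant multiple of y.
  have hy' : τ / (12 * a ^ 2) * y ≤ τ * (y * √(nObs J : ℝ)) * ℓ ^ 2 /
      (2 * (1 + (a * ℓ) ^ 2 + 2 * (2 * (a * ℓ))) * √(nObs J : ℝ)) := by
    have h1 : 1 + (a * ℓ) ^ 2 + 2 * (2 * (a * ℓ)) ≤ 6 * (a * ℓ) ^ 2 := by nlinarith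
    calc τ / (12 * a ^ 2) * y = τ * (y * √(nObs J : ℝ)) * ℓ ^ 2 /
          (2 * (6 * (a * ℓ) ^ 2) * √(nObs J : ℝ)) := by field_simp; norm_num
      _ ≤ _ := by gcongr
  have hcκ : τ / (12 * a ^ 2 * κ) * (κ * y) = τ / (12 * a ^ 2) * y := by field_simp
  refine hJ _ ρ z ?_ ?_ hz hzb hz1
  · refine le_trans ?_ hy'
    rw [← hcκ]; gcongr
  · refine le_trans ?_ hy'
    rw [← hcκ]; gcongr

/-- The kernel sums at the pre-fit stay bounded away from zero. -/
theorem exists_kernel_sum_tail_le.{u} {α : ℝ → ℝ} (hα : BoundedVariationOn α (Set.Icc 0 1))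
    {M : ℕ → ℕ} (hM : Tendsto M atTop atTop)
    (hnM : Tendsto (fun J => (nObs J : ℝ) / M J) atTop atTop) {bseq : ℕ → ℝ} {γ : ℝ} (hγ : 0 ≤ γ)
    (hbseq : bseq =o[atTop] fun J => ((nObs J : ℝ) / M J) ^ (1 / (6 + 4 * γ)))
    {a d v r₀ c₁ Kb L : ℝ} (ha : 0 < a) (hv : 0 ≤ v) (hr₀ : 0 < r₀) (hc₁ : 0 < c₁) (hKb : 0 < Kb)
    (hL : 0 < L) {K : ℝ → ℝ} (hK0 : ∀ z, 0 ≤ K z)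
    (hKs : ∀ z, z ∉ Set.Icc (-(1 / 2) : ℝ) (1 / 2) → K z = 0)
    (hKle : ∀ z, K z ≤ Kb) (hKL : ∀ z w, |K z - K w| ≤ L * |z - w|) (hKm : Measurable K) :
    ∃ θ : ℝ, 0 < θ ∧ ∃ b₀ : ℝ, 0 < b₀ ∧ ∃ A : ℝ, 0 < A ∧ ∀ᶠ J in atTop, ∀ (Ω : Type u)
      [MeasurableSpace Ω] (μ : Measure Ω) (ζ : ℕ → Ω → ℝ),
      IsCentredNoise μ ζ (2 * (a * Real.log (nObs J) ^ d)) v →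
      ∀ (e : ℕ → ℝ) (b u ρ z : ℝ), 0 < b → b ≤ b₀ →
      (∀ t ∈ Finset.Icc 1 (nObs J), |e t| ≤ r₀ / nObs J) →
      nObs J * b * c₁ ≤ ∑ t ∈ Finset.Icc 1 (nObs J), K ((designValue α J t - u) / b) →
      1 ≤ c₁ * b ^ 2 * √(M J : ℝ) → M J ≤ c₁ * (nObs J * b ^ 2) →
      ρ ≤ c₁ * √(nObs J : ℝ) * b ^ 2 → z ≤ A * ρ → z ≤ bseq J → 1 < z →
        μ.real {ω | ∑ t ∈ Finset.Icc 1 (nObs J),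
          K ((windowMean (nObs J) (M J) (fun p => designValue α J p + e p) t +
            windowMean (nObs J) (M J) (fun p => ζ p ω) t - u) / b) ≤ 2 * θ * (nObs J * b)} ≤
          (2 * M J + 1 : ℕ) * (Real.exp (-z ^ 2) + ((nObs J : ℝ) ^ 3)⁻¹) := by
  -- The radius 1/(8L) is matched to 1 ≤ c₁b²√M, which makes the tolerated noise b²(c₁/2)/(4L),
  -- times √(2M+1), at least this large.
  obtain ⟨p₀, hp₀, m₀, hm₀, hball⟩ := exists_small_ball_le.{u} v (1 / (8 * L)) hv (by positivity)
  obtain ⟨b₀, hb₀, J₀, hclamp⟩ := exists_dyadicVariation_clampAt_le hα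
    (by positivity : 0 < 1 / (16 * (L + 2 * Kb)))
  have hc0 : 0 < p₀ / (16 * L) := by positivity
  obtain ⟨A, hA, h⟩ := exists_window_exp_le hM hnM hγ hbseq (d := d) ha
    (by positivity : 0 < 512 * Real.exp (v + 2 * Real.exp v)) hc0
  refine ⟨p₀ * c₁ / 32, by positivity, min b₀ (1 / (16 * Kb)), by positivity, A, hA, ?_⟩
  filter_upwards [h, eventually_ge_atTop J₀, hM.eventually_ge_atTop 1, hM.eventually_ge_atTop m₀,
    hM.eventually_ge_atTop ⌈8 * L * r₀⌉₊, hnM.eventually_ge_atTop 3]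
    with J hJ hJ₀ hMJ hMm₀ hMr hnMJ
  intro Ω _ μ ζ hζ e b u ρ z hb hbb he hu hbM hMb hρ hz hzb hz1
  have hn := nObs_cast_pos J
  have hM0 : (0 : ℝ) < M J := by exact_mod_cast hMJ
  have hsn0 : 0 < √(nObs J : ℝ) := Real.sqrt_pos.2 hn
  have hsM0 : 0 < √(M J : ℝ) := Real.sqrt_pos.2 hM0
  have hm : 2 * M J + 1 ≤ nObs J := by
    rw [le_div_iff₀ hM0] at hnMJ
    have : 3 * M J ≤ nObs J := by exact_mod_cast hnMJ
    omega
  have hMm : (M J : ℝ) ≤ (2 * M J + 1 : ℕ) := by push_cast; linarith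
  have hm0 : (0 : ℝ) < (2 * M J + 1 : ℕ) := by positivity
  have hsm0 : 0 < √((2 * M J + 1 : ℕ) : ℝ) := Real.sqrt_pos.2 hm0
  have hMr' : 8 * L * r₀ ≤ c₁ * (nObs J * b ^ 2) := (Nat.ceil_le.1 hMr).trans hMb
  have hb1 : b ≤ 1 / (16 * Kb) := hbb.trans (min_le_right _ _)
  -- Truncation mean, band variation and boundary each cost at most an eighth of nbc₁, through M ≥
  -- 8Lr₀, the choice of the band, and b ≤ 1/(16 Kb). So more than half survives.
  have hmean : nObs J * b * (c₁ / 2) ≤ ∑ t ∈ Finset.Icc 1 (nObs J),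
      K ((windowMean (nObs J) (M J) (fun p => designValue α J p + e p) t - u) / b) := by
    have h1 := sum_kernel_windowMean_ge (M := M J) (u := u) (g := designValue α J) hK0 hKs hKle hKL hL.le hb
      (by positivity : 0 ≤ r₀ / nObs J) he
    have h2 : ∑ i ∈ Finset.range (nObs J),
        |clampAt u b (designValue α J (i + 1)) - clampAt u b (designValue α J i)| ≤
          1 / (16 * (L + 2 * Kb)) := by
      have := hclamp J hJ₀ u b hb.le (hbb.trans (min_le_left _ _))
      simpa only [dyadicVariation, designValue] using this
    have e1 : L * (r₀ / nObs J) / b * nObs J ≤ nObs J * b * c₁ / 8 := by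
      rw [show L * (r₀ / nObs J) / b * nObs J = L * r₀ / b by field_simp, div_le_iff₀ hb]
      linarith
    have e2 : (L + 2 * Kb) / b * (2 * M J * ∑ i ∈ Finset.range (nObs J),
        |clampAt u b (designValue α J (i + 1)) - clampAt u b (designValue α J i)|) ≤
          nObs J * b * c₁ / 8 := by
      calc _ ≤ (L + 2 * Kb) / b * (2 * (c₁ * (nObs J * b ^ 2)) * (1 / (16 * (L + 2 * Kb)))) := by
            gcongr
        _ = _ := by field_simp; norm_num
    have e3 : 2 * M J * Kb ≤ nObs J * b * c₁ / 8 := by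
      rw [le_div_iff₀ (by positivity)] at hb1
      calc 2 * M J * Kb ≤ 2 * (c₁ * (nObs J * b ^ 2)) * Kb := by gcongr
        _ = nObs J * b * c₁ / 8 * (b * (16 * Kb)) := by ring
        _ ≤ nObs J * b * c₁ / 8 * 1 := by gcongr
        _ = _ := mul_one _
    have : 0 ≤ nObs J * b * c₁ := by positivity
    linarith
  have hs₀ : 1 / (8 * L) ≤ b ^ 2 * (c₁ / 2) / (4 * L) * √(2 * M J + 1 : ℕ) := by
    calc 1 / (8 * L) ≤ c₁ * b ^ 2 * √(M J : ℝ) / (8 * L) := by gcongr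
      _ ≤ c₁ * b ^ 2 * √(2 * M J + 1 : ℕ) / (8 * L) := by gcongr
      _ = _ := by field_simp; norm_num
  have hθ : 2 * (p₀ * c₁ / 32) * (nObs J * b) = p₀ * (nObs J * b * (c₁ / 2)) / 8 := by ring
  rw [hθ]
  refine (hζ.measureReal_sum_kernel_le hm
    (s := max 1 (2 * (a * Real.log (nObs J) ^ d) / √(2 * M J + 1 : ℕ))) (le_max_left _ _)
    ((div_le_iff₀ hsm0).1 (le_max_right _ _)) hK0 hKm hKL hL hb (by positivity) hp₀ hmean
    (fun t => hball Ω μ ζ _ hζ _ (by omega) _ (card_window_le _ _ _)) hs₀).trans ?_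
  refine mul_le_mul_of_nonneg_left ?_ hm0.le
  have hy : p₀ / (16 * L) * (c₁ * √(nObs J : ℝ) * b ^ 2) =
      p₀ * (c₁ / 2) * √(nObs J : ℝ) * b ^ 2 / (8 * L) := by ring
  refine hJ _ ρ z ?_ ?_ hz hzb hz1
  · rw [← hy]; gcongr
  · rw [← hy]
    gcongr
    rw [div_le_iff₀ hsM0]
    calc √(nObs J : ℝ) = √(nObs J : ℝ) * 1 := (mul_one _).symm
      _ ≤ √(nObs J : ℝ) * (c₁ * b ^ 2 * √(M J : ℝ)) := by gcongr
      _ = _ := by ring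

/-! ### Constants of the model, consequences of the rate conditions, assembly -/

theorem designValue_mem_range (α : ℝ → ℝ) {J t : ℕ} (ht : t ∈ Finset.Icc 1 (nObs J)) :
    designValue α J t ∈ α '' Set.Icc 0 1 := by
  have hn := nObs_cast_pos J
  refine ⟨(t : ℝ) / nObs J, ⟨by positivity, ?_⟩, rfl⟩
  rw [div_le_one hn]
  exact_mod_cast (Finset.mem_Icc.1 ht).2

/-- The real infimum of a set unbounded below is 0 by convention, so a positive infimum is a genuine
one. -/
theorem bddBelow_of_sInf_pos {s : Set ℝ} (h : 0 < sInf s) : BddBelow s := by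
  by_contra hs
  rw [Real.sInf_of_not_bddBelow hs] at h
  exact lt_irrefl _ h

theorem IsMeanFunction.mem_Icc {α : ℝ → ℝ} (h : IsMeanFunction α) {x : ℝ}
    (hx : x ∈ α '' Set.Icc 0 1) : x ∈ Set.Icc (lowerValue α) (upperValue α) :=
  ⟨csInf_le (bddBelow_of_sInf_pos h.lower_pos) hx, le_csSup h.bddAbove hx⟩

theorem IsMeanFunction.abs_le {α : ℝ → ℝ} (h : IsMeanFunction α) {x : ℝ}
    (hx : x ∈ α '' Set.Icc 0 1) : |x| ≤ upperValue α := by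
  rw [abs_of_pos (h.lower_pos.trans_le (h.mem_Icc hx).1)]
  exact (h.mem_Icc hx).2

theorem IsVarianceFunction.exists_bound {α h : ℝ → ℝ} (hα : IsMeanFunction α)
    (hh : IsVarianceFunction α h) :
    ∃ hb : ℝ, 0 < hb ∧ ∀ x ∈ α '' Set.Icc 0 1, 0 ≤ h x ∧ h x ≤ hb := by
  have h1 : ∀ x ∈ α '' Set.Icc 0 1, 0 < h x ∧
      h x ≤ sSup (h '' Set.Icc (lowerValue α) (upperValue α)) := fun x hx => by
    have hm : h x ∈ h '' Set.Icc (lowerValue α) (upperValue α) := ⟨x, hα.mem_Icc hx, rfl⟩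
    exact ⟨hh.lower_pos.trans_le (csInf_le (bddBelow_of_sInf_pos hh.lower_pos) hm),
      le_csSup hh.bddAbove hm⟩
  have h0 : α 0 ∈ α '' Set.Icc 0 1 := ⟨0, by simp, rfl⟩
  exact ⟨_, (h1 _ h0).1.trans_le (h1 _ h0).2, fun x hx => ⟨(h1 x hx).1.le, (h1 x hx).2⟩⟩

/-- The noise of the regression model, its moments and its tails. -/
theorem IsRegressionModel.exists_isNoiseFamily {α h : ℝ → ℝ} (hα : IsMeanFunction α)
    (hh : IsVarianceFunction α h) {Ω : ℕ → Type*} [∀ J, MeasurableSpace (Ω J)]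
    {P : ∀ J, Measure (Ω J)} [∀ J, IsProbabilityMeasure (P J)] {X : ∀ J, ℕ → Ω J → ℝ}
    (hX : IsRegressionModel α h P X) {γ : ℝ} (hmom : MomentCondition α h P X γ) {a d : ℝ}
    (ha : 0 < a)
    (htail : (fun J => 1 - (P J).real {ω | ∀ t ∈ Finset.Icc 1 (nObs J),
      |noise α X J t ω| ≤ a * Real.log (nObs J) ^ d}) =O[atTop] fun J => ((nObs J : ℝ) ^ 2)⁻¹) :
    ∃ v τ : ℝ, 0 < v ∧ 0 < τ ∧ ∀ᶠ J in atTop,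
      IsNoiseFamily (P J) (Finset.Icc 1 (nObs J)) (noise α X J) (a * Real.log (nObs J) ^ d) v
        (τ * ((nObs J : ℝ) ^ 2)⁻¹) ∧
      (P J).real {ω | ¬ ∀ t ∈ Finset.Icc 1 (nObs J), |noise α X J t ω| ≤
        a * Real.log (nObs J) ^ d} ≤ τ * ((nObs J : ℝ) ^ 2)⁻¹ ∧
      ∀ t ∈ Finset.Icc 1 (nObs J), ∫ ω, noise α X J t ω ^ 2 ∂P J = h (designValue α J t) := by
  obtain ⟨hb, hb0, hhb⟩ := hh.exists_bound hα
  obtain ⟨κ₀, hκ₀, hmom⟩ := hmom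
  obtain ⟨τ, hτ, htail⟩ := htail.exists_pos
  have hmeas : ∀ J, ∀ t ∈ Finset.Icc 1 (nObs J), Measurable (noise α X J t) := fun J t ht =>
    (hX.measurable J t ht).sub_const _
  have hmem : ∀ J, ∀ t ∈ Finset.Icc 1 (nObs J), MemLp (noise α X J t) 2 (P J) := fun J t ht =>
    (hX.memLp_two J t ht).sub (memLp_const _)
  have hsq : ∀ J, ∀ t ∈ Finset.Icc 1 (nObs J),
      ∫ ω, noise α X J t ω ^ 2 ∂P J = h (designValue α J t) := fun J t ht => by
    rw [← hX.variance J t ht, variance_eq_integral (hX.measurable J t ht).aemeasurable,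
      hX.mean J t ht]
    rfl
  -- One constant for both moments: the variance is at most `hb`, and the moment condition with l =
  -- 4 gives the other summand, 24 being 4!.
  refine ⟨hb + (24 : ℝ) ^ (1 + γ) * κ₀ ^ 2 * hb, τ, by positivity, hτ, ?_⟩
  filter_upwards [htail.bound, tendsto_log_nObs.eventually_gt_atTop 0] with J hJ hl
  have hn := nObs_cast_pos J
  have hgood : MeasurableSet {ω | ∀ t ∈ Finset.Icc 1 (nObs J), |noise α X J t ω| ≤
      a * Real.log (nObs J) ^ d} := by
    simp only [Set.ofPred_forall]
    exact Finset.measurableSet_biInter _ fun t ht =>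
      measurableSet_le (hmeas J t ht).abs measurable_const
  have hbad : (P J).real {ω | ¬ ∀ t ∈ Finset.Icc 1 (nObs J), |noise α X J t ω| ≤
      a * Real.log (nObs J) ^ d} ≤ τ * ((nObs J : ℝ) ^ 2)⁻¹ := by
    have h1 : {ω | ¬ ∀ t ∈ Finset.Icc 1 (nObs J), |noise α X J t ω| ≤
      a * Real.log (nObs J) ^ d} = {ω | ∀ t ∈ Finset.Icc 1 (nObs J), |noise α X J t ω| ≤
      a * Real.log (nObs J) ^ d}ᶜ := rfl
    rw [h1, probReal_compl_eq_one_sub hgood]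
    refine (le_abs_self _).trans (hJ.trans_eq ?_)
    rw [Real.norm_of_nonneg (by positivity)]
  have hfour : ∀ t ∈ Finset.Icc 1 (nObs J), ∀ ω, |noise α X J t ω| ^ 4 = noise α X J t ω ^ 4 :=
    fun t _ ω => (Even.pow_abs ⟨2, rfl⟩ _)
  refine ⟨⟨hmeas J, ?_, by positivity, by positivity, fun t ht => (hmem J t ht).integrable
    one_le_two, ?_, fun t ht => (hmem J t ht).integrable_sq, ?_, ?_, ?_, ?_⟩, hbad, hsq J⟩
  · exact (hX.indep J).comp (fun t x => x - designValue α J t) fun t => by fun_prop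
  · intro t ht
    simp only [noise]
    rw [integral_sub ((hX.memLp_two J t ht).integrable one_le_two) (integrable_const _),
      hX.mean J t ht]
    simp
  · intro t ht
    rw [hsq J t ht]
    have := (hhb _ (designValue_mem_range α ht)).2
    have : 0 ≤ (24 : ℝ) ^ (1 + γ) * κ₀ ^ 2 * hb := by positivity
    linarith
  · intro t ht
    have := (hmom J t ht 4 (by norm_num)).1
    simpa only [hfour t ht] using this
  · intro t ht
    have h1 := (hmom J t ht 4 (by norm_num)).2
    simp only [hfour t ht] at h1
    have h2 := (hhb _ (designValue_mem_range α ht)).2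
    have h3 : ((Nat.factorial 4 : ℕ) : ℝ) = 24 := by norm_num [Nat.factorial]
    rw [h3] at h1
    calc _ ≤ _ := h1
      _ ≤ (24 : ℝ) ^ (1 + γ) * κ₀ ^ 2 * hb := by norm_num; gcongr
      _ ≤ _ := by linarith
  · intro t ht
    refine (measureReal_mono fun ω hω => ?_).trans hbad
    simp only [Set.mem_ofPred_eq] at hω ⊢
    exact fun hcon => hω (hcon t ht)

/-- A nonnegative rate means that the leading term dominates each subtracted term. Here c₁ stays in
front, so the ratios are bounded but not small. -/
theorem rateA_consequences {J M : ℕ} {b δ₁ c₁ : ℝ} (h : 0 ≤ rateA J M b δ₁) (hδ : δ₁ ≤ c₁)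
    (hM : 1 ≤ M) : 1 ≤ c₁ * b ^ 2 * √(M : ℝ) ∧ M ≤ c₁ * (nObs J * b ^ 2) ∧
      rateA J M b δ₁ ≤ c₁ * √(nObs J : ℝ) * b ^ 2 := by
  have hn := nObs_cast_pos J
  have hM0 : (0 : ℝ) < M := by exact_mod_cast hM
  have hsn0 : 0 < √(nObs J : ℝ) := Real.sqrt_pos.2 hn
  have hsM0 : 0 < √(M : ℝ) := Real.sqrt_pos.2 hM0
  have hsn : √(nObs J : ℝ) * √(nObs J : ℝ) = nObs J := Real.mul_self_sqrt hn.le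
  have h1 : 0 ≤ (M : ℝ) / √(nObs J : ℝ) := by positivity
  have h2 : 0 ≤ √(nObs J : ℝ) / √(M : ℝ) := by positivity
  have h3 : δ₁ * √(nObs J : ℝ) * b ^ 2 ≤ c₁ * √(nObs J : ℝ) * b ^ 2 := by gcongr
  unfold rateA at h ⊢
  refine ⟨?_, ?_, by linarith⟩
  · have : √(nObs J : ℝ) / √(M : ℝ) ≤ c₁ * √(nObs J : ℝ) * b ^ 2 := by linarith
    rw [div_le_iff₀ hsM0] at this
    refine le_of_mul_le_mul_left ?_ hsn0
    linarith
  · have : (M : ℝ) / √(nObs J : ℝ) ≤ c₁ * √(nObs J : ℝ) * b ^ 2 := by linarith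
    rw [div_le_iff₀ hsn0] at this
    refine this.trans_eq ?_
    linear_combination c₁ * b ^ 2 * hsn

/-- As for the first rate, after δ(c₁ - δ₁)/2 ≤ δc₁/2. -/
theorem rateE_consequences {J M : ℕ} {b d δ δ₁ c₁ : ℝ}
    (h : 0 ≤ rateE d J M b (δ * (c₁ - δ₁) / 2)) (hδ₁ : 0 ≤ δ₁) (hδ : 0 ≤ δ) :
    M / √(nObs J : ℝ) ≤
      c₁ / 2 * (δ * √(nObs J : ℝ) * b ^ 2 * Real.log (nObs J) ^ (-2 * d)) ∧
    √(nObs J : ℝ) / √(M : ℝ) ≤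
      c₁ / 2 * (δ * √(nObs J : ℝ) * b ^ 2 * Real.log (nObs J) ^ (-2 * d)) ∧
    rateE d J M b (δ * (c₁ - δ₁) / 2) ≤
      c₁ / 2 * (δ * √(nObs J : ℝ) * b ^ 2 * Real.log (nObs J) ^ (-2 * d)) := by
  have h1 : 0 ≤ (M : ℝ) / √(nObs J : ℝ) := by positivity
  have h2 : 0 ≤ √(nObs J : ℝ) / √(M : ℝ) := by positivity
  have h3 : 0 ≤ δ₁ * (δ * √(nObs J : ℝ) * b ^ 2 * Real.log (nObs J) ^ (-2 * d)) := by positivity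
  unfold rateE at h ⊢
  refine ⟨?_, ?_, ?_⟩ <;> linarith

theorem minScalePow_le {ε : ℝ} {J j : ℕ} (hj : j ∈ coarseScales ε J) (s : ℝ) :
    minScalePow ε J s ≤ (2 : ℝ) ^ (s * (J - j)) :=
  csInf_le ⟨0, by rintro _ ⟨i, _, rfl⟩; positivity⟩ ⟨j, hj, rfl⟩

theorem measureReal_le_of_alternatives {Ω : Type*} [MeasurableSpace Ω] {μ : Measure Ω}
    [IsFiniteMeasure μ] {s s₀ s₁ s₂ s₃ s₄ s₅ s₆ : Set Ω}
    (h : s ⊆ s₀ ∪ (s₁ ∪ (s₂ ∪ (s₃ ∪ (s₄ ∪ (s₅ ∪ s₆)))))) :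
    μ.real s ≤ μ.real s₀ + (μ.real s₁ + (μ.real s₂ + (μ.real s₃ +
      (μ.real s₄ + (μ.real s₅ + μ.real s₆))))) := by
  refine (measureReal_mono h).trans ((measureReal_union_le _ _).trans (add_le_add_right ?_ _))
  refine (measureReal_union_le _ _).trans (add_le_add_right ?_ _)
  refine (measureReal_union_le _ _).trans (add_le_add_right ?_ _)
  refine (measureReal_union_le _ _).trans (add_le_add_right ?_ _)
  refine (measureReal_union_le _ _).trans (add_le_add_right ?_ _)
  exact measureReal_union_le _ _

/-- The union bound over the alternatives for a deviation of the variance estimator. -/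
theorem measureReal_deviation_le {Ω : Type*} [MeasurableSpace Ω] {μ : Measure Ω}
    [IsFiniteMeasure μ] {K h : ℝ → ℝ} {J M : ℕ} {b B Cb Kb L H hb r θ δ Q u : ℝ} {k g e : ℕ → ℝ}
    {X ζ : ℕ → Ω → ℝ}
    (hK0 : ∀ z, 0 ≤ K z) (hKs : ∀ z, z ∉ Set.Icc (-(1 / 2) : ℝ) (1 / 2) → K z = 0)
    (hKb : ∀ z, K z ≤ Kb) (hKb0 : 0 < Kb) (hKL : ∀ z w, |K z - K w| ≤ L * |z - w|) (hL : 0 < L)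
    (hb0 : 0 < b) (hb1 : b ≤ 1) (hH : 0 ≤ H) (hbδ : b * H ≤ δ)
    (hu : ∑ q ∈ Finset.Icc 1 (nObs J), k q * g q = u)
    (hh : ∀ t ∈ Finset.Icc 1 (nObs J), |h (g t) - h u| ≤ H * |g t - u|)
    (hhb : ∀ t ∈ Finset.Icc 1 (nObs J), |h (g t)| ≤ hb) (hhb0 : 0 ≤ hb) (hθ : 0 < θ)
    (hk : ∀ q ∈ Finset.Icc 1 (nObs J), 0 ≤ k q) (hk1 : ∑ q ∈ Finset.Icc 1 (nObs J), k q = 1)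
    (hX : ∀ t ∈ Finset.Icc 1 (nObs J), ∀ ω, |X t ω - g t| ≤ B → X t ω - g t = ζ t ω + e t)
    (he : ∀ t ∈ Finset.Icc 1 (nObs J), |e t| ≤ r)
    (hζ : ∀ t ∈ Finset.Icc 1 (nObs J), ∀ ω, |ζ t ω + e t| ≤ B)
    (hβ : ∀ t ∈ Finset.Icc 1 (nObs J), |windowMean (nObs J) M (fun p => g p + e p) t - g t| ≤ Cb)
    (hQ : Kb + L * (1 + hb) + Kb * H = Q)
    (hr : r ≤ θ * b ^ 2 / (2 * L)) (hr' : r ≤ θ * δ * b ^ 2 / (24 * Q * (1 + B ^ 2))) :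
    μ.real {ω | δ ≤ |varianceEstimator K J M b (fun q => X q ω)
        (∑ q ∈ Finset.Icc 1 (nObs J), k q * X q ω) - h u|} ≤
      μ.real {ω | ¬ ∀ t ∈ Finset.Icc 1 (nObs J), |X t ω - g t| ≤ B} +
      (μ.real {ω | ∑ t ∈ Finset.Icc 1 (nObs J), K ((windowMean (nObs J) M (fun p => g p + e p) t +
        windowMean (nObs J) M (fun p => ζ p ω) t - u) / b) ≤ 2 * θ * (nObs J * b)} +
      (μ.real {ω | θ * b ^ 2 / (2 * L) ≤ |∑ q ∈ Finset.Icc 1 (nObs J), k q * ζ q ω|} +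
      (μ.real {ω | θ * δ * b ^ 2 / (24 * Q * (1 + B ^ 2)) ≤
        |∑ q ∈ Finset.Icc 1 (nObs J), k q * ζ q ω|} +
      (μ.real {ω | θ / (12 * Q) * δ * nObs J * b ^ 2 ≤ ∑ t ∈ Finset.Icc 1 (nObs J),
        |windowMean (nObs J) M (fun p => ζ p ω) t| *
          (1 + (ζ t ω + e t) ^ 2 + 2 * |windowMean (nObs J) M (fun p => ζ p ω) t|)} +
      (μ.real {ω | θ / (12 * Q) * δ * nObs J * b ^ 2 ≤ ∑ t ∈ Finset.Icc 1 (nObs J),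
        |windowMean (nObs J) M (fun p => g p + e p) t - g t| *
          (1 + 2 * Cb + (ζ t ω + e t) ^ 2)} +
      μ.real {ω | θ * (δ - b * H) / 2 ≤ |∑ t ∈ Finset.Icc 1 (nObs J),
        kernelWeight K J b (g t) u * ((ζ t ω + e t) ^ 2 - h (g t))|}))))) := by
  refine measureReal_le_of_alternatives fun ω hω => ?_
  rw [Set.mem_union, or_iff_not_imp_left]
  intro hgood
  have hgood' : ∀ t ∈ Finset.Icc 1 (nObs J), |X t ω - g t| ≤ B := not_not.1 hgood
  subst hu hQ
  have e1 : θ / (12 * (Kb + L * (1 + hb) + Kb * H)) * δ * nObs J * b ^ 2 =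
      θ * δ * nObs J * b ^ 2 / (12 * (Kb + L * (1 + hb) + Kb * H)) := by ring
  rw [e1]
  exact deviation_alternatives (ζ := fun t => ζ t ω) (e := e) hK0 hKs hKb hKb0 hKL hL hb0 hb1 hH hbδ
    hh hhb hhb0 hθ hk hk1
    (fun t ht => by linear_combination hX t ht ω (hgood' t ht))
    he (fun t ht => hζ t ht ω) hβ hr hr' hω

/-- Decomposition of truncated noise into centred noise and a small mean. -/
theorem IsNoiseFamily.exists_centred {Ω : Type*} [MeasurableSpace Ω] {μ : Measure Ω}
    {S : Finset ℕ} {ε : ℕ → Ω → ℝ} {B v T n : ℝ} (hn : 0 < n)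
    (h : IsNoiseFamily μ S ε B v (T * (n ^ 2)⁻¹)) :
    ∃ (e : ℕ → ℝ) (ζ : ℕ → Ω → ℝ), IsCentredNoise μ ζ (2 * B) (16 * v) ∧
      (∀ t ∈ S, |e t| ≤ (v + T) / n) ∧ (∀ t ∈ S, ∀ ω, |ζ t ω + e t| ≤ B) ∧
      (∀ t ∈ S, |∫ ω, (ζ t ω + e t) ^ 2 ∂μ - ∫ ω, ε t ω ^ 2 ∂μ| ≤ (v + T) / n) ∧
      ∀ t ∈ S, ∀ ω, |ε t ω| ≤ B → ε t ω = ζ t ω + e t := by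
  have hζe : ∀ t ω, truncNoise S B ε t ω - ∫ ω', truncNoise S B ε t ω' ∂μ +
      ∫ ω', truncNoise S B ε t ω' ∂μ = truncNoise S B ε t ω := fun t ω => sub_add_cancel _ _
  -- The choice l = 1/n balances lv against the tail T n⁻² divided by l.
  have hrn : 1 / n * v + T * (n ^ 2)⁻¹ / (1 / n) = (v + T) / n := by field_simp
  refine ⟨fun t => ∫ ω, truncNoise S B ε t ω ∂μ,
    fun t ω => truncNoise S B ε t ω - ∫ ω', truncNoise S B ε t ω' ∂μ, h.isCentredNoise,
    fun t ht => ?_, fun t _ ω => ?_, fun t ht => ?_, fun t ht ω hω => ?_⟩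
  · rw [← hrn]; exact h.abs_integral_truncNoise_le ht (by positivity)
  · rw [hζe]; exact h.abs_truncNoise_le t ω
  · simp only [hζe]
    rw [abs_sub_comm, ← hrn]
    exact h.integral_sub_truncNoise_le ht 2 (h.integrable_sq t ht) (h.integrable_fourth t ht)
      (h.fourth t ht) two_ne_zero (by positivity)
  · rw [hζe, truncNoise, if_pos ht, truncAt, if_pos hω]

/-- The bias of the pre-fit, pointwise and in total. -/
theorem IsMeanFunction.prefit_bias_le {α : ℝ → ℝ} (hα : IsMeanFunction α) {J M : ℕ} {e : ℕ → ℝ}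
    {r : ℝ} (hr : 0 ≤ r) (hM : 1 ≤ M) (he : ∀ t ∈ Finset.Icc 1 (nObs J), |e t| ≤ r / nObs J) :
    (∀ t ∈ Finset.Icc 1 (nObs J),
      |windowMean (nObs J) M (fun p => designValue α J p + e p) t - designValue α J t| ≤
        2 * upperValue α + r) ∧
    ∑ t ∈ Finset.Icc 1 (nObs J),
      |windowMean (nObs J) M (fun p => designValue α J p + e p) t - designValue α J t| ≤
        (2 * (eVariationOn α (Set.Icc 0 1)).toReal + r + 4 * upperValue α) * M := by
  have hn := nObs_cast_pos J
  have hgA : ∀ t ∈ Finset.Icc 1 (nObs J), |designValue α J t| ≤ upperValue α := fun t ht =>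
    hα.abs_le (designValue_mem_range α ht)
  have hsup : 0 ≤ upperValue α := (abs_nonneg _).trans (hgA 1 (Finset.mem_Icc.2 ⟨le_rfl, nObs_pos J⟩))
  constructor
  · intro t ht
    have h1 : |windowMean (nObs J) M (fun p => designValue α J p + e p) t| ≤ upperValue α + r :=
      abs_windowMean_le (by positivity) fun p hp => by
        have h2 : r / nObs J ≤ r := div_le_self hr (by exact_mod_cast nObs_pos J)
        exact (abs_add_le _ _).trans (add_le_add (hgA p hp) ((he p hp).trans h2))
    linarith [abs_sub (windowMean (nObs J) M (fun p => designValue α J p + e p) t)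
      (designValue α J t), hgA t ht]
  · have h1 := sum_abs_windowMean_sub_le (M := M) (by positivity : 0 ≤ r / (nObs J : ℝ))
      hgA he hsup
    have h2 : ∑ i ∈ Finset.range (nObs J), |designValue α J (i + 1) - designValue α J i| ≤
        (eVariationOn α (Set.Icc 0 1)).toReal := by
      have := dyadicVariation_le hα.boundedVariation J
      simpa only [dyadicVariation, designValue] using this
    have h3 : nObs J * (r / (nObs J : ℝ)) = r := by field_simp
    have h4 : r ≤ r * M := le_mul_of_one_le_right hr (by exact_mod_cast hM)
    have h5 := mul_le_mul_of_nonneg_left h2 (by positivity : 0 ≤ 2 * (M : ℝ))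
    linarith

/-- The mean of the truncated noise is negligible at the scale of the local means. -/
theorem bias_le_thresholds {n M b c₁ r θ L Q B δ a ℓ : ℝ} (hn : 0 < n) (hc₁ : 0 < c₁) (hθ : 0 < θ)
    (hL : 0 < L) (hQ : 0 < Q) (ha : 0 < a) (hℓ : 0 < ℓ) (hδ : 0 ≤ δ) (hB : B = a * ℓ) (hB1 : 1 ≤ B)
    (hMr : 2 * L * r * c₁ / θ ≤ M) (hMr' : 24 * c₁ * Q * a ^ 2 * r / θ ≤ M)
    (hA : M ≤ c₁ * (n * b ^ 2)) (hE : M / √n ≤ c₁ / 2 * (δ * √n * b ^ 2 * (ℓ ^ 2)⁻¹)) :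
    r / n ≤ θ * b ^ 2 / (2 * L) ∧
      θ * δ * b ^ 2 / (48 * Q * B ^ 2) ≤ θ * δ * b ^ 2 / (24 * Q * (1 + B ^ 2)) ∧
      r / n ≤ θ * δ * b ^ 2 / (24 * Q * (1 + B ^ 2)) := by
  have hB0 : 0 < B := by positivity
  have hxge : θ * δ * b ^ 2 / (48 * Q * B ^ 2) ≤ θ * δ * b ^ 2 / (24 * Q * (1 + B ^ 2)) := by
    have hBs : 1 + B ^ 2 ≤ 2 * B ^ 2 := by nlinarith
    have := mul_le_mul_of_nonneg_left hBs (by positivity : 0 ≤ 24 * Q)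
    exact div_le_div_of_nonneg_left (by positivity) (by positivity) (by linarith)
  refine ⟨?_, hxge, le_trans ?_ hxge⟩
  -- M ≤ c₁nb² bounds 1/n by c₁b²/M, and M exceeds the required constant.
  · rw [div_le_iff₀ hθ] at hMr
    have h2 : 2 * L * r * c₁ ≤ c₁ * (n * b ^ 2) * θ := hMr.trans (by gcongr)
    rw [div_le_div_iff₀ hn (by positivity)]
    refine le_of_mul_le_mul_left ?_ hc₁
    linarith
  · rw [div_le_iff₀ hθ] at hMr'
    have hsn0 : 0 < √n := Real.sqrt_pos.2 hn
    have hsn : √n * √n = n := Real.mul_self_sqrt hn.le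
    rw [div_le_iff₀ hsn0] at hE
    have h2 : M * θ ≤ c₁ / 2 * (δ * n * b ^ 2 * (ℓ ^ 2)⁻¹) * θ := by
      gcongr
      refine hE.trans_eq ?_
      linear_combination c₁ / 2 * δ * b ^ 2 * (ℓ ^ 2)⁻¹ * hsn
    rw [div_le_div_iff₀ hn (by positivity), hB]
    have h3 := mul_le_mul_of_nonneg_right (hMr'.trans h2) (by positivity : 0 ≤ 2 / c₁ * ℓ ^ 2)
    have h4 : c₁ / 2 * (δ * n * b ^ 2 * (ℓ ^ 2)⁻¹) * θ * (2 / c₁ * ℓ ^ 2) =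
        θ * δ * b ^ 2 * n := by field_simp
    have h5 : 24 * c₁ * Q * a ^ 2 * r * (2 / c₁ * ℓ ^ 2) = r * (48 * Q * (a * ℓ) ^ 2) := by
      field_simp; ring
    linarith

theorem IsSmoothingKernel.exists_constants {K : ℝ → ℝ} (hK : IsSmoothingKernel K) :
    ∃ Kb L : ℝ, 0 < Kb ∧ 0 < L ∧ (∀ z, K z ≤ Kb) ∧ (∀ z w, |K z - K w| ≤ L * |z - w|) ∧
      Measurable K := by
  obtain ⟨k, hk⟩ := hK.bounded
  obtain ⟨l, hl⟩ := hK.lipschitz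
  refine ⟨max k 1, l + 1, by positivity, by positivity, fun z => (hk z).trans (le_max_left _ _),
    fun z w => ?_, hl.continuous.measurable⟩
  have := hl.dist_le_mul z w
  rw [Real.dist_eq, Real.dist_eq] at this
  linarith [abs_nonneg (z - w)]

theorem IsLocalMeanWeights.exists_bound {ε : ℝ} {κ : ℕ → ℕ → ℕ → ℕ → ℝ}
    (hκ : IsLocalMeanWeights ε κ) :
    ∃ C : ℝ, 0 < C ∧ (∀ J, ∀ p ∈ coarseIndices ε J, ∀ q ∈ Finset.Icc 1 (nObs J),
        κ J p.1 p.2 q ≤ C * (2 : ℝ) ^ ((p.1 : ℝ) - J)) ∧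
      ∀ J, ∀ p ∈ coarseIndices ε J,
        ∑ q ∈ Finset.Icc 1 (nObs J), κ J p.1 p.2 q ^ 2 ≤ C * (2 : ℝ) ^ ((p.1 : ℝ) - J) := by
  obtain ⟨k₁, hk₁⟩ := hκ.max_le
  obtain ⟨k₂, hk₂⟩ := hκ.sum_sq
  refine ⟨max (max k₁ k₂) 1, by positivity, fun J p hp q hq => (hk₁ J p hp q hq).trans ?_,
    fun J p hp => (hk₂ J p hp).trans ?_⟩
  · gcongr; exact (le_max_left _ _).trans (le_max_left _ _)
  · gcongr; exact (le_max_right _ _).trans (le_max_left _ _)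

theorem minScalePow_nonneg (ε : ℝ) (J : ℕ) (s : ℝ) : 0 ≤ minScalePow ε J s :=
  Real.sInf_nonneg (by rintro _ ⟨i, _, rfl⟩; positivity)

/-- Adding up the tail bounds of the alternatives. -/
theorem add_tail_bounds_le {C T m n q q' p p₀ p₁ p₂ p₃ p₄ p₅ p₆ ΦA ΦC ΦE ΦF ΦG ΦH : ℝ}
    (hC : 0 ≤ C) (hm : 1 ≤ m) (hmn : m ≤ n) (hq' : 0 ≤ q') (hq : n * q' ≤ q) (hE : ΦE ≤ 1)
    (hF : ΦF ≤ 1) (hG : ΦG ≤ 1)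
    (hp : p ≤ p₀ + (p₁ + (p₂ + (p₃ + (p₄ + (p₅ + p₆)))))) (h₀ : p₀ ≤ T * q)
    (h₁ : p₁ ≤ C * m * (1 - ΦA) + m * q') (h₂ : p₂ ≤ C * 2 * (1 - ΦC) + 2 * q)
    (h₃ : p₃ ≤ C * 2 * (1 - ΦF) + 2 * q) (h₄ : p₄ ≤ C * m * (1 - ΦE) + m * q')
    (h₅ : p₅ ≤ C * 1 * (1 - ΦE) + 1 * q) (h₆ : p₆ ≤ C * 2 * (1 - ΦH) + 2 * q) :
    p ≤ C * m * (4 - ΦA - 2 * ΦE - ΦG) + 2 * C * (3 - ΦC - 2 * ΦF) + 2 * C * (1 - ΦH) +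
      (T + 9) * q := by
  have e1 : m * q' ≤ n * q' := mul_le_mul_of_nonneg_right hmn hq'
  have e2 : C * 1 * (1 - ΦE) ≤ C * m * (1 - ΦE) :=
    mul_le_mul_of_nonneg_right (mul_le_mul_of_nonneg_left hm hC) (by linarith)
  have e3 : 0 ≤ C * m * (1 - ΦG) := mul_nonneg (by positivity) (by linarith)
  have e4 : 0 ≤ C * (1 - ΦF) := mul_nonneg hC (by linarith)
  linarith

theorem theorem2
    -- the model
    (α h : ℝ → ℝ) (hα : IsMeanFunction α) (hh : IsVarianceFunction α h)
    {Ω : ℕ → Type*} [∀ J, MeasurableSpace (Ω J)]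
    (P : ∀ J, Measure (Ω J)) [∀ J, IsProbabilityMeasure (P J)]
    (X : ∀ J, ℕ → Ω J → ℝ) (hX : IsRegressionModel α h P X)
    (γ : ℝ) (hγ : 0 ≤ γ) (hmom : MomentCondition α h P X γ)
    -- the range of scales, the weights of the local means, the kernel
    (ε : ℝ) (hε : ε ∈ Set.Ioc (0 : ℝ) (1 / 3))
    (κ : ℕ → ℕ → ℕ → ℕ → ℝ) (hκ : IsLocalMeanWeights ε κ)
    (K : ℝ → ℝ) (hK : IsSmoothingKernel K)
    -- the half-span of the pre-fit and the bandwidth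
    (M : ℕ → ℕ) (b : ℕ → ℝ)
    (hM : Tendsto M atTop atTop)
    (hnM : Tendsto (fun J => (nObs J : ℝ) / M J) atTop atTop)
    (hnb : Tendsto (fun J => (nObs J : ℝ) * b J) atTop atTop)
    (hb : Tendsto b atTop (𝓝 0))
    -- the squared noise is uniformly non-degenerate
    (hvar : ∃ c₀ : ℝ, 0 < c₀ ∧ ∀ J, ∀ t ∈ Finset.Icc 1 (nObs J),
      c₀ ≤ Var[fun ω => noise α X J t ω ^ 2; P J])
    -- the variance of the pre-fit is comparable to that of its absolute deviation
    (habs : ∃ C₂ : ℝ, 0 < C₂ ∧ ∀ᶠ J in atTop, ∀ t ∈ Finset.Icc 1 (nObs J),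
      Var[fun ω => movingAverage J (M J) (fun p => X J p ω) t; P J] ≤
        C₂ * Var[fun ω => |movingAverage J (M J) (fun p => X J p ω) t -
          ∫ ω', movingAverage J (M J) (fun p => X J p ω') t ∂P J|; P J])
    -- tails of the noise
    (a d : ℝ) (ha : 0 < a) (hd : 0 < d)
    (htail : (fun J => 1 - (P J).real {ω | ∀ t ∈ Finset.Icc 1 (nObs J),
        |noise α X J t ω| ≤ a * Real.log (nObs J) ^ d}) =O[atTop]
      fun J => ((nObs J : ℝ) ^ 2)⁻¹)
    -- lower bound on the sums of kernel weights
    (c : ℝ → ℝ) (c₁ : ℝ) (hc₁ : 0 < c₁)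
    (hc : ∀ u ∈ α '' Set.Icc 0 1, c₁ ≤ c u)
    (hW : ∀ᶠ J in atTop, ∀ u ∈ α '' Set.Icc 0 1,
      c u ≤ ∑ t ∈ Finset.Icc 1 (nObs J), kernelWeight K J (b J) (designValue α J t) u)
    -- local means of the mean function stay in its range
    (hrange : ∀ᶠ J in atTop, ∀ p ∈ coarseIndices ε J,
      localMean J (κ J) p.1 p.2 (designValue α J) ∈ α '' Set.Icc 0 1)
    -- the sequences `b_n`, `d_n`, `i_n`
    (bseq dseq iseq : ℕ → ℝ)
    (hbseq : bseq =o[atTop] fun J => ((nObs J : ℝ) / M J) ^ (1 / (6 + 4 * γ)))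
    (hdseq : dseq =o[atTop] fun J => minScalePow ε J (1 / (2 * (1 + max γ 1))))
    (hiseq : iseq =o[atTop] fun J => ((nObs J : ℝ) * b J ^ 2) ^ (1 / (10 + 12 * γ)))
    -- `δ`, `δ₁`, `δ' = δ (c₁ - δ₁) / 2`, and the rate conditions
    (δ δ₁ δ' : ℕ → ℝ) (hδ₁ : ∀ᶠ J in atTop, 0 < δ₁ J ∧ δ₁ J < c₁)
    (hδ' : ∀ J, δ' J = δ J * (c₁ - δ₁ J) / 2)
    (H : ℝ≥0) (hH : LipschitzOnWith H h (α '' Set.Icc 0 1))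
    (hrate₁ : Tendsto (fun J => rateA J (M J) (b J) (δ₁ J)) atTop atTop)
    (hrate₂ : Tendsto (fun J => rateE d J (M J) (b J) (δ' J)) atTop atTop)
    (hrate₃ : ∀ᶠ J in atTop, b J * H < δ J) :
    ∃ C₃ C₄ C₅ C₆ A₁ A₂ A₃ A₄ A₅ A₆ : ℝ,
      0 < C₃ ∧ 0 < C₄ ∧ 0 < C₅ ∧ 0 < C₆ ∧
      0 < A₁ ∧ 0 < A₂ ∧ 0 < A₃ ∧ 0 < A₄ ∧ 0 < A₅ ∧ 0 < A₆ ∧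
      ∀ᶠ J in atTop, ∀ p ∈ coarseIndices ε J,
        (P J).real {ω | δ J ≤
            |varianceEstimator K J (M J) (b J) (fun q => X J q ω)
                (localMean J (κ J) p.1 p.2 (fun q => X J q ω)) -
              h (localMean J (κ J) p.1 p.2 (designValue α J))|} ≤
          C₃ * (2 * (M J : ℝ) + 1) *
              (4 - stdNormalCDF (min (A₁ * rateA J (M J) (b J) (δ₁ J)) (bseq J))
                - 2 * stdNormalCDF (min (A₃ * rateE d J (M J) (b J) (δ' J)) (bseq J))
                - stdNormalCDF (min (A₅ * rateG d J (M J) (b J) (δ' J)) (bseq J))) +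
            C₄ * (3 - stdNormalCDF (min (A₂ * rateC ε J (b J) (δ₁ J)) (dseq J))
                - 2 * stdNormalCDF (min (A₄ * rateF ε d J (b J) (δ' J)) (dseq J))) +
            C₅ * (1 - stdNormalCDF (min (A₆ * rateH J (b J) H (δ J)) (iseq J))) +
            C₆ * ((nObs J : ℝ) ^ 2)⁻¹ := by
  -- constants of the model
  obtain ⟨v₀, T₀, hv₀, hT₀, hnoise⟩ := hX.exists_isNoiseFamily hα hh hmom ha htail
  obtain ⟨hb', hb'0, hhb⟩ := hh.exists_bound hα
  obtain ⟨Kb, L, hKb, hL, hKle, hKL, hKm⟩ := hK.exists_constants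
  obtain ⟨Cκ, hCκ, hκmax, hκsq⟩ := hκ.exists_bound
  have hsup : 0 < upperValue α := by
    have h0 : α 0 ∈ α '' Set.Icc 0 1 := ⟨0, by simp, rfl⟩
    exact hα.lower_pos.trans_le ((hα.mem_Icc h0).1.trans (hα.mem_Icc h0).2)
  set TV := (eVariationOn α (Set.Icc 0 1)).toReal with hTV
  have hTV0 : 0 ≤ TV := ENNReal.toReal_nonneg
  have hr₀ : 0 < v₀ + T₀ := by positivity
  have hv : 0 < 16 * v₀ := by positivity
  set Q := Kb + L * (1 + hb') + Kb * H with hQ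
  have hQ0 : 0 < Q := by positivity
  have hCb : 0 < 2 * upperValue α + (v₀ + T₀) := by positivity
  -- the tail bounds
  obtain ⟨θ, hθ, b₀, hb₀, A₁, hA₁, hED⟩ := exists_kernel_sum_tail_le hα.boundedVariation hM hnM hγ
    hbseq (d := d) ha hv.le hr₀ hc₁ hKb hL hK.nonneg hK.support hKle hKL hKm
  obtain ⟨A₂, hA₂, hEU⟩ := exists_localMean_tail_le (d := d) ha hv hCκ hε.1
    (by positivity : 0 < θ / (2 * L * c₁))
  obtain ⟨A₄, hA₄, hEU'⟩ := exists_localMean_tail_le (d := d) ha hv hCκ hε.1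
    (by positivity : 0 < θ / (24 * Q * a ^ 2 * c₁))
  obtain ⟨Aν, hAν, hEν⟩ := exists_prefit_noise_tail_le hM hnM hγ hbseq (v := 16 * v₀) ha hd
    (by positivity : 0 < θ / (12 * Q)) (half_pos hc₁)
  obtain ⟨Aβ, hAβ, hEβ⟩ := exists_bias_tail_le (v := 16 * v₀)
    (C := 1 + 2 * (2 * upperValue α + (v₀ + T₀))) ha hd
    (by positivity : 0 < 2 * TV + (v₀ + T₀) + 4 * upperValue α) (by positivity) hCb
    (by positivity : 0 < θ / (12 * Q)) (half_pos hc₁)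
  obtain ⟨A₆, hA₆, hES⟩ := exists_kernel_noise_tail_le (d := d) ha hv hKb hr₀ hθ hK.nonneg hKle
  obtain ⟨C, hC, hconv⟩ := exists_le_mul_one_sub_stdNormalCDF
  -- Noise and bias of the pre-fit share e_n, hence the minimum. No alternative produces g_n, so its
  -- constant is arbitrary. In T₀ + 9, T₀ pays for the truncation event and 9 = 1 + 2 + 2 + 1 + 1 +
  -- 2 for the six alternatives.
  refine ⟨C, 2 * C, 2 * C, T₀ + 9, A₁, A₂, min Aν Aβ, A₄, 1, A₆, hC, by positivity, by positivity,
    by positivity, hA₁, hA₂, by positivity, hA₄, one_pos, hA₆, ?_⟩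
  have hbb : ∀ᶠ J in atTop, b J ≤ min b₀ 1 :=
    (hb.eventually_lt_const (by positivity : (0 : ℝ) < min b₀ 1)).mono fun _ => le_of_lt
  filter_upwards [hnoise, hED, hEU, hEU', hEν, hEβ, hES, hW, hrange, hδ₁,
    hrate₁.eventually_ge_atTop 0, hrate₂.eventually_ge_atTop 0, hrate₃,
    hnb.eventually_gt_atTop 0, hbb, hM.eventually_ge_atTop 1, hnM.eventually_ge_atTop 3,
    tendsto_log_nObs.eventually_gt_atTop 0, eventually_le_log_rpow hd (1 / a),
    tendsto_nObs.eventually_ge_atTop (v₀ + T₀),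
    hM.eventually_ge_atTop ⌈2 * L * (v₀ + T₀) * c₁ / θ⌉₊,
    hM.eventually_ge_atTop ⌈24 * c₁ * Q * a ^ 2 * (v₀ + T₀) / θ⌉₊]
    with J hnJ hEDJ hEUJ hEU'J hEνJ hEβJ hESJ hWJ hrangeJ hδ₁J hrA hrE hrH hnbJ hbJ hMJ hnMJ hl hℓ
      hnr hMr hMr' p hp
  obtain ⟨j, k⟩ := p
  have hn := nObs_cast_pos J
  have hbpos : 0 < b J := pos_of_mul_pos_right hnbJ hn.le
  have hM0 : (0 : ℝ) < M J := by exact_mod_cast hMJ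
  have hM1 : (1 : ℝ) ≤ M J := by exact_mod_cast hMJ
  have hℓ0 : 0 < Real.log (nObs J) ^ d := by positivity
  have hδ0 : 0 < δ J := lt_of_le_of_lt (by positivity) hrH
  rw [hδ' J] at hrE ⊢
  obtain ⟨hA1, hA2, hA3⟩ := rateA_consequences hrA hδ₁J.2.le hMJ
  obtain ⟨hE1, hE2, hE3⟩ := rateE_consequences hrE hδ₁J.1.le hδ0.le
  have hlm2 : Real.log (nObs J) ^ (-2 * d) = ((Real.log (nObs J) ^ d) ^ 2)⁻¹ := by
    rw [show -2 * d = -(d * 2) by ring, Real.rpow_neg hl.le, Real.rpow_mul hl.le, Real.rpow_ofNat]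
  have hB1 : 1 ≤ a * Real.log (nObs J) ^ d := by rw [div_le_iff₀ ha] at hℓ; linarith
  rw [le_div_iff₀ hM0] at hnMJ
  obtain ⟨hN, hbad, hsq⟩ := hnJ
  obtain ⟨e, ζ, hζ, her, hξB, hη, hζe⟩ := hN.exists_centred hn
  have he1 : ∀ t ∈ Finset.Icc 1 (nObs J), |e t| ≤ 1 := fun t ht =>
    (her t ht).trans ((div_le_one hn).2 hnr)
  have hdm : ∀ t ∈ Finset.Icc 1 (nObs J), designValue α J t ∈ α '' Set.Icc 0 1 := fun t ht =>
    designValue_mem_range α ht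
  obtain ⟨hβ, hβsum⟩ := hα.prefit_bias_le hr₀.le hMJ her
  obtain ⟨hr1, hx2, hr2⟩ := bias_le_thresholds hn hc₁ hθ hL hQ0 ha hℓ0 hδ0.le rfl hB1
    (Nat.ceil_le.1 hMr) (Nat.ceil_le.1 hMr') hA2 (hlm2 ▸ hE1)
  generalize hu : localMean J (κ J) j k (designValue α J) = u
  have hur : u ∈ α '' Set.Icc 0 1 := hu ▸ hrangeJ _ hp
  have hlip : ∀ t ∈ Finset.Icc 1 (nObs J),
      |h (designValue α J t) - h u| ≤ H * |designValue α J t - u| := fun t ht => by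
    have := hH.dist_le_mul _ (hdm t ht) _ hur
    rwa [Real.dist_eq, Real.dist_eq] at this
  have hkern : nObs J * b J * c₁ ≤
      ∑ t ∈ Finset.Icc 1 (nObs J), K ((designValue α J t - u) / b J) := by
    have h1 := (hc u hur).trans (hWJ u hur)
    simp only [kernelWeight] at h1
    rw [← Finset.mul_sum, one_div, ← div_eq_inv_mul, le_div_iff₀ hnbJ] at h1
    linarith
  have hscale := minScalePow_le hp.1 (1 / 2)
  have hscale0 := minScalePow_nonneg ε J (1 / 2)
  have hs0 : (0 : ℝ) < (2 : ℝ) ^ ((1 / 2 : ℝ) * (J - j)) := by positivity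
  have hm1 : (1 : ℝ) ≤ (2 * M J + 1 : ℕ) := by push_cast; linarith
  have hmn : ((2 * M J + 1 : ℕ) : ℝ) ≤ nObs J := by push_cast; linarith
  have hunion := measureReal_deviation_le (μ := P J) (X := X J) hK.nonneg hK.support hKle hKb hKL hL hbpos
    (hbJ.trans (min_le_right _ _)) H.2 hrH.le hu hlip
    (fun t ht => by rw [abs_of_nonneg (hhb _ (hdm t ht)).1]; exact (hhb _ (hdm t ht)).2) hb'0.le hθ
    (hκ.nonneg J _ hp) (hκ.sum_one J _ hp) hζe her hξB hβ hQ.symm hr1 hr2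
  have hmcast : (2 * (M J : ℝ) + 1) = (2 * M J + 1 : ℕ) := by push_cast; ring
  rw [hmcast]
  have hq3 : 0 ≤ ((nObs J : ℝ) ^ 3)⁻¹ := by positivity
  have hq2 : 0 ≤ ((nObs J : ℝ) ^ 2)⁻¹ := by positivity
  -- The window sums carry the remainder n⁻³, because their factor 2M + 1 ≤ n must leave n⁻².
  refine add_tail_bounds_le hC.le hm1 hmn hq3 (le_of_eq (by field_simp)) (stdNormalCDF_le_one _)
    (stdNormalCDF_le_one _) (stdNormalCDF_le_one _)
    hunion hbad ?_ ?_ ?_ ?_ ?_ ?_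
  · refine hconv _ _ _ _ measureReal_le_one hm1 hq3 fun hz => ?_
    exact hEDJ _ (P J) ζ hζ e (b J) u _ _ hbpos (hbJ.trans (min_le_left _ _)) her hkern hA1 hA2 hA3
      (min_le_left _ _) (min_le_right _ _) hz
  · refine hconv _ _ _ _ measureReal_le_one one_le_two hq2 fun hz => ?_
    refine hEUJ _ (P J) ζ hζ j hp.1 (κ J j k) (hκ.nonneg J _ hp) (hκmax J _ hp) (hκsq J _ hp) _ _ _
      (by positivity) ?_ (min_le_left _ _) hz
    calc θ / (2 * L * c₁) * rateC ε J (b J) (δ₁ J)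
        ≤ θ / (2 * L * c₁) * (c₁ * b J ^ 2 * (2 : ℝ) ^ ((1 / 2 : ℝ) * (J - j))) := by
          unfold rateC
          have := hδ₁J.1
          gcongr
          exact hδ₁J.2.le
      _ = _ := by field_simp
  · refine hconv _ _ _ _ measureReal_le_one one_le_two hq2 fun hz => ?_
    refine hEU'J _ (P J) ζ hζ j hp.1 (κ J j k) (hκ.nonneg J _ hp) (hκmax J _ hp) (hκsq J _ hp) _ _ _
      (by positivity) ?_ (min_le_left _ _) hz
    have h1 : δ J * (c₁ - δ₁ J) / 2 ≤ δ J * c₁ / 2 := by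
      have := hδ₁J.1
      gcongr
      linarith
    have h2 : 0 ≤ δ J * (c₁ - δ₁ J) / 2 := by
      have := sub_pos.2 hδ₁J.2
      positivity
    calc θ / (24 * Q * a ^ 2 * c₁) * rateF ε d J (b J) (δ J * (c₁ - δ₁ J) / 2)
        ≤ θ / (24 * Q * a ^ 2 * c₁) * (δ J * c₁ / 2 * b J ^ 2 *
            (2 : ℝ) ^ ((1 / 2 : ℝ) * (J - j)) * ((Real.log (nObs J) ^ d) ^ 2)⁻¹) := by
          unfold rateF
          rw [hlm2]
          gcongr
      _ = θ * δ J * b J ^ 2 / (48 * Q * (a * Real.log (nObs J) ^ d) ^ 2) *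
            (2 : ℝ) ^ ((1 / 2 : ℝ) * (J - j)) := by field_simp; ring
      _ ≤ _ := by gcongr
  · refine hconv _ _ _ _ measureReal_le_one hm1 hq3 fun hz => ?_
    exact hEνJ _ (P J) ζ hζ e (b J) (δ J) _ _ he1 hξB hE2 hE3
      ((min_le_left _ _).trans (by gcongr; exact min_le_left _ _)) (min_le_right _ _) hz
  · refine hconv _ _ _ _ measureReal_le_one le_rfl hq2 fun hz => ?_
    rw [one_mul]
    exact hEβJ _ (P J) ζ hζ e _ (M J) (b J) (δ J) _ _ hM0 (by linarith) hδ0 he1 hξB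
      (fun t _ => abs_nonneg _) hβ hβsum hE1 hE3
      ((min_le_left _ _).trans (by gcongr; exact min_le_right _ _)) hz
  · refine hconv _ _ _ _ measureReal_le_one one_le_two hq2 fun hz => ?_
    exact hESJ _ (P J) ζ hζ e (fun t => h (designValue α J t)) (designValue α J) (b J) _ u _ hbpos
      (sub_nonneg.2 hrH.le) he1 hξB (fun t ht => by rw [← hsq t ht]; exact hη t ht)
      (min_le_left _ _) hz
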